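/- Let $U\subseteq\mathbb R^n$ be open, with coordinates $u=(u^1,\dots,u^n)$, and let $$\mathcal A^{ij}=g_{\mathcal A}^{ij}(u)\,\partial_x+b_{\mathcal A,k}^{ij}(u)\,u^k_x+\omega_{\mathcal A}^{ij}(u),\qquad \mathcal B^{ij}=g_{\mathcal B}^{ij}(u)\,\partial_x+b_{\mathcal B,k}^{ij}(u)\,u^k_x+\omega_{\mathcal B}^{ij}(u)$$ be two operators of type $(1+0)$ with coefficients smooth on $U$, non-degenerate ($\det g_{\mathcal A}\ne0$ and $\det g_{\mathcal B}\neq 0$ everywhere on $U$) and Hamiltonian. An operator $\mathcal C$ is called Hamiltonian if its bracket $\{F,G\}_{\mathcal C}=\int \frac{\delta f}{\delta u^i}\,\mathcal C^{ij}\frac{\delta g}{\delta u^j}\,dx$ on local functionals $F=\int f\,dx$, $G=\int g\,dx$ is skew-symmetric and satisfies the Jacobi identity; here densities are smooth functions of $x$, $u\in U$ and finitely many $x$-derivatives of $u$, and functionals are densities modulo total $x$-derivatives. The operators $\mathcal A,\mathcal B$ are called compatible if $\mu\mathcal A+\nu\mathcal B$ is Hamiltonian for all $\mu,\nu\in\mathbb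 R$. For a contravariant metric $g^{ij}$ let $\Gamma^j_{sk}$, $R^j{}_{skl}$ and $\nabla$ be the Christoffel symbols, the curvature and the Levi-Civita connection of the inverse metric $g_{ij}$, and put $\Gamma^{ij}_k=-g^{is}\Gamma^j_{sk}$, $R^{ij}_{kl}=g^{is}R^j{}_{skl}$, $\nabla^i=g^{is}\nabla_s$. For $\mu\in\mathbb R$ put $g_\mu=g_{\mathcal A}+\mu\,g_{\mathcal B}$ and $\omega_\mu=\omega_{\mathcal A}+\mu\,\omega_{\mathcal B}$. Then $\mathcal A$ and $\mathcal B$ are compatible if and only if $(g_{\mathcal A},g_{\mathcal B})$ and $(\omega_{\mathcal A},\omega_{\mathcal B})$ form a bi-pencil $(g_\mu,\omega_\mu)$, i.e. 1. the metrics form a pencil: for every $\mu\in\mathbb R$, at every point of $U$ where $\det(g_{\mathcal A}+\mu\,g_{\mathcal B})\neq0$, one has $\Gamma^{ij}_{\mu,k}=\Gamma^{ij}_{\mathcal A,k}+\mu\,\Gamma^{ij}_{\mathcal B,k}$ and $R^{ij}_{\mu,kl}=R^{ij}_{\mathcal A,kl}+\mu\,R^{ij}_{\mathcal B,kl}$;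 2. the ultralocal terms form a pencil: for every $\mu\in\mathbb R$, $\omega_\mu$ is a Poisson tensor on $U$, i.e. it is skew-symmetric and $\omega_\mu^{is}\partial_s\omega_\mu^{jk}+\omega_\mu^{js}\partial_s\omega_\mu^{ki}+\omega_\mu^{ks}\partial_s\omega_\mu^{ij}=0$; 3. for every $\mu\in\mathbb R$, on the set where $\det(g_{\mathcal A}+\mu\,g_{\mathcal B})\neq0$, the tensor $\omega_\mu$ is Killing–Yano for $g_\mu$: it is skew-symmetric and $\nabla_\mu^i\omega_\mu^{jk}+\nabla_\mu^j\omega_\mu^{ik}=0$. In particular, if $\det(g_{\mathcal A}+\mu\,g_{\mathcal B})\neq0$ for all $\mu$ and at all points of $U$, conditions 1 and 3 are required for all $\mu$ on all of $U$. -/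

import Mathlib

open scoped ContDiff

/-! ### Formal calculus of variations in one independent variable `x`

The field variables `u = (u¹, …, uⁿ)` take values in an open set `U ⊆ ℝⁿ`. -/

/-- Jets of the field variables: `j k i` is the coordinate `uⁱ_{kx}`, so `j 0 = u`. -/
abbrev Jet (n : ℕ) : Type := ℕ → Fin n → ℝ

/-- Differential functions over `U`: smooth functions of `x`, `u` and finitely many
`x`-derivatives of `u`. Values at jets with `u ∉ U` are irrelevant. -/
def IsDiffFun {n : ℕ} (U : Set (Fin n → ℝ)) (f : ℝ → Jet n → ℝ) : Prop :=
  ∃ (N : ℕ) (φ : ℝ × (Fin (N + 1) → Fin n → ℝ) → ℝ),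
    ContDiffOn ℝ ∞ φ {p | p.2 0 ∈ U} ∧
    ∀ x j, j 0 ∈ U → f x j = φ (x, fun k => j k)

/-- The partial derivative `∂f/∂uⁱ_{kx}`. -/
noncomputable def jetPartial {n : ℕ} (k : ℕ) (i : Fin n) (f : ℝ → Jet n → ℝ) :
    ℝ → Jet n → ℝ :=
  fun x j => deriv (fun t => f x (Function.update j k (Function.update (j k) i t))) (j k i)

/-- The total derivative `∂ₓ f = ∂f/∂x + ∑ₖ ∑ᵢ uⁱ_{(k+1)x} ∂f/∂uⁱ_{kx}`
(a finite sum for every differential function). -/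
noncomputable def totalDeriv {n : ℕ} (f : ℝ → Jet n → ℝ) : ℝ → Jet n → ℝ :=
  fun x j => deriv (fun s => f s j) x +
    ∑ᶠ k : ℕ, ∑ i : Fin n, j (k + 1) i * jetPartial k i f x j

/-- The variational derivative `δf/δuⁱ = ∑ₖ (-∂ₓ)ᵏ (∂f/∂uⁱ_{kx})`. -/
noncomputable def varDeriv {n : ℕ} (i : Fin n) (f : ℝ → Jet n → ℝ) : ℝ → Jet n → ℝ :=
  fun x j => ∑ᶠ k : ℕ, (-1 : ℝ) ^ k * (totalDeriv^[k] (jetPartial k i f)) x j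

/-- The functional `∫ f dx` vanishes: functionals are differential functions modulo total
`x`-derivatives of differential functions. -/
def FunctionalIsZero {n : ℕ} (U : Set (Fin n → ℝ)) (f : ℝ → Jet n → ℝ) : Prop :=
  ∃ q, IsDiffFun U q ∧ ∀ x j, j 0 ∈ U → f x j = totalDeriv q x j

/-! ### Operators of type (1+0) -/

/-- The operator `gⁱʲ(u) ∂ₓ + bⁱʲₖ(u) uᵏₓ + ωⁱʲ(u)`; here `b u i j k` is `bⁱʲₖ(u)` and
`w u i j` is `ωⁱʲ(u)`. -/
structure HydroOp (n : ℕ) where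
  g : (Fin n → ℝ) → Matrix (Fin n) (Fin n) ℝ
  b : (Fin n → ℝ) → Fin n → Fin n → Fin n → ℝ
  w : (Fin n → ℝ) → Matrix (Fin n) (Fin n) ℝ

namespace HydroOp

variable {n : ℕ}

/-- The coefficients are smooth on `U`. -/
structure IsSmoothOn (A : HydroOp n) (U : Set (Fin n → ℝ)) : Prop where
  g : ∀ i j, ContDiffOn ℝ ∞ (fun u => A.g u i j) U
  b : ∀ i j k, ContDiffOn ℝ ∞ (fun u => A.b u i j k) U
  w : ∀ i j, ContDiffOn ℝ ∞ (fun u => A.w u i j) U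

/-- The leading coefficient is everywhere invertible. -/
def IsNondegenerate (A : HydroOp n) (U : Set (Fin n → ℝ)) : Prop :=
  ∀ u ∈ U, (A.g u).det ≠ 0

/-- The linear combination `μ A + ν B`. -/
def linComb (μ : ℝ) (A : HydroOp n) (ν : ℝ) (B : HydroOp n) : HydroOp n where
  g := fun u => μ • A.g u + ν • B.g u
  b := fun u => μ • A.b u + ν • B.b u
  w := fun u => μ • A.w u + ν • B.w u

/-- The `i`-th component `Aⁱʲ ψⱼ` of the operator applied to a covector `ψ` of differential
functions. -/
noncomputable def apply (A : HydroOp n) (ψ : Fin n → ℝ → Jet n → ℝ) (i : Fin n) :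
    ℝ → Jet n → ℝ :=
  fun x j => ∑ l, (A.g (j 0) i l * totalDeriv (ψ l) x j
    + (∑ k, A.b (j 0) i l k * j 1 k) * ψ l x j + A.w (j 0) i l * ψ l x j)

/-- A density `(δf/δuⁱ) Aⁱʲ (δg/δuʲ)` of the bracket `{∫ f dx, ∫ g dx}` of `A`. -/
noncomputable def bracket (A : HydroOp n) (f g : ℝ → Jet n → ℝ) : ℝ → Jet n → ℝ :=
  fun x j => ∑ i, varDeriv i f x j * A.apply (fun l => varDeriv l g) i x j

/-- The operator is Hamiltonian over `U`: its bracket on functionals is skew-symmetric and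
satisfies the Jacobi identity. -/
structure IsHamiltonian (A : HydroOp n) (U : Set (Fin n → ℝ)) : Prop where
  skew : ∀ f g, IsDiffFun U f → IsDiffFun U g →
    FunctionalIsZero U (A.bracket f g + A.bracket g f)
  jacobi : ∀ f g h, IsDiffFun U f → IsDiffFun U g → IsDiffFun U h →
    FunctionalIsZero U (A.bracket (A.bracket f g) h + A.bracket (A.bracket g h) f
      + A.bracket (A.bracket h f) g)

/-- Two operators are compatible if all their linear combinations are Hamiltonian. -/
def AreCompatible (A B : HydroOp n) (U : Set (Fin n → ℝ)) : Prop :=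
  ∀ μ ν : ℝ, (linComb μ A ν B).IsHamiltonian U

end HydroOp

/-! ### Contravariant metrics, Poisson tensors and bi-pencils -/

/-- `∂f/∂uᵏ` at `u`. -/
noncomputable def pderiv {n : ℕ} (k : Fin n) (f : (Fin n → ℝ) → ℝ) (u : Fin n → ℝ) : ℝ :=
  fderiv ℝ f u (Pi.single k 1)

/-- The Christoffel symbol `Γⁱ_{jk}` of the covariant metric `g_{ij}` inverse to the
contravariant metric `gⁱʲ`. -/
noncomputable def christoffel {n : ℕ} (g : (Fin n → ℝ) → Matrix (Fin n) (Fin n) ℝ)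
    (i j k : Fin n) (u : Fin n → ℝ) : ℝ :=
  (1 / 2) * ∑ l, g u i l * (pderiv j (fun v => (g v)⁻¹ l k) u
    + pderiv k (fun v => (g v)⁻¹ l j) u - pderiv l (fun v => (g v)⁻¹ j k) u)

/-- `Γⁱʲₖ = - gⁱˢ Γʲ_{sk}`. -/
noncomputable def contraChristoffel {n : ℕ} (g : (Fin n → ℝ) → Matrix (Fin n) (Fin n) ℝ)
    (i j k : Fin n) (u : Fin n → ℝ) : ℝ :=
  -∑ s, g u i s * christoffel g j s k u

/-- The Riemann curvature
`Rʲ_{skl} = ∂ₖ Γʲ_{ls} - ∂ₗ Γʲ_{ks} + Γʲ_{km} Γᵐ_{ls} - Γʲ_{lm} Γᵐ_{ks}`. -/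
noncomputable def riemann {n : ℕ} (g : (Fin n → ℝ) → Matrix (Fin n) (Fin n) ℝ)
    (j s k l : Fin n) (u : Fin n → ℝ) : ℝ :=
  pderiv k (christoffel g j l s) u - pderiv l (christoffel g j k s) u
    + ∑ m, (christoffel g j k m u * christoffel g m l s u
      - christoffel g j l m u * christoffel g m k s u)

/-- `Rⁱʲ_{kl} = gⁱˢ Rʲ_{skl}`. -/
noncomputable def contraRiemann {n : ℕ} (g : (Fin n → ℝ) → Matrix (Fin n) (Fin n) ℝ)
    (i j k l : Fin n) (u : Fin n → ℝ) : ℝ :=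
  ∑ s, g u i s * riemann g j s k l u

/-- `∇ⁱ πʲᵏ = gⁱˢ (∂ₛ πʲᵏ + Γʲ_{sm} πᵐᵏ + Γᵏ_{sm} πʲᵐ)`, for the Levi-Civita connection. -/
noncomputable def contraCovDeriv {n : ℕ} (g π : (Fin n → ℝ) → Matrix (Fin n) (Fin n) ℝ)
    (i j k : Fin n) (u : Fin n → ℝ) : ℝ :=
  ∑ s, g u i s * (pderiv s (fun v => π v j k) u
    + ∑ m, (christoffel g j s m u * π u m k + christoffel g k s m u * π u j m))

/-- `π` is a Killing–Yano (2,0)-tensor for the metric `g` on `V`. -/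
structure IsKillingYanoOn {n : ℕ} (V : Set (Fin n → ℝ))
    (g π : (Fin n → ℝ) → Matrix (Fin n) (Fin n) ℝ) : Prop where
  skew : ∀ u ∈ V, ∀ i j, π u i j = -π u j i
  killing : ∀ u ∈ V, ∀ i j k, contraCovDeriv g π i j k u + contraCovDeriv g π j i k u = 0

/-- `w` is a Poisson tensor on `U`. -/
structure IsPoissonOn {n : ℕ} (U : Set (Fin n → ℝ))
    (w : (Fin n → ℝ) → Matrix (Fin n) (Fin n) ℝ) : Prop where
  skew : ∀ u ∈ U, ∀ i j, w u i j = -w u j i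
  jacobi : ∀ u ∈ U, ∀ i j k, ∑ s, (w u i s * pderiv s (fun v => w v j k) u
    + w u j s * pderiv s (fun v => w v k i) u + w u k s * pderiv s (fun v => w v i j) u) = 0

/-- The member `T_μ = T_A + μ T_B` of a pencil. -/
def pencil {n : ℕ} (TA TB : (Fin n → ℝ) → Matrix (Fin n) (Fin n) ℝ) (μ : ℝ) :
    (Fin n → ℝ) → Matrix (Fin n) (Fin n) ℝ :=
  fun u => TA u + μ • TB u

/-- The points of `U` at which `det g ≠ 0`, i.e. where the contravariant tensor `g` is a metric. -/
def nondegLocus {n : ℕ} (U : Set (Fin n → ℝ))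
    (g : (Fin n → ℝ) → Matrix (Fin n) (Fin n) ℝ) : Set (Fin n → ℝ) :=
  {u | u ∈ U ∧ (g u).det ≠ 0}

/-- The contravariant metrics form a pencil `g_μ` of compatible metrics: wherever
`det (g_A + μ g_B) ≠ 0`, the Christoffel symbols and the curvature with raised index are
`Γ_μ = Γ_A + μ Γ_B` and `R_μ = R_A + μ R_B`. -/
structure IsMetricPencil {n : ℕ} (U : Set (Fin n → ℝ))
    (gA gB : (Fin n → ℝ) → Matrix (Fin n) (Fin n) ℝ) : Prop where
  christoffel : ∀ μ : ℝ, ∀ u ∈ nondegLocus U (pencil gA gB μ), ∀ i j k,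
    contraChristoffel (pencil gA gB μ) i j k u
      = contraChristoffel gA i j k u + μ * contraChristoffel gB i j k u
  curvature : ∀ μ : ℝ, ∀ u ∈ nondegLocus U (pencil gA gB μ), ∀ i j k l,
    contraRiemann (pencil gA gB μ) i j k l u
      = contraRiemann gA i j k l u + μ * contraRiemann gB i j k l u

/-- The pairs `(g_A, g_B)` and `(ω_A, ω_B)` form the bi-pencil `(g_μ, ω_μ)`. -/
structure IsBiPencil {n : ℕ} (U : Set (Fin n → ℝ))
    (gA gB wA wB : (Fin n → ℝ) → Matrix (Fin n) (Fin n) ℝ) : Prop where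
  metric : IsMetricPencil U gA gB
  poisson : ∀ μ : ℝ, IsPoissonOn U (pencil wA wB μ)
  killingYano : ∀ μ : ℝ, IsKillingYanoOn (nondegLocus U (pencil gA gB μ))
    (pencil gA gB μ) (pencil wA wB μ)

/-! The bracket conditions are turned into pointwise identities between the coefficients of an
operator `g ∂ₓ + b uₓ + ω` and their derivatives. Skew-symmetry amounts to linear identities: `g` is
symmetric, `∂ₗ gⁱʲ = bⁱʲₗ + bʲⁱₗ`, and `ω` is skew. Given these, the Jacobi density of three
functionals equals, modulo total derivatives, a trivector in their variational derivatives ψ, φ, χ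
(`jacobi_sub_trivector_mem_exact`). Its coefficients yield six families of identities, all quadratic
in the operator: torsion, curvature, Killing, Poisson, mixed and quadratic. If all six hold, the
trivector is the total derivative of `Σ Kⁱʲᵐ ψᵢ φⱼ χₘ`, where `K` is the Killing term. Conversely,
the functionals `∫ a(x) uⁱ dx`, `∫ uʲ dx` and `∫ ½ (uᵐ - u₀ᵐ)² dx`, tested with the Euler operator
at constant jets, force the first four families (`isJacobiAt`).

For non-degenerate `g` these four families suffice and are geometric. The skew and torsion
identities identify `b` with the contravariant Christoffel symbols, the curvature identity says that
`g` is flat, `K` is `∇ⁱ ωʲᵐ`, and its cyclic invariance is the Killing–Yano equation. The other two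
families follow: the quadratic one holds for every flat metric (`flat_quadratic`), and the mixed one
expresses `∇∇ω = 0`, which holds for every Killing–Yano bivector of a flat metric (`flat_mixed`).

Compatibility therefore gives a bi-pencil: where `g_μ` is invertible, `Γ_μ` is the coefficient
`b_μ`, linear in `μ`, and all curvatures vanish. For the converse, `g_μ` may degenerate, so the
geometric description is not available for every member. But at a given point `g_A + μ g_B` is
invertible for `μ = 0, ±δ` with `δ` small, and there all six families hold. Each of them is a
quadratic form in the coefficients of `μ A + ν B`, and a binary quadratic form vanishing at `(1,
0)`, `(1, δ)`, `(1, -δ)` is zero (`isJacobi_linComb`). Hence every linear combination is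
Hamiltonian. -/

/-- A ring of differential functions, abstractly: partial derivatives `P k i = ∂/∂uⁱ_{kx}`
and a total derivative `D` with the usual commutation relations. -/
structure VarCalc (n : ℕ) (R : Type*) [CommRing R] [Algebra ℝ R] where
  P : ℕ → Fin n → Derivation ℝ R R
  D : Derivation ℝ R R
  finite_order : ∀ f, ∃ N, ∀ k, N ≤ k → ∀ i, P k i f = 0
  comm : ∀ k i l j f, P k i (P l j f) = P l j (P k i f)
  comm_zero : ∀ i f, P 0 i (D f) = D (P 0 i f)
  comm_succ : ∀ k i f, P (k + 1) i (D f) = D (P (k + 1) i f) + P k i f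

/-! ### Evolutionary vector fields and the Euler operator -/

namespace VarCalc

variable {n : ℕ} {R : Type*} [CommRing R] [Algebra ℝ R] (C : VarCalc n R)

/-- `f` involves only derivatives of order `< N`. -/
def HasOrder (f : R) (N : ℕ) : Prop := ∀ k, N ≤ k → ∀ i, C.P k i f = 0

variable {C} in
theorem HasOrder.mono {f : R} {N M : ℕ} (h : C.HasOrder f N) (hNM : N ≤ M) : C.HasOrder f M :=
  fun k hk i => h k (hNM.trans hk) i

variable {C} in
theorem HasOrder.totalDeriv {f : R} {N : ℕ} (h : C.HasOrder f N) : C.HasOrder (C.D f) (N + 1) := by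
  intro k hk i
  obtain ⟨k, rfl⟩ : ∃ m, k = m + 1 := ⟨k - 1, by omega⟩
  rw [C.comm_succ, h (k + 1) (by omega), h k (by omega)]
  simp

theorem exists_hasOrder (f : R) : ∃ N, C.HasOrder f N := C.finite_order f

theorem exists_hasOrder_pair (f g : R) : ∃ N, C.HasOrder f N ∧ C.HasOrder g N := by
  obtain ⟨N, hN⟩ := C.exists_hasOrder f
  obtain ⟨M, hM⟩ := C.exists_hasOrder g
  exact ⟨max N M, hN.mono (le_max_left _ _), hM.mono (le_max_right _ _)⟩

/-- The prolongation of the evolutionary vector field with characteristic `V`. -/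
noncomputable def pr (V : Fin n → R) (f : R) : R :=
  ∑ᶠ k : ℕ, ∑ i, C.D^[k] (V i) * C.P k i f

/-- The variational derivative. -/
noncomputable def euler (i : Fin n) (f : R) : R :=
  ∑ᶠ k : ℕ, (-1 : R) ^ k * C.D^[k] (C.P k i f)

theorem iterate_D_zero (k : ℕ) : C.D^[k] (0 : R) = 0 := by
  induction k with
  | zero => rfl
  | succ k ih => rw [Function.iterate_succ_apply', ih, map_zero]

theorem iterate_D_sub (k : ℕ) (f g : R) : C.D^[k] (f - g) = C.D^[k] f - C.D^[k] g := by
  induction k with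
  | zero => rfl
  | succ k ih => simp only [Function.iterate_succ_apply', ih, map_sub]

theorem iterate_D_add (k : ℕ) (f g : R) : C.D^[k] (f + g) = C.D^[k] f + C.D^[k] g := by
  induction k with
  | zero => rfl
  | succ k ih => simp only [Function.iterate_succ_apply', ih, map_add]

theorem finsum_eq_sum_range {M : Type*} [AddCommMonoid M] {F : ℕ → M} {N : ℕ}
    (h : ∀ k, N ≤ k → F k = 0) : ∑ᶠ k, F k = ∑ k ∈ Finset.range N, F k := by
  apply finsum_eq_sum_of_support_subset
  intro k hk
  by_contra hk'
  simp only [Finset.coe_range, Set.mem_Iio, not_lt] at hk'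
  exact hk (h k hk')

theorem pr_eq_sum {f : R} {N : ℕ} (h : C.HasOrder f N) (V : Fin n → R) :
    C.pr V f = ∑ k ∈ Finset.range N, ∑ i, C.D^[k] (V i) * C.P k i f :=
  finsum_eq_sum_range fun k hk => Finset.sum_eq_zero fun i _ => by rw [h k hk, mul_zero]

theorem euler_eq_sum {f : R} {N : ℕ} (h : C.HasOrder f N) (i : Fin n) :
    C.euler i f = ∑ k ∈ Finset.range N, (-1 : R) ^ k * C.D^[k] (C.P k i f) :=
  finsum_eq_sum_range fun k hk => by rw [h k hk, C.iterate_D_zero, mul_zero]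

theorem pr_add (V : Fin n → R) (f g : R) : C.pr V (f + g) = C.pr V f + C.pr V g := by
  obtain ⟨N, hf, hg⟩ := C.exists_hasOrder_pair f g
  have hfg : C.HasOrder (f + g) N := fun k hk i => by rw [map_add, hf k hk, hg k hk, add_zero]
  simp only [C.pr_eq_sum hf, C.pr_eq_sum hg, C.pr_eq_sum hfg, map_add, mul_add,
    Finset.sum_add_distrib]

theorem pr_smul (V : Fin n → R) (c : ℝ) (f : R) : C.pr V (c • f) = c • C.pr V f := by
  obtain ⟨N, hf⟩ := C.exists_hasOrder f
  have hcf : C.HasOrder (c • f) N := fun k hk i => by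
    rw [Derivation.map_smul, hf k hk, smul_zero]
  simp only [C.pr_eq_sum hf, C.pr_eq_sum hcf, Derivation.map_smul, mul_smul_comm,
    Finset.smul_sum]

theorem pr_mul (V : Fin n → R) (f g : R) :
    C.pr V (f * g) = f * C.pr V g + g * C.pr V f := by
  obtain ⟨N, hf, hg⟩ := C.exists_hasOrder_pair f g
  have hfg : C.HasOrder (f * g) N := fun k hk i => by
    rw [Derivation.leibniz, hf k hk, hg k hk, smul_zero, smul_zero, add_zero]
  simp only [C.pr_eq_sum hf, C.pr_eq_sum hg, C.pr_eq_sum hfg, Derivation.leibniz, smul_eq_mul,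
    Finset.mul_sum, ← Finset.sum_add_distrib]
  refine Finset.sum_congr rfl fun k _ => Finset.sum_congr rfl fun i _ => ?_
  ring

/-- The prolongation as a derivation. -/
noncomputable def prDer (V : Fin n → R) : Derivation ℝ R R :=
  Derivation.mk' { toFun := C.pr V, map_add' := C.pr_add V, map_smul' := C.pr_smul V }
    (C.pr_mul V)

theorem prDer_apply (V : Fin n → R) (f : R) : C.prDer V f = C.pr V f := rfl

/-- The commutator of `∂/∂uⁱ_{kx}` with `D` lowers `k` by one, which matches the extra `D` falling
on the characteristic. -/
theorem prDer_D (V : Fin n → R) (f : R) : C.prDer V (C.D f) = C.D (C.prDer V f) := by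
  simp only [prDer_apply]
  obtain ⟨N, hf⟩ := C.exists_hasOrder f
  rw [C.pr_eq_sum hf.totalDeriv, C.pr_eq_sum (hf.mono (Nat.le_succ N)), map_sum,
    Finset.sum_range_succ', Finset.sum_range_succ']
  simp only [C.comm_succ, C.comm_zero, map_sum, Derivation.leibniz, smul_eq_mul, mul_add,
    Finset.sum_add_distrib, ← Function.iterate_succ_apply' C.D]
  -- Shift of the summation index; the top term drops out since `f` has order below `N`.
  have h1 : ∑ k ∈ Finset.range N, ∑ i, C.D^[k + 1] (V i) * C.P k i f =
      (∑ k ∈ Finset.range N, ∑ i, C.P (k + 1) i f * C.D^[(k + 1).succ] (V i))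
        + ∑ i, C.P 0 i f * C.D^[Nat.succ 0] (V i) := by
    have h2 := Finset.sum_range_succ' (fun k => ∑ i, C.D^[k + 1] (V i) * C.P k i f) N
    have h3 := Finset.sum_range_succ (fun k => ∑ i, C.D^[k + 1] (V i) * C.P k i f) N
    have h4 : ∑ i, C.D^[N + 1] (V i) * C.P N i f = 0 :=
      Finset.sum_eq_zero fun i _ => by rw [hf N le_rfl, mul_zero]
    rw [h4, add_zero] at h3
    rw [← h3, h2]
    congr 1
    · exact Finset.sum_congr rfl fun k _ => Finset.sum_congr rfl fun i _ => mul_comm _ _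
    · exact Finset.sum_congr rfl fun i _ => mul_comm _ _
  rw [h1]
  ring

theorem prDer_iterate_D (V : Fin n → R) (k : ℕ) (f : R) :
    C.prDer V (C.D^[k] f) = C.D^[k] (C.prDer V f) := by
  induction k with
  | zero => rfl
  | succ k ih => simp only [Function.iterate_succ_apply', prDer_D, ih]

/-- The second-order terms are symmetric in `V` and `W` because the partial derivatives commute;
only the derivatives of the characteristics survive. -/
theorem prDer_comm (V W : Fin n → R) (f : R) :
    C.prDer V (C.prDer W f) - C.prDer W (C.prDer V f)
      = C.prDer (fun i => C.prDer V (W i) - C.prDer W (V i)) f := by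
  obtain ⟨N, hf⟩ := C.exists_hasOrder f
  have hP : ∀ k i, C.HasOrder (C.P k i f) N := fun k i l hl j => by
    rw [C.comm, hf l hl, map_zero]
  have key : ∀ V W : Fin n → R, C.prDer V (C.prDer W f)
      = (∑ k ∈ Finset.range N, ∑ i, C.D^[k] (C.prDer V (W i)) * C.P k i f)
        + ∑ k ∈ Finset.range N, ∑ i, ∑ l ∈ Finset.range N, ∑ j,
          C.D^[k] (W i) * (C.D^[l] (V j) * C.P l j (C.P k i f)) := by
    intro V W
    conv_lhs => rw [C.prDer_apply W, C.pr_eq_sum hf]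
    simp only [map_sum, Derivation.leibniz, smul_eq_mul, C.prDer_iterate_D,
      Finset.sum_add_distrib]
    rw [add_comm]
    congr 1
    · exact Finset.sum_congr rfl fun k _ => Finset.sum_congr rfl fun i _ => mul_comm _ _
    · refine Finset.sum_congr rfl fun k _ => Finset.sum_congr rfl fun i _ => ?_
      rw [C.prDer_apply, C.pr_eq_sum (hP k i)]
      simp only [Finset.mul_sum]
  have hsymm : (∑ k ∈ Finset.range N, ∑ i, ∑ l ∈ Finset.range N, ∑ j,
        C.D^[k] (W i) * (C.D^[l] (V j) * C.P l j (C.P k i f)))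
      = ∑ k ∈ Finset.range N, ∑ i, ∑ l ∈ Finset.range N, ∑ j,
        C.D^[k] (V i) * (C.D^[l] (W j) * C.P l j (C.P k i f)) := by
    have : ∀ V W : Fin n → R, (∑ k ∈ Finset.range N, ∑ i, ∑ l ∈ Finset.range N, ∑ j,
        C.D^[k] (W i) * (C.D^[l] (V j) * C.P l j (C.P k i f)))
        = ∑ p ∈ (Finset.range N ×ˢ Finset.univ) ×ˢ (Finset.range N ×ˢ (Finset.univ : Finset (Fin n))),
          C.D^[p.1.1] (W p.1.2) * (C.D^[p.2.1] (V p.2.2) * C.P p.2.1 p.2.2 (C.P p.1.1 p.1.2 f)) := by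
      intro V W
      simp only [Finset.sum_product]
    rw [this V W, this W V]
    refine Finset.sum_equiv (Equiv.prodComm _ _) (fun p => ?_) fun p _ => ?_
    · simp [and_comm]
    · simp only [Equiv.prodComm_apply, Prod.fst_swap, Prod.snd_swap]
      rw [C.comm]
      ring
  rw [key V W, key W V, hsymm, C.prDer_apply, C.pr_eq_sum hf]
  simp only [C.iterate_D_sub, sub_mul, Finset.sum_sub_distrib]
  ring

/-- Total derivatives. -/
noncomputable def exact : Submodule ℝ R := LinearMap.range (C.D : R →ₗ[ℝ] R)

theorem D_mem_exact (f : R) : C.D f ∈ C.exact := ⟨f, rfl⟩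

theorem iterate_D_mul_sub_mem_exact (k : ℕ) (a b : R) :
    C.D^[k] a * b - a * ((-1 : R) ^ k * C.D^[k] b) ∈ C.exact := by
  induction k generalizing b with
  | zero => simp
  | succ k ih =>
    have h1 := ih (C.D b)
    have h2 := C.D_mem_exact (C.D^[k] a * b)
    rw [Derivation.leibniz, smul_eq_mul, smul_eq_mul, ← Function.iterate_succ_apply' C.D] at h2
    convert C.exact.sub_mem h2 h1 using 1
    rw [← Function.iterate_succ_apply C.D k b, pow_succ]
    ring

/-- The first variation formula: all powers of `D` are moved off the characteristic by integration
by parts. -/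
theorem prDer_sub_mem_exact (V : Fin n → R) (f : R) :
    C.prDer V f - ∑ i, V i * C.euler i f ∈ C.exact := by
  obtain ⟨N, hf⟩ := C.exists_hasOrder f
  rw [C.prDer_apply, C.pr_eq_sum hf]
  simp only [C.euler_eq_sum hf, Finset.mul_sum]
  rw [Finset.sum_comm, ← Finset.sum_sub_distrib]
  refine Submodule.sum_mem _ fun i _ => ?_
  rw [← Finset.sum_sub_distrib]
  exact Submodule.sum_mem _ fun k _ => C.iterate_D_mul_sub_mem_exact k _ _

theorem prDer_mem_exact (V : Fin n → R) {f : R} (hf : f ∈ C.exact) : C.prDer V f ∈ C.exact := by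
  obtain ⟨q, rfl⟩ := hf
  exact ⟨C.prDer V q, (C.prDer_D V q).symm⟩

/-- The variational derivative annihilates total derivatives. -/
theorem euler_D (i : Fin n) (f : R) : C.euler i (C.D f) = 0 := by
  obtain ⟨N, hf⟩ := C.exists_hasOrder f
  rw [C.euler_eq_sum hf.totalDeriv, Finset.sum_range_succ']
  simp only [C.comm_succ, C.comm_zero, C.iterate_D_add, mul_add, Finset.sum_add_distrib]
  have h3 := Finset.sum_range_succ (fun k => (-1 : R) ^ k * C.D^[k + 1] (C.P k i f)) N
  rw [hf N le_rfl, C.iterate_D_zero, mul_zero, add_zero, Finset.sum_range_succ'] at h3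
  -- The commutator terms reproduce the remaining sum shifted by one in `k`, hence with the opposite
  -- sign, and the two cancel.
  have h4 : ∑ k ∈ Finset.range N, (-1 : R) ^ (k + 1) * C.D^[k + 1] (C.P k i f)
      = - ∑ k ∈ Finset.range N, (-1 : R) ^ k * C.D^[k + 1] (C.P k i f) := by
    rw [← Finset.sum_neg_distrib]
    exact Finset.sum_congr rfl fun k _ => by ring
  rw [h4, ← h3]
  simp only [← Function.iterate_succ_apply C.D, pow_zero]
  simp

theorem euler_eq_zero_of_mem_exact (i : Fin n) {f : R} (hf : f ∈ C.exact) : C.euler i f = 0 := by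
  obtain ⟨q, rfl⟩ := hf
  exact C.euler_D i q

/-- Linearised variational derivatives are self-adjoint. -/
theorem euler_selfAdjoint (V W : Fin n → R) (f : R) :
    (∑ i, W i * C.prDer V (C.euler i f)) - ∑ i, V i * C.prDer W (C.euler i f) ∈ C.exact := by
  -- The first variation formula for `W`, differentiated along `V`. Antisymmetrising in `V`, `W` and
  -- applying the same formula to the commutator field cancels every term that differentiates a
  -- characteristic.
  have key : ∀ V W : Fin n → R, C.prDer V (C.prDer W f)
      - ∑ i, (W i * C.prDer V (C.euler i f) + C.euler i f * C.prDer V (W i)) ∈ C.exact := by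
    intro V W
    have h := C.prDer_mem_exact V (C.prDer_sub_mem_exact W f)
    simpa only [map_sub, map_sum, Derivation.leibniz, smul_eq_mul] using h
  have h3 := C.prDer_sub_mem_exact (fun i => C.prDer V (W i) - C.prDer W (V i)) f
  rw [← C.prDer_comm] at h3
  have h := C.exact.sub_mem h3 (C.exact.sub_mem (key V W) (key W V))
  convert h using 1
  simp only [Finset.sum_add_distrib, sub_mul, Finset.sum_sub_distrib, mul_comm (C.euler _ f)]
  ring

end VarCalc

/-! ### The bracket of a first-order operator and its trivector -/

namespace VarCalc

variable {n : ℕ} {R : Type*} [CommRing R] [Algebra ℝ R] (C : VarCalc n R)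

/-- `c` is a function of the field variables alone, `ux` being their first `x`-derivatives. -/
structure IsCoeff (ux : Fin n → R) (c : R) : Prop where
  partial_succ : ∀ k i, C.P (k + 1) i c = 0
  total : C.D c = ∑ l, C.P 0 l c * ux l

/-- The coefficients of an operator `gⁱʲ ∂ₓ + bⁱʲₖ uᵏₓ + wⁱʲ` in a ring of differential functions. -/
structure OpData where
  g : Fin n → Fin n → R
  b : Fin n → Fin n → Fin n → R
  w : Fin n → Fin n → R
  ux : Fin n → R
  partial_ux : ∀ k i l, C.P k i (ux l) = if k = 1 ∧ i = l then 1 else 0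
  g_coeff : ∀ i j, C.IsCoeff ux (g i j)
  b_coeff : ∀ i j k, C.IsCoeff ux (b i j k)
  w_coeff : ∀ i j, C.IsCoeff ux (w i j)

variable {C}

theorem IsCoeff.add {ux : Fin n → R} {c d : R} (hc : C.IsCoeff ux c) (hd : C.IsCoeff ux d) :
    C.IsCoeff ux (c + d) where
  partial_succ k i := by rw [map_add, hc.1, hd.1, add_zero]
  total := by simp only [map_add, hc.2, hd.2, add_mul, Finset.sum_add_distrib]

theorem IsCoeff.neg {ux : Fin n → R} {c : R} (hc : C.IsCoeff ux c) : C.IsCoeff ux (-c) where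
  partial_succ k i := by rw [map_neg, hc.1, neg_zero]
  total := by simp only [map_neg, hc.2, neg_mul, Finset.sum_neg_distrib]

theorem IsCoeff.sub {ux : Fin n → R} {c d : R} (hc : C.IsCoeff ux c) (hd : C.IsCoeff ux d) :
    C.IsCoeff ux (c - d) := by
  rw [sub_eq_add_neg]
  exact hc.add hd.neg

theorem IsCoeff.mul {ux : Fin n → R} {c d : R} (hc : C.IsCoeff ux c) (hd : C.IsCoeff ux d) :
    C.IsCoeff ux (c * d) where
  partial_succ k i := by rw [Derivation.leibniz, hc.1, hd.1, smul_zero, smul_zero, add_zero]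
  total := by
    simp only [Derivation.leibniz, hc.2, hd.2, smul_eq_mul, add_mul, Finset.sum_add_distrib,
      Finset.mul_sum, mul_assoc]

theorem IsCoeff.sum {ux : Fin n → R} {ι : Type*} (s : Finset ι) {c : ι → R}
    (hc : ∀ i, C.IsCoeff ux (c i)) : C.IsCoeff ux (∑ i ∈ s, c i) where
  partial_succ k i := by rw [map_sum]; exact Finset.sum_eq_zero fun j _ => (hc j).1 k i
  total := by
    simp only [map_sum, (hc _).2, Finset.sum_mul]
    rw [Finset.sum_comm]

theorem sum_rotate {ι M : Type*} [Fintype ι] [AddCommMonoid M] (G : ι → ι → ι → M) :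
    ∑ i, ∑ j, ∑ l, G i j l = ∑ l, ∑ i, ∑ j, G i j l :=
  (Finset.sum_congr rfl fun _ _ => Finset.sum_comm).trans Finset.sum_comm

namespace OpData

variable (A : C.OpData)

theorem coeff_partial {c : R} (hc : C.IsCoeff A.ux c) (i : Fin n) :
    C.IsCoeff A.ux (C.P 0 i c) where
  partial_succ k j := by rw [C.comm, hc.1, map_zero]
  total := by
    rw [← C.comm_zero, hc.2, map_sum]
    refine Finset.sum_congr rfl fun l _ => ?_
    rw [Derivation.leibniz, A.partial_ux]
    simp only [zero_ne_one, false_and, if_false, smul_eq_mul]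
    rw [C.comm]
    ring

theorem prDer_coeff {c : R} (hc : C.IsCoeff A.ux c) (V : Fin n → R) :
    C.prDer V c = ∑ l, V l * C.P 0 l c := by
  rw [prDer_apply, C.pr_eq_sum (N := 1) (fun k hk i => ?_)]
  · simp
  · obtain ⟨k, rfl⟩ : ∃ m, k = m + 1 := ⟨k - 1, by omega⟩
    exact hc.1 k i

theorem prDer_ux (V : Fin n → R) (l : Fin n) : C.prDer V (A.ux l) = C.D (V l) := by
  rw [prDer_apply, C.pr_eq_sum (N := 2) (fun k hk i => ?_)]
  · simp [Finset.sum_range_succ, A.partial_ux]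
  · rw [A.partial_ux, if_neg (by omega)]

/-- `bⁱʲₖ uᵏₓ`. -/
def bu (i j : Fin n) : R := ∑ k, A.b i j k * A.ux k

/-- The operator applied to a covector. -/
def op (ψ : Fin n → R) (i : Fin n) : R :=
  ∑ l, (A.g i l * C.D (ψ l) + A.bu i l * ψ l + A.w i l * ψ l)

/-- The conditions for skew-symmetry. -/
structure IsSkew : Prop where
  g_symm : ∀ i j, A.g i j = A.g j i
  partial_g : ∀ i j l, C.P 0 l (A.g i j) = A.b i j l + A.b j i l
  w_skew : ∀ i j, A.w i j = -A.w j i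

variable {A}

theorem IsSkew.D_g (hA : A.IsSkew) (i j : Fin n) : C.D (A.g i j) = A.bu i j + A.bu j i := by
  rw [(A.g_coeff i j).2, bu, bu, ← Finset.sum_add_distrib]
  exact Finset.sum_congr rfl fun l _ => by rw [hA.partial_g, add_mul]

/-- Formal skew-adjointness: the symmetric part of `b uₓ` is exactly what `D` produces from `g`. -/
theorem IsSkew.op_skew (hA : A.IsSkew) (ψ φ : Fin n → R) :
    (∑ i, ψ i * A.op φ i) + ∑ i, φ i * A.op ψ i = C.D (∑ i, ∑ l, A.g i l * (ψ i * φ l)) := by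
  simp only [op, Finset.mul_sum, map_sum]
  rw [Finset.sum_comm (f := fun i l => φ i * _), ← Finset.sum_add_distrib]
  refine Finset.sum_congr rfl fun i _ => ?_
  rw [← Finset.sum_add_distrib]
  refine Finset.sum_congr rfl fun l _ => ?_
  rw [Derivation.leibniz, Derivation.leibniz, hA.D_g, hA.g_symm l i, hA.w_skew l i]
  simp only [smul_eq_mul]
  ring

variable (A)

/-- The variation of the coefficients of the operator along `V`, as a bilinear form. -/
noncomputable def variation (V ψ φ : Fin n → R) : R :=
  ∑ i, ∑ l, ψ i * (C.prDer V (A.g i l) * C.D (φ l) + C.prDer V (A.bu i l) * φ l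
    + C.prDer V (A.w i l) * φ l)

theorem prDer_pairing (V ψ φ : Fin n → R) :
    C.prDer V (∑ i, ψ i * A.op φ i) = (∑ i, A.op φ i * C.prDer V (ψ i))
      + (∑ i, ψ i * A.op (fun l => C.prDer V (φ l)) i) + A.variation V ψ φ := by
  rw [map_sum, variation, ← Finset.sum_add_distrib, ← Finset.sum_add_distrib]
  refine Finset.sum_congr rfl fun i _ => ?_
  rw [Derivation.leibniz, ← Finset.mul_sum, smul_eq_mul, smul_eq_mul]
  have : C.prDer V (A.op φ i) = A.op (fun l => C.prDer V (φ l)) i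
      + ∑ l, (C.prDer V (A.g i l) * C.D (φ l) + C.prDer V (A.bu i l) * φ l
        + C.prDer V (A.w i l) * φ l) := by
    simp only [op]
    rw [map_sum, ← Finset.sum_add_distrib]
    refine Finset.sum_congr rfl fun l _ => ?_
    simp only [map_add, Derivation.leibniz, smul_eq_mul, C.prDer_D]
    ring
  rw [this]
  ring

/-- The density of the bracket. -/
noncomputable def bracket (f g : R) : R :=
  ∑ i, C.euler i f * A.op (fun l => C.euler l g) i

/-- The cyclic sum of variations, to which the Jacobi density is equivalent. -/
noncomputable def cyclicVariation (ψ φ χ : Fin n → R) : R :=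
  A.variation (A.op χ) ψ φ + A.variation (A.op ψ) φ χ + A.variation (A.op φ) χ ψ

variable {A}

/-- The outer bracket is, modulo exact terms, the derivative of the inner density along the
Hamiltonian field `V` of `h`. The Leibniz rule splits this derivative, and skew-adjointness moves
the operator off `pr_V (δg)`. -/
theorem IsSkew.bracket_bracket (hA : A.IsSkew) (f g h : R) :
    A.bracket (A.bracket f g) h
      - ((∑ i, A.op (fun l => C.euler l g) i * C.prDer (A.op fun l => C.euler l h) (C.euler i f))
        - (∑ i, A.op (fun l => C.euler l f) i * C.prDer (A.op fun l => C.euler l h) (C.euler i g))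
        + A.variation (A.op fun l => C.euler l h) (fun l => C.euler l f) (fun l => C.euler l g))
      ∈ C.exact := by
  set V := A.op fun l => C.euler l h with hV
  have h1 := C.prDer_sub_mem_exact V (A.bracket f g)
  have h2 : A.bracket (A.bracket f g) h = ∑ i, V i * C.euler i (A.bracket f g) :=
    Finset.sum_congr rfl fun i _ => mul_comm _ _
  have h3 := A.prDer_pairing V (fun l => C.euler l f) (fun l => C.euler l g)
  have h4 := hA.op_skew (fun l => C.euler l f) (fun l => C.prDer V (C.euler l g))
  have h5 := C.D_mem_exact
    (∑ i, ∑ l, A.g i l * (C.euler i f * C.prDer V (C.euler l g)))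
  rw [← h4] at h5
  convert C.exact.sub_mem h5 h1 using 1
  rw [h2, bracket, h3]
  simp only [mul_comm (C.prDer V (C.euler _ g))]
  ring

/-- In the cyclic sum the terms differentiating `δf`, `δg`, `δh` cancel in pairs, because linearised
variational derivatives are self-adjoint. Only the variation of the coefficients is left. -/
theorem IsSkew.jacobi_sub_mem_exact (hA : A.IsSkew) (f g h : R) :
    (A.bracket (A.bracket f g) h + A.bracket (A.bracket g h) f + A.bracket (A.bracket h f) g)
      - A.cyclicVariation (fun l => C.euler l f) (fun l => C.euler l g) (fun l => C.euler l h)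
      ∈ C.exact := by
  have h1 := C.exact.add_mem (C.exact.add_mem (hA.bracket_bracket f g h)
    (hA.bracket_bracket g h f)) (hA.bracket_bracket h f g)
  have h2 := C.exact.add_mem (C.exact.add_mem
    (C.euler_selfAdjoint (A.op fun l => C.euler l h) (A.op fun l => C.euler l g) f)
    (C.euler_selfAdjoint (A.op fun l => C.euler l f) (A.op fun l => C.euler l h) g))
    (C.euler_selfAdjoint (A.op fun l => C.euler l g) (A.op fun l => C.euler l f) h)
  convert C.exact.add_mem h1 h2 using 1
  simp only [cyclicVariation]
  ring

variable (A)

/-- `∂ₗ bⁱʲᵣ - ∂ᵣ bⁱʲₗ`. -/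
def curl (i j l r : Fin n) : R := C.P 0 l (A.b i j r) - C.P 0 r (A.b i j l)

/-- `(∂ₗ bⁱʲᵣ - ∂ᵣ bⁱʲₗ) uʳₓ`. -/
def curlu (i j l : Fin n) : R := ∑ r, A.curl i j l r * A.ux r

/-- The terms of the variation after integrating by parts. -/
def reducedTerm (i j l : Fin n) (p p' q q' : R) : R :=
  A.b j i l * p * q' - A.b i j l * p' * q + (A.curlu i j l + C.P 0 l (A.w i j)) * (p * q)

def reduced (ψ φ : Fin n → R) (l : Fin n) : R :=
  ∑ i, ∑ j, A.reducedTerm i j l (ψ i) (C.D (ψ i)) (φ j) (C.D (φ j))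

theorem prDer_bu (V : Fin n → R) (i j : Fin n) :
    C.prDer V (A.bu i j)
      = ∑ l, ((∑ r, C.P 0 l (A.b i j r) * A.ux r) * V l + A.b i j l * C.D (V l)) := by
  simp only [bu, map_sum, Derivation.leibniz, smul_eq_mul, A.prDer_ux,
    A.prDer_coeff (A.b_coeff _ _ _), Finset.sum_add_distrib, Finset.mul_sum, Finset.sum_mul]
  rw [add_comm, Finset.sum_comm]
  congr 1
  exact Finset.sum_congr rfl fun l _ => Finset.sum_congr rfl fun r _ => by ring

variable {A}

/-- The only derivative of `V` enters through the variation of `uₓ` in `b uₓ`; integrating it by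
parts makes the expression linear over the ring in `V`. The contribution `b i j l * ψ i * D (φ j)`
then cancels against half of `∂ₗ g = b + bᵀ`. -/
theorem IsSkew.variation_sub_mem_exact (hA : A.IsSkew) (V ψ φ : Fin n → R) :
    A.variation V ψ φ - ∑ l, A.reduced ψ φ l * V l ∈ C.exact := by
  have key : A.variation V ψ φ - ∑ l, A.reduced ψ φ l * V l
      = C.D (∑ l, ∑ i, ∑ j, A.b i j l * (ψ i * φ j) * V l) := by
    simp only [variation, reduced, map_sum]
    have h1 : ∀ i j, ψ i * (C.prDer V (A.g i j) * C.D (φ j) + C.prDer V (A.bu i j) * φ j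
        + C.prDer V (A.w i j) * φ j)
        = ∑ l, ψ i * (V l * (A.b i j l + A.b j i l) * C.D (φ j)
          + ((∑ r, C.P 0 l (A.b i j r) * A.ux r) * V l + A.b i j l * C.D (V l)) * φ j
          + V l * C.P 0 l (A.w i j) * φ j) := by
      intro i j
      rw [A.prDer_bu, A.prDer_coeff (A.g_coeff _ _), A.prDer_coeff (A.w_coeff _ _)]
      simp only [Finset.sum_mul, ← Finset.sum_add_distrib, ← Finset.mul_sum, hA.partial_g]
    simp only [h1]
    rw [sum_rotate, ← Finset.sum_sub_distrib]
    refine Finset.sum_congr rfl fun l _ => ?_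
    rw [Finset.sum_mul, ← Finset.sum_sub_distrib]
    refine Finset.sum_congr rfl fun i _ => ?_
    rw [Finset.sum_mul, ← Finset.sum_sub_distrib]
    refine Finset.sum_congr rfl fun j _ => ?_
    simp only [reducedTerm, Derivation.leibniz, smul_eq_mul, (A.b_coeff _ _ _).2, curlu, curl,
      sub_mul, Finset.sum_sub_distrib]
    ring
  rw [key]
  exact C.D_mem_exact _

variable (A)

/-- The trivector of the operator. -/
def trivector (ψ φ χ : Fin n → R) : R :=
  ∑ l, (A.reduced ψ φ l * A.op χ l + A.reduced φ χ l * A.op ψ l + A.reduced χ ψ l * A.op φ l)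

variable {A}

theorem IsSkew.jacobi_sub_trivector_mem_exact (hA : A.IsSkew) (f g h : R) :
    (A.bracket (A.bracket f g) h + A.bracket (A.bracket g h) f + A.bracket (A.bracket h f) g)
      - A.trivector (fun l => C.euler l f) (fun l => C.euler l g) (fun l => C.euler l h)
      ∈ C.exact := by
  have h1 := hA.jacobi_sub_mem_exact f g h
  have h2 := C.exact.add_mem (C.exact.add_mem
    (hA.variation_sub_mem_exact (A.op fun l => C.euler l h) (fun l => C.euler l f)
      (fun l => C.euler l g))
    (hA.variation_sub_mem_exact (A.op fun l => C.euler l f) (fun l => C.euler l g)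
      (fun l => C.euler l h)))
    (hA.variation_sub_mem_exact (A.op fun l => C.euler l g) (fun l => C.euler l h)
      (fun l => C.euler l f))
  convert C.exact.add_mem h1 h2 using 1
  simp only [cyclicVariation, trivector, Finset.sum_add_distrib]
  ring

variable (A)

/-- For `bⁱʲₖ = -gⁱˢ Γʲ_{sk}` with `g` symmetric and invertible, its vanishing is the symmetry of
`Γ` in the lower indices. -/
def torsionTerm (i j m : Fin n) : R := ∑ l, (A.b j i l * A.g l m - A.b m i l * A.g l j)

/-- For the Levi-Civita coefficients this is `-gⁱˡ Rʲᵐ_{lr} uʳₓ`, see `LeviCivita.curvature_eq`. -/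
def curvatureTerm (i j m : Fin n) : R :=
  ∑ l, (A.b i m l * A.bu l j - A.b i j l * A.bu l m + A.curlu j m l * A.g l i)

/-- For the Levi-Civita coefficients and skew `w` this is `∇ⁱ wʲᵐ`, see `LeviCivita.killing_eq`. -/
def killingTerm (i j m : Fin n) : R :=
  ∑ l, (A.g l i * C.P 0 l (A.w j m) - A.b i j l * A.w l m + A.b i m l * A.w l j)

def poissonTerm (i j m : Fin n) : R :=
  ∑ l, (C.P 0 l (A.w i j) * A.w l m + C.P 0 l (A.w j m) * A.w l i + C.P 0 l (A.w m i) * A.w l j)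

/-- `poissonTerm`, `mixedTerm` and `quadraticTerm` are the parts of degree 0, 1 and 2 in `uₓ` of the
coefficient of `ψᵢ φⱼ χₘ`. -/
def mixedTerm (i j m : Fin n) : R :=
  ∑ l, (A.curlu i j l * A.w l m + C.P 0 l (A.w i j) * A.bu l m
    + (A.curlu j m l * A.w l i + C.P 0 l (A.w j m) * A.bu l i)
    + (A.curlu m i l * A.w l j + C.P 0 l (A.w m i) * A.bu l j))

def quadraticTerm (i j m : Fin n) : R :=
  ∑ l, (A.curlu i j l * A.bu l m + A.curlu j m l * A.bu l i + A.curlu m i l * A.bu l j)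

/-- Primed arguments stand for total derivatives. No term `p' q' s'` occurs: each product involves
at most two differentiated covectors. -/
def trivectorTerm (i j m : Fin n) (p p' q q' s s' : R) : R :=
  A.torsionTerm i j m * (p * q' * s') + A.torsionTerm j m i * (p' * q * s')
    + A.torsionTerm m i j * (p' * q' * s)
    + (A.killingTerm i j m + A.curvatureTerm i j m) * (p' * q * s)
    + (A.killingTerm j m i + A.curvatureTerm j m i) * (p * q' * s)
    + (A.killingTerm m i j + A.curvatureTerm m i j) * (p * q * s')
    + (A.poissonTerm i j m + A.mixedTerm i j m + A.quadraticTerm i j m) * (p * q * s)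

theorem sum_mul_sum_rotate {S : Type*} [CommRing S] (F : Fin n → Fin n → Fin n → S)
    (G : Fin n → Fin n → S) :
    ∑ l, (∑ i, ∑ j, F l i j) * (∑ m, G l m) = ∑ i, ∑ j, ∑ m, ∑ l, F l i j * G l m := by
  have h : ∀ l, (∑ i, ∑ j, F l i j) * (∑ m, G l m) = ∑ i, ∑ j, ∑ m, F l i j * G l m := by
    intro l
    simp only [Finset.sum_mul, Finset.mul_sum]
    exact (sum_rotate fun i j m => F l i j * G l m).symm
  simp only [h]
  rw [Finset.sum_comm]
  refine Finset.sum_congr rfl fun i _ => ?_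
  rw [← sum_rotate]

theorem trivector_eq (ψ φ χ : Fin n → R) :
    A.trivector ψ φ χ = ∑ i, ∑ j, ∑ m, A.trivectorTerm i j m (ψ i) (C.D (ψ i)) (φ j) (C.D (φ j))
      (χ m) (C.D (χ m)) := by
  have h : A.trivector ψ φ χ = ∑ i, ∑ j, ∑ m, ∑ l,
      (A.reducedTerm i j l (ψ i) (C.D (ψ i)) (φ j) (C.D (φ j))
          * (A.g l m * C.D (χ m) + A.bu l m * χ m + A.w l m * χ m)
        + A.reducedTerm j m l (φ j) (C.D (φ j)) (χ m) (C.D (χ m))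
          * (A.g l i * C.D (ψ i) + A.bu l i * ψ i + A.w l i * ψ i)
        + A.reducedTerm m i l (χ m) (C.D (χ m)) (ψ i) (C.D (ψ i))
          * (A.g l j * C.D (φ j) + A.bu l j * φ j + A.w l j * φ j)) := by
    rw [trivector, Finset.sum_add_distrib, Finset.sum_add_distrib]
    simp only [reduced, op]
    rw [sum_mul_sum_rotate, sum_mul_sum_rotate, sum_mul_sum_rotate, sum_rotate
      (fun j m i => ∑ l, A.reducedTerm j m l (φ j) (C.D (φ j)) (χ m) (C.D (χ m))
          * (A.g l i * C.D (ψ i) + A.bu l i * ψ i + A.w l i * ψ i)),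
      ← sum_rotate (fun i j m => ∑ l, A.reducedTerm m i l (χ m) (C.D (χ m)) (ψ i) (C.D (ψ i))
          * (A.g l j * C.D (φ j) + A.bu l j * φ j + A.w l j * φ j))]
    simp only [← Finset.sum_add_distrib]
  rw [h]
  refine Finset.sum_congr rfl fun i _ => Finset.sum_congr rfl fun j _ =>
    Finset.sum_congr rfl fun m _ => ?_
  simp only [trivectorTerm, torsionTerm, curvatureTerm, killingTerm, poissonTerm, mixedTerm,
    quadraticTerm, Finset.sum_mul, ← Finset.sum_add_distrib]
  refine Finset.sum_congr rfl fun l _ => ?_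
  simp only [reducedTerm]
  ring

end OpData
end VarCalc

/-! ### Sufficiency of the six conditions; test functionals at a constant jet -/

namespace VarCalc

variable {n : ℕ} {R : Type*} [CommRing R] [Algebra ℝ R] {C : VarCalc n R}

namespace OpData

variable (A : C.OpData)

/-- The conditions for the Jacobi identity. -/
structure IsJacobi : Prop where
  torsion : ∀ i j m, A.torsionTerm i j m = 0
  curvature : ∀ i j m, A.curvatureTerm i j m = 0
  killing : ∀ i j m, A.killingTerm i j m = A.killingTerm j m i
  mixed : ∀ i j m, C.D (A.killingTerm i j m) = A.mixedTerm i j m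
  quadratic : ∀ i j m, A.quadraticTerm i j m = 0
  poisson : ∀ i j m, A.poissonTerm i j m = 0

variable {A}

/-- Cyclic invariance gives the terms in `ψ' φ χ`, `ψ φ' χ`, `ψ φ χ'` one common coefficient, the
Killing term, and the mixed condition supplies the derivative of that coefficient. Together they
form a total derivative. -/
theorem IsJacobi.trivector_mem_exact (hA : A.IsJacobi) (ψ φ χ : Fin n → R) :
    A.trivector ψ φ χ ∈ C.exact := by
  have h : A.trivector ψ φ χ
      = C.D (∑ i, ∑ j, ∑ m, A.killingTerm i j m * (ψ i * φ j * χ m)) := by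
    rw [trivector_eq]
    simp only [map_sum]
    refine Finset.sum_congr rfl fun i _ => Finset.sum_congr rfl fun j _ =>
      Finset.sum_congr rfl fun m _ => ?_
    simp only [trivectorTerm, hA.torsion, hA.curvature, hA.quadratic, hA.poisson,
      Derivation.leibniz, hA.mixed, smul_eq_mul, ← hA.killing i j m, hA.killing m i j]
    ring
  rw [h]
  exact C.D_mem_exact _

theorem IsSkew.bracket_add_bracket_mem_exact (hA : A.IsSkew) (f g : R) :
    A.bracket f g + A.bracket g f ∈ C.exact := by
  rw [bracket, bracket, hA.op_skew]
  exact C.D_mem_exact _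

theorem IsJacobi.jacobi_mem_exact (hA : A.IsSkew) (hA' : A.IsJacobi) (f g h : R) :
    A.bracket (A.bracket f g) h + A.bracket (A.bracket g h) f + A.bracket (A.bracket h f) g
      ∈ C.exact := by
  have h1 := C.exact.add_mem (hA.jacobi_sub_trivector_mem_exact f g h)
    (hA'.trivector_mem_exact (fun l => C.euler l f) (fun l => C.euler l g) fun l => C.euler l h)
  rwa [sub_add_cancel] at h1

end OpData

theorem HasOrder.add {f g : R} {N : ℕ} (hf : C.HasOrder f N) (hg : C.HasOrder g N) :
    C.HasOrder (f + g) N := fun k hk i => by rw [map_add, hf k hk, hg k hk, add_zero]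

theorem HasOrder.sub {f g : R} {N : ℕ} (hf : C.HasOrder f N) (hg : C.HasOrder g N) :
    C.HasOrder (f - g) N := fun k hk i => by rw [map_sub, hf k hk, hg k hk, sub_zero]

theorem HasOrder.mul {f g : R} {N : ℕ} (hf : C.HasOrder f N) (hg : C.HasOrder g N) :
    C.HasOrder (f * g) N := fun k hk i => by
  rw [Derivation.leibniz, hf k hk, hg k hk, smul_zero, smul_zero, add_zero]

theorem HasOrder.sum {ι : Type*} (s : Finset ι) {f : ι → R} {N : ℕ}
    (hf : ∀ i, C.HasOrder (f i) N) : C.HasOrder (∑ i ∈ s, f i) N := fun k hk i => by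
  rw [map_sum]
  exact Finset.sum_eq_zero fun j _ => hf j k hk i

theorem IsCoeff.hasOrder {ux : Fin n → R} {c : R} (hc : C.IsCoeff ux c) {N : ℕ} (hN : 1 ≤ N) :
    C.HasOrder c N := fun k hk i => by
  obtain ⟨k, rfl⟩ : ∃ m, k = m + 1 := ⟨k - 1, by omega⟩
  exact hc.1 k i

variable (C) in
theorem euler_of_hasOrder_one {f : R} (hf : C.HasOrder f 1) (i : Fin n) :
    C.euler i f = C.P 0 i f := by
  rw [C.euler_eq_sum hf]
  simp

variable (C) in
theorem euler_of_hasOrder_two {f : R} (hf : C.HasOrder f 2) (i : Fin n) :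
    C.euler i f = C.P 0 i f - C.D (C.P 1 i f) := by
  rw [C.euler_eq_sum hf]
  simp [Finset.sum_range_succ, sub_eq_add_neg]

/-- `f` and its total derivative are killed by `ε`. -/
def Vanishes (C : VarCalc n R) (ε : R →+* ℝ) (f : R) : Prop := ε f = 0 ∧ ε (C.D f) = 0

theorem Vanishes.add {ε : R →+* ℝ} {f g : R} (hf : C.Vanishes ε f) (hg : C.Vanishes ε g) :
    C.Vanishes ε (f + g) := by
  simp [Vanishes, hf.1, hf.2, hg.1, hg.2]

theorem Vanishes.sub {ε : R →+* ℝ} {f g : R} (hf : C.Vanishes ε f) (hg : C.Vanishes ε g) :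
    C.Vanishes ε (f - g) := by
  simp [Vanishes, hf.1, hf.2, hg.1, hg.2]

/-- By the Leibniz rule these elements form an ideal. It contains every `uˡₓ`, and hence all
coefficients below that carry a factor `uₓ`. -/
theorem Vanishes.mul_left {ε : R →+* ℝ} {f : R} (hf : C.Vanishes ε f) (g : R) :
    C.Vanishes ε (g * f) := by
  simp [Vanishes, hf.1, hf.2]

theorem Vanishes.mul_right {ε : R →+* ℝ} {f : R} (hf : C.Vanishes ε f) (g : R) :
    C.Vanishes ε (f * g) := by
  simp [Vanishes, hf.1, hf.2]

theorem Vanishes.sum {ε : R →+* ℝ} {ι : Type*} (s : Finset ι) {f : ι → R}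
    (hf : ∀ i, C.Vanishes ε (f i)) : C.Vanishes ε (∑ i ∈ s, f i) := by
  simp [Vanishes, (hf _).1, (hf _).2]

namespace OpData

variable (A : C.OpData)

/-- A point of the jet space, given by an evaluation `ε` at which all derivatives of the field
vanish, with coordinate functions `u`, the independent variable `x` centred at the point. -/
structure Point where
  ε : R →+* ℝ
  u : Fin n → R
  x : R
  vanishes_ux : ∀ l, C.Vanishes ε (A.ux l)
  u_coeff : ∀ l, C.IsCoeff A.ux (u l)
  partial_u : ∀ i l, C.P 0 i (u l) = if i = l then 1 else 0
  partial_x : ∀ k i, C.P k i x = 0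
  D_x : C.D x = 1
  ε_x : ε x = 0
  ε_algebraMap : ∀ r : ℝ, ε (algebraMap ℝ R r) = r

variable {A}

theorem D_u (p : A.Point) (l : Fin n) : C.D (p.u l) = A.ux l := by
  rw [(p.u_coeff l).2]
  simp [p.partial_u]

theorem isCoeff_algebraMap (ux : Fin n → R) (r : ℝ) : C.IsCoeff ux (algebraMap ℝ R r) where
  partial_succ k i := by simp
  total := by simp

theorem vanishes_bu (p : A.Point) (i j : Fin n) : C.Vanishes p.ε (A.bu i j) :=
  Vanishes.sum _ fun k => (p.vanishes_ux k).mul_left _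

theorem vanishes_curlu (p : A.Point) (i j l : Fin n) : C.Vanishes p.ε (A.curlu i j l) :=
  Vanishes.sum _ fun k => (p.vanishes_ux k).mul_left _

theorem vanishes_curvatureTerm (p : A.Point) (i j m : Fin n) :
    C.Vanishes p.ε (A.curvatureTerm i j m) :=
  Vanishes.sum _ fun _ => (((vanishes_bu p _ _).mul_left _).sub
    ((vanishes_bu p _ _).mul_left _)).add ((vanishes_curlu p _ _ _).mul_right _)

theorem vanishes_mixedTerm (p : A.Point) (i j m : Fin n) : C.Vanishes p.ε (A.mixedTerm i j m) := by
  have h : ∀ i j m l, C.Vanishes p.ε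
      (A.curlu i j l * A.w l m + C.P 0 l (A.w i j) * A.bu l m) := fun i j m l =>
    ((vanishes_curlu p _ _ _).mul_right _).add ((vanishes_bu p _ _).mul_left _)
  exact Vanishes.sum _ fun _ => ((h _ _ _ _).add (h _ _ _ _)).add (h _ _ _ _)

theorem vanishes_quadraticTerm (p : A.Point) (i j m : Fin n) :
    C.Vanishes p.ε (A.quadraticTerm i j m) := by
  have h : ∀ i j m l, C.Vanishes p.ε (A.curlu i j l * A.bu l m) := fun i j m l =>
    (vanishes_curlu p _ _ _).mul_right _
  exact Vanishes.sum _ fun _ => ((h _ _ _ _).add (h _ _ _ _)).add (h _ _ _ _)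

theorem ε_D_coeff (p : A.Point) {c : R} (hc : C.IsCoeff A.ux c) : p.ε (C.D c) = 0 := by
  rw [hc.2]
  simp [(p.vanishes_ux _).1]

variable (A)

theorem curl_coeff (i j l r : Fin n) : C.IsCoeff A.ux (A.curl i j l r) :=
  (A.coeff_partial (A.b_coeff _ _ _) _).sub (A.coeff_partial (A.b_coeff _ _ _) _)

theorem torsionTerm_coeff (i j m : Fin n) : C.IsCoeff A.ux (A.torsionTerm i j m) :=
  IsCoeff.sum _ fun _ => ((A.b_coeff _ _ _).mul (A.g_coeff _ _)).sub
    ((A.b_coeff _ _ _).mul (A.g_coeff _ _))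

theorem killingTerm_coeff (i j m : Fin n) : C.IsCoeff A.ux (A.killingTerm i j m) :=
  IsCoeff.sum _ fun _ => (((A.g_coeff _ _).mul (A.coeff_partial (A.w_coeff _ _) _)).sub
    ((A.b_coeff _ _ _).mul (A.w_coeff _ _))).add ((A.b_coeff _ _ _).mul (A.w_coeff _ _))

theorem poissonTerm_coeff (i j m : Fin n) : C.IsCoeff A.ux (A.poissonTerm i j m) :=
  IsCoeff.sum _ fun _ => (((A.coeff_partial (A.w_coeff _ _) _).mul (A.w_coeff _ _)).add
    ((A.coeff_partial (A.w_coeff _ _) _).mul (A.w_coeff _ _))).add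
    ((A.coeff_partial (A.w_coeff _ _) _).mul (A.w_coeff _ _))

theorem ux_hasOrder (l : Fin n) : C.HasOrder (A.ux l) 2 := fun k hk i => by
  rw [A.partial_ux, if_neg (by omega)]

theorem bu_hasOrder (i j : Fin n) : C.HasOrder (A.bu i j) 2 :=
  HasOrder.sum _ fun _ => ((A.b_coeff _ _ _).hasOrder one_le_two).mul (A.ux_hasOrder _)

theorem curlu_hasOrder (i j l : Fin n) : C.HasOrder (A.curlu i j l) 2 :=
  HasOrder.sum _ fun _ => ((A.curl_coeff _ _ _ _).hasOrder one_le_two).mul (A.ux_hasOrder _)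

theorem w_hasOrder (i j : Fin n) : C.HasOrder (A.w i j) 2 := (A.w_coeff i j).hasOrder one_le_two

theorem g_hasOrder (i j : Fin n) : C.HasOrder (A.g i j) 2 := (A.g_coeff i j).hasOrder one_le_two

theorem b_hasOrder (i j k : Fin n) : C.HasOrder (A.b i j k) 2 :=
  (A.b_coeff i j k).hasOrder one_le_two

theorem curvatureTerm_hasOrder (i j m : Fin n) : C.HasOrder (A.curvatureTerm i j m) 2 :=
  HasOrder.sum _ fun _ => (((A.b_hasOrder _ _ _).mul (A.bu_hasOrder _ _)).sub
    ((A.b_hasOrder _ _ _).mul (A.bu_hasOrder _ _))).add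
    ((A.curlu_hasOrder _ _ _).mul (A.g_hasOrder _ _))

theorem mixedTerm_hasOrder (i j m : Fin n) : C.HasOrder (A.mixedTerm i j m) 2 := by
  have h : ∀ i j m l, C.HasOrder
      (A.curlu i j l * A.w l m + C.P 0 l (A.w i j) * A.bu l m) 2 := fun i j m l =>
    ((A.curlu_hasOrder _ _ _).mul (A.w_hasOrder _ _)).add
      (((A.coeff_partial (A.w_coeff _ _) _).hasOrder one_le_two).mul (A.bu_hasOrder _ _))
  exact HasOrder.sum _ fun _ => ((h _ _ _ _).add (h _ _ _ _)).add (h _ _ _ _)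

theorem quadraticTerm_hasOrder (i j m : Fin n) : C.HasOrder (A.quadraticTerm i j m) 2 := by
  have h : ∀ i j m l, C.HasOrder (A.curlu i j l * A.bu l m) 2 := fun i j m l =>
    (A.curlu_hasOrder _ _ _).mul (A.bu_hasOrder _ _)
  exact HasOrder.sum _ fun _ => ((h _ _ _ _).add (h _ _ _ _)).add (h _ _ _ _)

theorem partial_one_bu (i j r : Fin n) : C.P 1 r (A.bu i j) = A.b i j r := by
  have : ∀ k, C.P 1 r (A.b i j k) = 0 := fun k => (A.b_coeff i j k).1 0 r
  simp [bu, A.partial_ux, this]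

theorem partial_one_curlu (i j l r : Fin n) : C.P 1 r (A.curlu i j l) = A.curl i j l r := by
  have : ∀ k, C.P 1 r (A.curl i j l k) = 0 := fun k => (A.curl_coeff i j l k).1 0 r
  simp [curlu, A.partial_ux, this]

theorem partial_one_curvatureTerm (i j m r : Fin n) : C.P 1 r (A.curvatureTerm i j m)
    = ∑ l, (A.b i m l * A.b l j r - A.b i j l * A.b l m r + A.curl j m l r * A.g l i) := by
  have h1 : ∀ i j k, C.P 1 r (A.b i j k) = 0 := fun i j k => (A.b_coeff i j k).1 0 r
  have h2 : ∀ i j, C.P 1 r (A.g i j) = 0 := fun i j => (A.g_coeff i j).1 0 r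
  simp only [curvatureTerm, map_sum, map_add, map_sub, Derivation.leibniz, partial_one_bu,
    partial_one_curlu, h1, h2, smul_eq_mul]
  exact Finset.sum_congr rfl fun l _ => by ring

/-- The covector with the single non-zero component `z` in direction `m`. -/
def covec (m : Fin n) (z : R) : Fin n → R := fun l => if l = m then z else 0

theorem op_covec (m : Fin n) (z : R) (i : Fin n) :
    A.op (covec m z) i = A.g i m * C.D z + A.bu i m * z + A.w i m * z := by
  rw [op, Finset.sum_eq_single m]
  · simp [covec]
  · intro l _ hl
    simp [covec, hl]
  · simp

theorem trivector_covec (i j m : Fin n) (p q s : R) :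
    A.trivector (covec i p) (covec j q) (covec m s)
      = A.trivectorTerm i j m p (C.D p) q (C.D q) s (C.D s) := by
  have h1 : ∀ i j m p p' q q', A.trivectorTerm i j m p p' q q' 0 0 = 0 := by
    intros; simp [trivectorTerm]
  have h2 : ∀ i j m p p' s s', A.trivectorTerm i j m p p' 0 0 s s' = 0 := by
    intros; simp [trivectorTerm]
  have h3 : ∀ i j m q q' s s', A.trivectorTerm i j m 0 0 q q' s s' = 0 := by
    intros; simp [trivectorTerm]
  simp only [trivector_eq, covec]
  rw [Finset.sum_eq_single i, Finset.sum_eq_single j, Finset.sum_eq_single m]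
  · simp
  · intro l _ hl
    simp [hl, h1]
  · simp
  · intro l _ hl
    simp [hl, h2]
  · simp
  · intro l _ hl
    simp [hl, h3]
  · simp

variable {A}

theorem D_hasOrder_two {a : R} (ha : ∀ k i, C.P k i a = 0) : C.HasOrder (C.D a) 2 := by
  have h : C.HasOrder a 1 := fun k _ i => ha k i
  exact h.totalDeriv

/-- Functionals linear in `u` have variational derivatives depending on `x` only, so their value and
derivatives at the point can be prescribed freely. -/
theorem euler_mul_u (p : A.Point) {a : R} (ha : ∀ k i, C.P k i a = 0) (i : Fin n) :
    (fun l => C.euler l (a * p.u i)) = covec i a := by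
  have h1 : C.HasOrder a 1 := fun k _ i => ha k i
  funext l
  rw [C.euler_of_hasOrder_one (h1.mul ((p.u_coeff i).hasOrder le_rfl)), Derivation.leibniz, ha,
    p.partial_u, covec]
  simp

theorem euler_u (p : A.Point) (i : Fin n) : (fun l => C.euler l (p.u i)) = covec i 1 := by
  have h := euler_mul_u p (a := (1 : R)) (by simp) i
  simpa using h

/-- The coordinate `uⁱ`, centred at the point. -/
noncomputable def Point.centred (p : A.Point) (i : Fin n) : R :=
  p.u i - algebraMap ℝ R (p.ε (p.u i))

theorem Point.centred_coeff (p : A.Point) (i : Fin n) : C.IsCoeff A.ux (p.centred i) :=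
  (p.u_coeff i).sub (isCoeff_algebraMap _ _)

theorem Point.ε_centred (p : A.Point) (i : Fin n) : p.ε (p.centred i) = 0 := by
  simp [Point.centred, p.ε_algebraMap]

theorem Point.partial_centred (p : A.Point) (i l : Fin n) :
    C.P 0 i (p.centred l) = if i = l then 1 else 0 := by
  simp [Point.centred, p.partial_u]

theorem Point.D_centred (p : A.Point) (l : Fin n) : C.D (p.centred l) = A.ux l := by
  simp [Point.centred, D_u]

theorem euler_half_sq (p : A.Point) (i : Fin n) :
    (fun l => C.euler l (algebraMap ℝ R (1 / 2) * (p.centred i * p.centred i)))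
      = covec i (p.centred i) := by
  have h1 := p.centred_coeff i
  have h2 : C.HasOrder (algebraMap ℝ R (1 / 2) * (p.centred i * p.centred i)) 1 :=
    ((isCoeff_algebraMap A.ux _).mul (h1.mul h1)).hasOrder le_rfl
  have h3 : algebraMap ℝ R (1 / 2) + algebraMap ℝ R (1 / 2) = 1 := by
    rw [← map_add, add_halves, map_one]
  funext l
  rw [C.euler_of_hasOrder_one h2]
  simp only [Derivation.leibniz, p.partial_centred, smul_eq_mul, covec, Derivation.map_algebraMap]
  split_ifs
  · linear_combination p.centred i * h3
  · simp

/-- Test functions of `x` with prescribed first derivatives at the point. -/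
theorem Point.exists_test (p : A.Point) (r s t : ℝ) : ∃ a : R, (∀ k i, C.P k i a = 0) ∧
    p.ε a = r ∧ p.ε (C.D a) = s ∧ p.ε (C.D (C.D a)) = t := by
  -- The Taylor polynomial `r + s x + (t / 2) x²`; `x` vanishes at the point.
  refine ⟨algebraMap ℝ R r + algebraMap ℝ R s * p.x + algebraMap ℝ R (t / 2) * (p.x * p.x),
    fun k i => ?_, ?_, ?_, ?_⟩ <;>
  simp [p.partial_x, p.D_x, p.ε_x, p.ε_algebraMap]
  ring

end OpData
end VarCalc

/-! ### Necessary conditions from test functionals -/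

namespace VarCalc

variable {n : ℕ} {R : Type*} [CommRing R] [Algebra ℝ R] {C : VarCalc n R}

namespace OpData

variable {A : C.OpData}

theorem bracket_of_covec {f h : R} {i j : Fin n} {a z : R}
    (hf : (fun l => C.euler l f) = covec i a) (hh : (fun l => C.euler l h) = covec j z) :
    A.bracket f h = a * (A.g i j * C.D z + A.bu i j * z + A.w i j * z) := by
  have h1 : A.bracket f h
      = ∑ l, (fun l => C.euler l f) l * A.op (fun l => C.euler l h) l := rfl
  rw [h1, hf, hh, ← A.op_covec]
  simp [covec]

/-- An exact density is killed by the Euler operator, which for densities of first order has only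
two terms. -/
theorem ε_eq_of_mem_exact (ε : R →+* ℝ) {f : R} (hf : C.HasOrder f 2) (h : f ∈ C.exact)
    (l : Fin n) : ε (C.P 0 l f) = ε (C.D (C.P 1 l f)) := by
  have h1 := C.euler_eq_zero_of_mem_exact l h
  rw [C.euler_of_hasOrder_two hf, sub_eq_zero] at h1
  rw [h1]

/-- The values at a point of the conditions for skew-symmetry. -/
structure IsSkewAt (A : C.OpData) (p : A.Point) : Prop where
  g_symm : ∀ i j, p.ε (A.g i j) = p.ε (A.g j i)
  partial_g : ∀ i j l, p.ε (C.P 0 l (A.g i j)) = p.ε (A.b i j l) + p.ε (A.b j i l)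
  w_skew : ∀ i j, p.ε (A.w i j) = -p.ε (A.w j i)

/-- At a constant jet each Euler identity becomes a linear relation between `ε a` and `ε (D a)`.
These two numbers are arbitrary, so their coefficients can be compared. -/
theorem isSkewAt_of_bracket (p : A.Point)
    (h : ∀ f h, A.bracket f h + A.bracket h f ∈ C.exact) : A.IsSkewAt p := by
  have hb1 : ∀ i j k r, C.P 1 r (A.b i j k) = 0 := fun i j k r => (A.b_coeff i j k).1 0 r
  have hg1 : ∀ i j r, C.P 1 r (A.g i j) = 0 := fun i j r => (A.g_coeff i j).1 0 r
  have hw1 : ∀ i j r, C.P 1 r (A.w i j) = 0 := fun i j r => (A.w_coeff i j).1 0 r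
  have hbu0 : ∀ i j, p.ε (A.bu i j) = 0 := fun i j => (vanishes_bu p i j).1
  have hbu0' : ∀ i j r, p.ε (C.P 0 r (A.bu i j)) = 0 := by
    intro i j r
    simp [bu, A.partial_ux, (p.vanishes_ux _).1]
  have hDa : ∀ {a : R}, (∀ k i, C.P k i a = 0) →
      C.HasOrder a 2 ∧ C.HasOrder (C.D a) 2 ∧ (∀ i, C.P 0 i (C.D a) = 0) ∧
      ∀ i, C.P 1 i (C.D a) = 0 := by
    intro a ha
    refine ⟨fun k _ i => ha k i, D_hasOrder_two ha, fun i => ?_, fun i => ?_⟩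
    · rw [C.comm_zero, ha, map_zero]
    · rw [C.comm_succ, ha, ha, map_zero, add_zero]
  -- Test pair `∫ a(x) uⁱ dx`, `∫ uʲ dx`: this isolates the first derivatives of `g`.
  have hlin : ∀ i j l (a : R), (∀ k i, C.P k i a = 0) →
      p.ε (C.P 0 l (A.g j i)) * p.ε (C.D a)
        + (p.ε (C.P 0 l (A.w i j)) + p.ε (C.P 0 l (A.w j i))) * p.ε a
      = (p.ε (A.b i j l) + p.ε (A.b j i l)) * p.ε (C.D a) := by
    intro i j l a ha
    obtain ⟨ha2, hDa2, hDa0, hDa1⟩ := hDa ha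
    have h1 := h (a * p.u i) (p.u j)
    rw [bracket_of_covec (euler_mul_u p ha i) (euler_u p j),
      bracket_of_covec (euler_u p j) (euler_mul_u p ha i)] at h1
    simp only [Derivation.map_one_eq_zero, mul_zero, zero_add, mul_one, one_mul] at h1
    have h2 := ε_eq_of_mem_exact p.ε ((ha2.mul ((A.bu_hasOrder i j).add (A.w_hasOrder i j))).add
      ((((A.g_hasOrder j i).mul hDa2).add ((A.bu_hasOrder j i).mul ha2)).add
        ((A.w_hasOrder j i).mul ha2))) h1 l
    simp only [map_add, Derivation.leibniz, smul_eq_mul, ha, hDa0, hDa1, hg1, hw1,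
      A.partial_one_bu, map_mul, mul_zero, add_zero, hbu0',
      ε_D_coeff p (A.b_coeff _ _ _), zero_add] at h2
    linear_combination h2
  -- With the second functional quadratic, its variational derivative vanishes at the point but has
  -- derivative one in direction `j`, so `g` and `w` themselves appear.
  have hquad : ∀ i j (a : R), (∀ k i, C.P k i a = 0) →
      p.ε (A.g j i) * p.ε (C.D a) + (p.ε (A.w i j) + p.ε (A.w j i)) * p.ε a
      = p.ε (A.g i j) * p.ε (C.D a) := by
    intro i j a ha
    obtain ⟨ha2, hDa2, hDa0, hDa1⟩ := hDa ha
    have h1 := h (a * p.u i) (algebraMap ℝ R (1 / 2) * (p.centred j * p.centred j))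
    rw [bracket_of_covec (euler_mul_u p ha i) (euler_half_sq p j),
      bracket_of_covec (euler_half_sq p j) (euler_mul_u p ha i), p.D_centred] at h1
    have hz : C.HasOrder (p.centred j) 2 := (p.centred_coeff j).hasOrder one_le_two
    have hz1 : ∀ r, C.P 1 r (p.centred j) = 0 := fun r => (p.centred_coeff j).1 0 r
    have h2 := ε_eq_of_mem_exact p.ε ((ha2.mul ((((A.g_hasOrder i j).mul (A.ux_hasOrder j)).add
      ((A.bu_hasOrder i j).mul hz)).add ((A.w_hasOrder i j).mul hz))).add
      (hz.mul ((((A.g_hasOrder j i).mul hDa2).add ((A.bu_hasOrder j i).mul ha2)).add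
        ((A.w_hasOrder j i).mul ha2)))) h1 j
    simp only [map_add, Derivation.leibniz, smul_eq_mul, ha, hDa0, hDa1, hg1, hw1, hz1,
      A.partial_one_bu, map_mul, mul_zero, add_zero, hbu0, hbu0',
      ε_D_coeff p (A.b_coeff _ _ _), ε_D_coeff p (A.g_coeff _ _), zero_add, p.D_centred,
      p.ε_centred, (p.vanishes_ux _).1, p.partial_centred, A.partial_ux, if_true, mul_one,
      zero_ne_one, false_and, if_false, zero_mul, and_self] at h2
    linear_combination h2
  refine ⟨fun i j => ?_, fun i j l => ?_, fun i j => ?_⟩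
  · obtain ⟨a, ha, ha0, ha1, -⟩ := p.exists_test 0 1 0
    have := hquad j i a ha
    rw [ha0, ha1] at this
    linarith
  · obtain ⟨a, ha, ha0, ha1, -⟩ := p.exists_test 0 1 0
    have := hlin j i l a ha
    rw [ha0, ha1] at this
    linarith
  · obtain ⟨a, ha, ha0, ha1, -⟩ := p.exists_test 1 0 0
    have := hquad i j a ha
    rw [ha0, ha1] at this
    linarith

/-- The values at a point of the conditions implied by the Jacobi identity. -/
structure IsJacobiAt (A : C.OpData) (p : A.Point) : Prop where
  torsion : ∀ i j m, p.ε (A.torsionTerm i j m) = 0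
  curvature : ∀ i j m r, p.ε (C.P 1 r (A.curvatureTerm i j m)) = 0
  killing : ∀ i j m, p.ε (A.killingTerm i j m) = p.ε (A.killingTerm j m i)
  poisson : ∀ i j m, p.ε (A.poissonTerm i j m) = 0

/-- Skewness is needed in the whole ring and not only at the point: it is what replaces the Jacobi
density by the trivector before the Euler operator is applied. -/
theorem IsSkew.isJacobiAt (hA : A.IsSkew) (p : A.Point)
    (h : ∀ f g h, A.bracket (A.bracket f g) h + A.bracket (A.bracket g h) f
      + A.bracket (A.bracket h f) g ∈ C.exact) : A.IsJacobiAt p := by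
  have hT : ∀ f g h, A.trivector (fun l => C.euler l f) (fun l => C.euler l g)
      (fun l => C.euler l h) ∈ C.exact := fun f g h' => by
    have := C.exact.sub_mem (h f g h') (hA.jacobi_sub_trivector_mem_exact f g h')
    rwa [sub_sub_cancel] at this
  have hDa : ∀ {a : R}, (∀ k i, C.P k i a = 0) →
      C.HasOrder a 2 ∧ C.HasOrder (C.D a) 2 ∧ (∀ i, C.P 0 i (C.D a) = 0) ∧
      ∀ i, C.P 1 i (C.D a) = 0 := by
    intro a ha
    refine ⟨fun k _ i => ha k i, D_hasOrder_two ha, fun i => ?_, fun i => ?_⟩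
    · rw [C.comm_zero, ha, map_zero]
    · rw [C.comm_succ, ha, ha, map_zero, add_zero]
  have ht1 : ∀ i j m r, C.P 1 r (A.torsionTerm i j m) = 0 :=
    fun i j m r => (A.torsionTerm_coeff i j m).1 0 r
  have hk1 : ∀ i j m r, C.P 1 r (A.killingTerm i j m) = 0 :=
    fun i j m r => (A.killingTerm_coeff i j m).1 0 r
  have hp1 : ∀ i j m r, C.P 1 r (A.poissonTerm i j m) = 0 :=
    fun i j m r => (A.poissonTerm_coeff i j m).1 0 r
  have hord : ∀ i j m {p p' q q' s s' : R}, C.HasOrder p 2 → C.HasOrder p' 2 → C.HasOrder q 2 →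
      C.HasOrder q' 2 → C.HasOrder s 2 → C.HasOrder s' 2 →
      C.HasOrder (A.trivectorTerm i j m p p' q q' s s') 2 := by
    intro i j m p p' q q' s s' hp hp' hq hq' hs hs'
    have t : ∀ i j m, C.HasOrder (A.torsionTerm i j m) 2 :=
      fun i j m => (A.torsionTerm_coeff i j m).hasOrder one_le_two
    have k : ∀ i j m, C.HasOrder (A.killingTerm i j m + A.curvatureTerm i j m) 2 := fun i j m =>
      ((A.killingTerm_coeff i j m).hasOrder one_le_two).add (A.curvatureTerm_hasOrder i j m)
    have z : C.HasOrder (A.poissonTerm i j m + A.mixedTerm i j m + A.quadraticTerm i j m) 2 :=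
      (((A.poissonTerm_coeff i j m).hasOrder one_le_two).add (A.mixedTerm_hasOrder i j m)).add
        (A.quadraticTerm_hasOrder i j m)
    exact (((((((t _ _ _).mul ((hp.mul hq').mul hs')).add ((t _ _ _).mul ((hp'.mul hq).mul hs'))).add
      ((t _ _ _).mul ((hp'.mul hq').mul hs))).add ((k _ _ _).mul ((hp'.mul hq).mul hs))).add
      ((k _ _ _).mul ((hp.mul hq').mul hs))).add ((k _ _ _).mul ((hp.mul hq).mul hs'))).add
      (z.mul ((hp.mul hq).mul hs))
  have h1 : C.HasOrder (1 : R) 2 := fun k _ i => by simp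
  have h0 : C.HasOrder (0 : R) 2 := fun k _ i => by simp
  -- Three functionals linear in `u`, two of them without `x`: the density is `(K + R) a' + (…) a`,
  -- with `K` the Killing and `R` the curvature term. When `a` and `a'` vanish at the point, the
  -- Euler operator sees only `a''` times the `uʳₓ`-coefficient of `R`.
  have hlin : ∀ i j m r (a : R), (∀ k i, C.P k i a = 0) → p.ε a = 0 → p.ε (C.D a) = 0 →
      p.ε (C.P 1 r (A.curvatureTerm i j m)) * p.ε (C.D (C.D a)) = 0 := by
    intro i j m r a ha ha0 ha1
    obtain ⟨ha2, hDa2, hDa0, hDa1⟩ := hDa ha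
    have h2 := hT (a * p.u i) (p.u j) (p.u m)
    rw [euler_mul_u p ha, euler_u, euler_u, trivector_covec, Derivation.map_one_eq_zero] at h2
    have h3 := ε_eq_of_mem_exact p.ε (hord i j m ha2 hDa2 h1 h0 h1 h0) h2 r
    simp only [trivectorTerm, map_add, Derivation.leibniz, smul_eq_mul, ha, hDa0, hDa1, map_mul,
      mul_zero, add_zero, zero_add, mul_one,
      ha0, ha1, zero_mul, hk1] at h3
    linear_combination -h3
  -- Making the third functional quadratic gives a relation linear in `a`, `a'`, `a''`. The
  -- coefficients of these three values yield the Poisson, Killing and torsion conditions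
  -- respectively.
  have hquad : ∀ i j m (a : R), (∀ k i, C.P k i a = 0) →
      p.ε (A.killingTerm i j m) * p.ε (C.D a) + p.ε (A.poissonTerm i j m) * p.ε a
      = p.ε (A.torsionTerm j m i) * p.ε (C.D (C.D a))
        + p.ε (A.killingTerm m i j) * p.ε (C.D a) := by
    intro i j m a ha
    obtain ⟨ha2, hDa2, hDa0, hDa1⟩ := hDa ha
    have hz : C.HasOrder (p.centred m) 2 := (p.centred_coeff m).hasOrder one_le_two
    have hz1 : ∀ r, C.P 1 r (p.centred m) = 0 := fun r => (p.centred_coeff m).1 0 r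
    have h2 := hT (a * p.u i) (p.u j) (algebraMap ℝ R (1 / 2) * (p.centred m * p.centred m))
    rw [euler_mul_u p ha, euler_u, euler_half_sq, trivector_covec, Derivation.map_one_eq_zero,
      p.D_centred] at h2
    have h3 := ε_eq_of_mem_exact p.ε (hord i j m ha2 hDa2 h1 h0 hz (A.ux_hasOrder m)) h2 m
    simp only [trivectorTerm, map_add, Derivation.leibniz, smul_eq_mul, ha, hDa0, hDa1, map_mul,
      mul_zero, add_zero, zero_add, mul_one,
      zero_mul, hk1, ht1, hp1, hz1, p.partial_centred, A.partial_ux, if_true, p.ε_centred,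
      p.D_centred, (p.vanishes_ux _).1, (p.vanishes_ux _).2, (vanishes_curvatureTerm p _ _ _).1,
      (vanishes_curvatureTerm p _ _ _).2, (vanishes_mixedTerm p _ _ _).1,
      (vanishes_quadraticTerm p _ _ _).1, ε_D_coeff p (A.torsionTerm_coeff _ _ _),
      ε_D_coeff p (A.killingTerm_coeff _ _ _), zero_ne_one, false_and, if_false, and_self,
      one_mul] at h3
    linear_combination h3
  refine ⟨fun i j m => ?_, fun i j m r => ?_, fun i j m => ?_, fun i j m => ?_⟩
  · obtain ⟨a, ha, ha0, ha1, ha2⟩ := p.exists_test 0 0 1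
    have := hquad m i j a ha
    rw [ha0, ha1, ha2] at this
    linarith
  · obtain ⟨a, ha, ha0, ha1, ha2⟩ := p.exists_test 0 0 1
    have := hlin i j m r a ha ha0 ha1
    rw [ha2] at this
    linarith
  · obtain ⟨a, ha, ha0, ha1, ha2⟩ := p.exists_test 0 1 0
    have := hquad j m i a ha
    rw [ha0, ha1, ha2] at this
    linarith
  · obtain ⟨a, ha, ha0, ha1, ha2⟩ := p.exists_test 1 0 0
    have := hquad i j m a ha
    rw [ha0, ha1, ha2] at this
    linarith

end OpData
end VarCalc

/-! ### The ring of differential functions over `U` -/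

section DiffRing

variable {n : ℕ}

/-- Jets over `U`. -/
abbrev JetOver (U : Set (Fin n → ℝ)) : Type := {p : ℝ × Jet n // p.2 0 ∈ U}

/-- Truncation of jets. -/
def truncJet (N : ℕ) : ℝ × Jet n →ₗ[ℝ] ℝ × (Fin (N + 1) → Fin n → ℝ) where
  toFun p := (p.1, fun k => p.2 k)
  map_add' _ _ := rfl
  map_smul' _ _ := rfl

/-- Truncation of truncated jets. -/
def retruncJet {N M : ℕ} (h : N ≤ M) :
    ℝ × (Fin (M + 1) → Fin n → ℝ) →ₗ[ℝ] ℝ × (Fin (N + 1) → Fin n → ℝ) where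
  toFun p := (p.1, fun k => p.2 (Fin.castLE (by omega) k))
  map_add' _ _ := rfl
  map_smul' _ _ := rfl

/-- `φ` expresses `F` over `U` through derivatives of order at most `N`. -/
structure Expresses (U : Set (Fin n → ℝ)) (N : ℕ)
    (φ : ℝ × (Fin (N + 1) → Fin n → ℝ) → ℝ) (F : ℝ × Jet n → ℝ) : Prop where
  smooth : ContDiffOn ℝ ∞ φ {p | p.2 0 ∈ U}
  eq : ∀ p : ℝ × Jet n, p.2 0 ∈ U → F p = φ (truncJet N p)

theorem Expresses.mono {U : Set (Fin n → ℝ)} {N M : ℕ} {φ : ℝ × (Fin (N + 1) → Fin n → ℝ) → ℝ}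
    {F : ℝ × Jet n → ℝ} (hφ : Expresses U N φ F) (h : N ≤ M) :
    Expresses U M (φ ∘ retruncJet h) F where
  smooth := by
    refine hφ.smooth.comp (LinearMap.toContinuousLinearMap (retruncJet h)).contDiff.contDiffOn ?_
    intro p hp
    exact hp
  eq := hφ.eq

theorem isOpen_truncDomain {U : Set (Fin n → ℝ)} (hU : IsOpen U) (N : ℕ) :
    IsOpen {p : ℝ × (Fin (N + 1) → Fin n → ℝ) | p.2 0 ∈ U} :=
  hU.preimage (by fun_prop)

theorem Expresses.contDiffAt {U : Set (Fin n → ℝ)} (hU : IsOpen U) {N : ℕ}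
    {φ : ℝ × (Fin (N + 1) → Fin n → ℝ) → ℝ}
    {F : ℝ × Jet n → ℝ} (hφ : Expresses U N φ F) {p : ℝ × Jet n} (hp : p.2 0 ∈ U) :
    ContDiffAt ℝ ∞ φ (truncJet N p) :=
  hφ.smooth.contDiffAt ((isOpen_truncDomain hU N).mem_nhds hp)

/-- The jet space is infinite-dimensional, so only line derivatives are used; they are computed in
the finite-dimensional truncation. Openness of `U` keeps the line over `U` for small times. -/
theorem Expresses.hasLineDerivAt {U : Set (Fin n → ℝ)} (hU : IsOpen U) {N : ℕ}
    {φ : ℝ × (Fin (N + 1) → Fin n → ℝ) → ℝ}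
    {F : ℝ × Jet n → ℝ} (hφ : Expresses U N φ F) {p : ℝ × Jet n} (hp : p.2 0 ∈ U)
    (v : ℝ × Jet n) :
    HasLineDerivAt ℝ F (fderiv ℝ φ (truncJet N p) (truncJet N v)) p v := by
  have h1 : HasFDerivAt φ (fderiv ℝ φ (truncJet N p)) (truncJet N p) :=
    ((hφ.contDiffAt hU hp).differentiableAt (by simp)).hasFDerivAt
  have h2 : HasDerivAt (fun t : ℝ => φ (truncJet N p + t • truncJet N v))
      (fderiv ℝ φ (truncJet N p) (truncJet N v)) 0 := h1.hasLineDerivAt _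
  refine h2.congr_of_eventuallyEq ?_
  have h3 : ∀ᶠ t : ℝ in nhds 0, p.2 0 + t • v.2 0 ∈ U := by
    have hc : Continuous fun t : ℝ => p.2 0 + t • v.2 0 := by fun_prop
    exact hc.continuousAt.eventually_mem (hU.mem_nhds (by simpa using hp))
  filter_upwards [h3] with t ht
  rw [hφ.eq _ ht, map_add, map_smul]

theorem Expresses.lineDeriv {U : Set (Fin n → ℝ)} (hU : IsOpen U) {N : ℕ}
    {φ : ℝ × (Fin (N + 1) → Fin n → ℝ) → ℝ} {F : ℝ × Jet n → ℝ} (hφ : Expresses U N φ F)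
    (v : ℝ × Jet n) :
    Expresses U N (fun q => fderiv ℝ φ q (truncJet N v)) (fun p => lineDeriv ℝ F p v) where
  smooth := by
    have := hφ.smooth.fderiv_of_isOpen (m := ∞) (isOpen_truncDomain hU N) (by simp)
    exact this.clm_apply contDiffOn_const
  eq p hp := (hφ.hasLineDerivAt hU hp v).lineDeriv

theorem Expresses.lineDeriv_comm {U : Set (Fin n → ℝ)} (hU : IsOpen U) {N : ℕ}
    {φ : ℝ × (Fin (N + 1) → Fin n → ℝ) → ℝ} {F : ℝ × Jet n → ℝ} (hφ : Expresses U N φ F)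
    (v w : ℝ × Jet n) {p : ℝ × Jet n} (hp : p.2 0 ∈ U) :
    _root_.lineDeriv ℝ (fun q => _root_.lineDeriv ℝ F q v) p w
      = _root_.lineDeriv ℝ (fun q => _root_.lineDeriv ℝ F q w) p v := by
  have hc := hφ.contDiffAt hU hp
  have hd : DifferentiableAt ℝ (fderiv ℝ φ) (truncJet N p) :=
    (hc.fderiv_right (m := 1) (by norm_cast)).differentiableAt (by simp)
  have key : ∀ v w : ℝ × Jet n, _root_.lineDeriv ℝ (fun q => _root_.lineDeriv ℝ F q v) p w
      = fderiv ℝ (fderiv ℝ φ) (truncJet N p) (truncJet N w) (truncJet N v) := by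
    intro v w
    rw [((hφ.lineDeriv hU v).hasLineDerivAt hU hp w).lineDeriv, fderiv_clm_apply hd (by fun_prop)]
    simp
  rw [key, key]
  -- Both iterated derivatives are values of the second Fréchet derivative of `φ`, which is
  -- symmetric for smooth `φ`.
  refine hc.isSymmSndFDerivAt ?_ _ _
  rw [minSmoothness_of_isRCLikeNormedField]
  exact WithTop.coe_le_coe.2 le_top

end DiffRing

section DiffRing

variable {n : ℕ}

/-- Extension by zero of a function on jets over `U`. -/
noncomputable def extendJet {U : Set (Fin n → ℝ)} (F : JetOver U → ℝ) : ℝ × Jet n → ℝ :=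
  open Classical in fun p => if h : p.2 0 ∈ U then F ⟨p, h⟩ else 0

theorem extendJet_apply {U : Set (Fin n → ℝ)} (F : JetOver U → ℝ) (p : JetOver U) :
    extendJet F p.1 = F p := by
  simp [extendJet, p.2]

theorem Expresses.congr {U : Set (Fin n → ℝ)} {N : ℕ} {φ : ℝ × (Fin (N + 1) → Fin n → ℝ) → ℝ}
    {F G : ℝ × Jet n → ℝ} (hφ : Expresses U N φ F) (h : ∀ p : ℝ × Jet n, p.2 0 ∈ U → G p = F p) :
    Expresses U N φ G :=
  ⟨hφ.smooth, fun p hp => (h p hp).trans (hφ.eq p hp)⟩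

theorem exists_expresses_pair {U : Set (Fin n → ℝ)} {F G : ℝ × Jet n → ℝ}
    (hF : ∃ N φ, Expresses U N φ F) (hG : ∃ N φ, Expresses U N φ G) :
    ∃ N φ ψ, Expresses U N φ F ∧ Expresses U N ψ G := by
  obtain ⟨N, φ, hφ⟩ := hF
  obtain ⟨M, ψ, hψ⟩ := hG
  exact ⟨max N M, _, _, hφ.mono (le_max_left _ _), hψ.mono (le_max_right _ _)⟩

/-- The ring of differential functions over `U`. -/
noncomputable def diffRing (U : Set (Fin n → ℝ)) : Subalgebra ℝ (JetOver U → ℝ) where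
  carrier := {F | ∃ N φ, Expresses U N φ (extendJet F)}
  mul_mem' := by
    intro F G hF hG
    obtain ⟨N, φ, ψ, hφ, hψ⟩ := exists_expresses_pair hF hG
    refine ⟨N, fun p => φ p * ψ p, hφ.smooth.mul hψ.smooth, fun p hp => ?_⟩
    rw [← hφ.eq p hp, ← hψ.eq p hp]
    simp [extendJet, hp]
  add_mem' := by
    intro F G hF hG
    obtain ⟨N, φ, ψ, hφ, hψ⟩ := exists_expresses_pair hF hG
    refine ⟨N, fun p => φ p + ψ p, hφ.smooth.add hψ.smooth, fun p hp => ?_⟩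
    rw [← hφ.eq p hp, ← hψ.eq p hp]
    simp [extendJet, hp]
  algebraMap_mem' r := by
    refine ⟨0, fun _ => r, contDiffOn_const, fun p hp => ?_⟩
    simp [extendJet, hp]

variable {U : Set (Fin n → ℝ)}

theorem diffRing_ext {F G : diffRing U} (h : ∀ p, F.1 p = G.1 p) : F = G :=
  Subtype.ext (funext h)

theorem diffRing_hasLineDerivAt (hU : IsOpen U) (F : diffRing U) (p : JetOver U) (v : ℝ × Jet n) :
    HasLineDerivAt ℝ (extendJet F.1) (lineDeriv ℝ (extendJet F.1) p.1 v) p.1 v := by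
  obtain ⟨N, φ, hφ⟩ := F.2
  exact (hφ.hasLineDerivAt hU p.2 v).lineDifferentiableAt.hasLineDerivAt

/-- The derivative in the direction `v`, as a function. -/
noncomputable def dirDerivFun (hU : IsOpen U) (v : ℝ × Jet n) (F : diffRing U) : diffRing U :=
  ⟨fun p => lineDeriv ℝ (extendJet F.1) p.1 v, by
    obtain ⟨N, φ, hφ⟩ := F.2
    exact ⟨N, _, (hφ.lineDeriv hU v).congr fun p hp => by simp [extendJet, hp]⟩⟩

theorem dirDerivFun_eq (hU : IsOpen U) {v : ℝ × Jet n} {F : diffRing U} {p : JetOver U} {d : ℝ}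
    (h : HasLineDerivAt ℝ (extendJet F.1) d p.1 v) : (dirDerivFun hU v F).1 p = d :=
  h.lineDeriv

/-- The derivative in the direction `v`. -/
noncomputable def dirDeriv (hU : IsOpen U) (v : ℝ × Jet n) :
    Derivation ℝ (diffRing U) (diffRing U) :=
  Derivation.mk'
    { toFun := dirDerivFun hU v
      map_add' := fun F G => diffRing_ext fun p => by
        refine dirDerivFun_eq hU ?_
        have := HasDerivAt.add (diffRing_hasLineDerivAt hU F p v)
          (diffRing_hasLineDerivAt hU G p v)
        refine HasDerivAt.congr_of_eventuallyEq this (Filter.Eventually.of_forall fun t => ?_)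
        -- Off `U` all extensions take the value zero, so the identity holds along the whole line.
        by_cases h : (p.1 + t • v).2 0 ∈ U
        · simp only [extendJet, dif_pos h, Pi.add_apply]; rfl
        · simp only [extendJet, dif_neg h, Pi.add_apply, add_zero]
      map_smul' := fun c F => diffRing_ext fun p => by
        refine dirDerivFun_eq hU ?_
        have := HasDerivAt.const_mul c (diffRing_hasLineDerivAt hU F p v)
        refine HasDerivAt.congr_of_eventuallyEq this (Filter.Eventually.of_forall fun t => ?_)
        by_cases h : (p.1 + t • v).2 0 ∈ U
        · simp only [extendJet, dif_pos h]; rfl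
        · simp only [extendJet, dif_neg h, mul_zero] }
    (fun F G => diffRing_ext fun p => by
        refine dirDerivFun_eq hU ?_
        have := HasDerivAt.mul (diffRing_hasLineDerivAt hU F p v)
          (diffRing_hasLineDerivAt hU G p v)
        have h2 := HasDerivAt.congr_of_eventuallyEq
          (f₁ := fun t : ℝ => extendJet (F * G).1 (p.1 + t • v)) this
          (Filter.Eventually.of_forall fun t => by
            by_cases h : (p.1 + t • v).2 0 ∈ U
            · simp only [extendJet, dif_pos h, Pi.mul_apply]; rfl
            · simp only [extendJet, dif_neg h, Pi.mul_apply, mul_zero])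
        refine HasDerivAt.congr_deriv h2 ?_
        simp only [zero_smul, add_zero, extendJet_apply]
        exact (add_comm _ _).trans (congrArg₂ _ rfl (mul_comm _ _)))

theorem dirDeriv_eq (hU : IsOpen U) {v : ℝ × Jet n} {F : diffRing U} {p : JetOver U} {d : ℝ}
    (h : HasLineDerivAt ℝ (extendJet F.1) d p.1 v) : (dirDeriv hU v F).1 p = d :=
  h.lineDeriv

theorem dirDeriv_comm (hU : IsOpen U) (v w : ℝ × Jet n) (F : diffRing U) :
    dirDeriv hU v (dirDeriv hU w F) = dirDeriv hU w (dirDeriv hU v F) := by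
  refine diffRing_ext fun p => ?_
  obtain ⟨N, φ, hφ⟩ := F.2
  have key : ∀ v w, (dirDeriv hU v (dirDeriv hU w F)).1 p
      = lineDeriv ℝ (fun q => lineDeriv ℝ (extendJet F.1) q w) p.1 v := by
    intro v w
    refine dirDeriv_eq hU ?_
    have h1 := hφ.lineDeriv hU w
    have h2 := h1.hasLineDerivAt hU p.2 v
    rw [h2.lineDeriv]
    refine Expresses.hasLineDerivAt hU (h1.congr fun q hq => ?_) p.2 v
    simp only [extendJet, dif_pos hq]
    rfl
  rw [key, key]
  exact hφ.lineDeriv_comm hU w v p.2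

/-- The direction of `∂/∂uⁱ_{kx}`. -/
def jetDir (k : ℕ) (i : Fin n) : ℝ × Jet n := (0, Pi.single k (Pi.single i 1))

/-- The direction of `∂/∂x`. -/
def xDir : ℝ × Jet n := (1, 0)

theorem truncJet_jetDir {N k : ℕ} (h : N < k) (i : Fin n) : truncJet N (jetDir k i) = 0 := by
  refine Prod.ext rfl (funext fun l => ?_)
  have : (l : ℕ) ≠ k := by have := l.2; omega
  simp [truncJet, jetDir, Pi.single_eq_of_ne this]

theorem dirDeriv_jetDir_eq_zero (hU : IsOpen U) {N k : ℕ}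
    {φ : ℝ × (Fin (N + 1) → Fin n → ℝ) → ℝ} {F : diffRing U}
    (hφ : Expresses U N φ (extendJet F.1)) (h : N < k) (i : Fin n) :
    dirDeriv hU (jetDir k i) F = 0 := by
  refine diffRing_ext fun p => dirDeriv_eq hU ?_
  have := hφ.hasLineDerivAt hU p.2 (jetDir k i)
  rw [truncJet_jetDir h, map_zero] at this
  exact this

theorem hasLineDerivAt_extendJet (hU : IsOpen U) {F : JetOver U → ℝ} {G : ℝ × Jet n → ℝ}
    (h : ∀ p : JetOver U, F p = G p.1) {p : JetOver U} {v : ℝ × Jet n} {d : ℝ}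
    (hG : HasLineDerivAt ℝ G d p.1 v) : HasLineDerivAt ℝ (extendJet F) d p.1 v := by
  refine HasDerivAt.congr_of_eventuallyEq hG ?_
  have h3 : ∀ᶠ t : ℝ in nhds 0, p.1.2 0 + t • v.2 0 ∈ U := by
    have hc : Continuous fun t : ℝ => p.1.2 0 + t • v.2 0 := by fun_prop
    exact hc.continuousAt.eventually_mem (hU.mem_nhds (by simpa using p.2))
  filter_upwards [h3] with t ht
  have := h ⟨p.1 + t • v, ht⟩
  rw [← extendJet_apply F] at this
  exact this

/-- The coordinate `uⁱ_{kx}`. -/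
noncomputable def jetCoord (U : Set (Fin n → ℝ)) (k : ℕ) (i : Fin n) : diffRing U :=
  ⟨fun p => p.1.2 k i, k, fun q => q.2 (Fin.last k) i, by fun_prop, fun p hp => by
    simp [extendJet, hp, truncJet]⟩

/-- The independent variable. -/
noncomputable def xCoord (U : Set (Fin n → ℝ)) : diffRing U :=
  ⟨fun p => p.1.1, 0, fun q => q.1, by fun_prop, fun p hp => by simp [extendJet, hp, truncJet]⟩

/-- A function of the field variables as a differential function. -/
noncomputable def coeffFun (c : (Fin n → ℝ) → ℝ) (hc : ContDiffOn ℝ ∞ c U) : diffRing U :=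
  ⟨fun p => c (p.1.2 0), 0, fun q => c (q.2 0),
    hc.comp (by fun_prop) (fun _ h => h), fun p hp => by simp [extendJet, hp, truncJet]⟩

theorem dirDeriv_of_linear (hU : IsOpen U) (L : ℝ × Jet n →ₗ[ℝ] ℝ) {F : diffRing U}
    (h : ∀ p, F.1 p = L p.1) (v : ℝ × Jet n) : dirDeriv hU v F = algebraMap ℝ _ (L v) := by
  refine diffRing_ext fun p => dirDeriv_eq hU (hasLineDerivAt_extendJet hU h ?_)
  have : HasDerivAt (fun t : ℝ => L p.1 + t * L v) (1 * L v) 0 :=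
    ((hasDerivAt_id (0 : ℝ)).mul_const (L v)).const_add _
  rw [one_mul] at this
  refine this.congr_of_eventuallyEq (Filter.Eventually.of_forall fun t => ?_)
  simp

theorem dirDeriv_jetCoord (hU : IsOpen U) (v : ℝ × Jet n) (k : ℕ) (i : Fin n) :
    dirDeriv hU v (jetCoord U k i) = algebraMap ℝ _ (v.2 k i) :=
  dirDeriv_of_linear hU
    (LinearMap.proj i ∘ₗ LinearMap.proj k ∘ₗ LinearMap.snd ℝ ℝ (Jet n)) (fun _ => rfl) v

theorem dirDeriv_xCoord (hU : IsOpen U) (v : ℝ × Jet n) :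
    dirDeriv hU v (xCoord U) = algebraMap ℝ _ v.1 :=
  dirDeriv_of_linear hU (LinearMap.fst ℝ ℝ (Jet n)) (fun _ => rfl) v

theorem dirDeriv_coeffFun (hU : IsOpen U) (v : ℝ × Jet n) {c : (Fin n → ℝ) → ℝ}
    (hc : ContDiffOn ℝ ∞ c U) (p : JetOver U) :
    (dirDeriv hU v (coeffFun c hc)).1 p = fderiv ℝ c (p.1.2 0) (v.2 0) := by
  refine dirDeriv_eq hU
    (hasLineDerivAt_extendJet (G := fun q => c (q.2 0)) hU (fun _ => rfl) ?_)
  have h1 : HasFDerivAt c (fderiv ℝ c (p.1.2 0)) (p.1.2 0) :=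
    ((hc.contDiffAt (hU.mem_nhds p.2)).differentiableAt (by simp)).hasFDerivAt
  exact h1.hasLineDerivAt (v.2 0)

end DiffRing

/-! ### The total derivative, and comparison with the concrete bracket -/

section DiffCalc

variable {n : ℕ} {U : Set (Fin n → ℝ)}

/-- The partial derivative `∂/∂uⁱ_{kx}` on the ring of differential functions. -/
noncomputable def jetDeriv (hU : IsOpen U) (k : ℕ) (i : Fin n) :
    Derivation ℝ (diffRing U) (diffRing U) := dirDeriv hU (jetDir k i)

theorem jetDeriv_finite_order (hU : IsOpen U) (F : diffRing U) :
    ∃ N, ∀ k, N ≤ k → ∀ i, jetDeriv hU k i F = 0 := by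
  obtain ⟨N, φ, hφ⟩ := F.2
  exact ⟨N + 1, fun k hk i => dirDeriv_jetDir_eq_zero hU hφ hk i⟩

theorem jetDeriv_finite_order_pair (hU : IsOpen U) (F G : diffRing U) :
    ∃ N, (∀ k, N ≤ k → ∀ i, jetDeriv hU k i F = 0) ∧ ∀ k, N ≤ k → ∀ i, jetDeriv hU k i G = 0 := by
  obtain ⟨N, hN⟩ := jetDeriv_finite_order hU F
  obtain ⟨M, hM⟩ := jetDeriv_finite_order hU G
  exact ⟨max N M, fun k hk => hN k ((le_max_left _ _).trans hk),
    fun k hk => hM k ((le_max_right _ _).trans hk)⟩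

theorem jetDeriv_jetCoord (hU : IsOpen U) (k : ℕ) (i : Fin n) (l : ℕ) (j : Fin n) :
    jetDeriv hU k i (jetCoord U l j) = if k = l ∧ i = j then 1 else 0 := by
  rw [jetDeriv, dirDeriv_jetCoord]
  by_cases hk : k = l
  · subst hk
    by_cases hi : i = j
    · subst hi
      simp [jetDir]
    · simp [jetDir, hi]
  · simp [jetDir, hk]

/-- The total derivative, as a function. -/
noncomputable def totalDerivFun (hU : IsOpen U) (F : diffRing U) : diffRing U :=
  dirDeriv hU xDir F + ∑ᶠ k : ℕ, ∑ i, jetCoord U (k + 1) i * jetDeriv hU k i F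

theorem totalDerivFun_eq_sum (hU : IsOpen U) {F : diffRing U} {N : ℕ}
    (h : ∀ k, N ≤ k → ∀ i, jetDeriv hU k i F = 0) : totalDerivFun hU F
      = dirDeriv hU xDir F
        + ∑ k ∈ Finset.range N, ∑ i, jetCoord U (k + 1) i * jetDeriv hU k i F := by
  rw [totalDerivFun, VarCalc.finsum_eq_sum_range (N := N)]
  exact fun k hk => Finset.sum_eq_zero fun i _ => by rw [h k hk, mul_zero]

/-- The total derivative on the ring of differential functions. -/
noncomputable def diffTotal (hU : IsOpen U) : Derivation ℝ (diffRing U) (diffRing U) :=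
  Derivation.mk'
    { toFun := totalDerivFun hU
      map_add' := fun F G => by
        obtain ⟨N, hF, hG⟩ := jetDeriv_finite_order_pair hU F G
        have hFG : ∀ k, N ≤ k → ∀ i, jetDeriv hU k i (F + G) = 0 := fun k hk i => by
          rw [map_add, hF k hk, hG k hk, add_zero]
        rw [totalDerivFun_eq_sum hU hF, totalDerivFun_eq_sum hU hG, totalDerivFun_eq_sum hU hFG]
        simp only [map_add, mul_add, Finset.sum_add_distrib]
        ring
      map_smul' := fun c F => by
        obtain ⟨N, hF⟩ := jetDeriv_finite_order hU F
        have hcF : ∀ k, N ≤ k → ∀ i, jetDeriv hU k i (c • F) = 0 := fun k hk i => by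
          rw [Derivation.map_smul, hF k hk, smul_zero]
        rw [totalDerivFun_eq_sum hU hF, totalDerivFun_eq_sum hU hcF]
        simp only [Derivation.map_smul, mul_smul_comm, smul_add, Finset.smul_sum,
          RingHom.id_apply] }
    (fun F G => by
        obtain ⟨N, hF, hG⟩ := jetDeriv_finite_order_pair hU F G
        have hFG : ∀ k, N ≤ k → ∀ i, jetDeriv hU k i (F * G) = 0 := fun k hk i => by
          rw [Derivation.leibniz, hF k hk, hG k hk, smul_zero, smul_zero, add_zero]
        simp only [LinearMap.coe_mk, AddHom.coe_mk]
        rw [totalDerivFun_eq_sum hU hF, totalDerivFun_eq_sum hU hG, totalDerivFun_eq_sum hU hFG]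
        simp only [Derivation.leibniz, smul_eq_mul, mul_add, Finset.sum_add_distrib,
          Finset.mul_sum, mul_left_comm]
        ring)

theorem diffTotal_apply (hU : IsOpen U) (F : diffRing U) :
    diffTotal hU F = totalDerivFun hU F := rfl

/-- All derivations involved commute; the correction comes from differentiating the coefficients
`uʲ_{(l+1)x}` of `D`. It is the single term `l = k - 1`, and it is absent for `k = 0`. -/
theorem jetDeriv_diffTotal (hU : IsOpen U) (k : ℕ) (i : Fin n) (F : diffRing U) :
    jetDeriv hU k i (diffTotal hU F)
      = diffTotal hU (jetDeriv hU k i F)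
        + ∑ᶠ l : ℕ, if k = l + 1 then jetDeriv hU l i F else 0 := by
  obtain ⟨N, hF⟩ := jetDeriv_finite_order hU F
  have hkF : ∀ l, N ≤ l → ∀ j, jetDeriv hU l j (jetDeriv hU k i F) = 0 := fun l hl j => by
    have : jetDeriv hU l j (jetDeriv hU k i F) = jetDeriv hU k i (jetDeriv hU l j F) :=
      dirDeriv_comm hU _ _ F
    rw [this, hF l hl, map_zero]
  rw [diffTotal_apply, diffTotal_apply, totalDerivFun_eq_sum hU hF, totalDerivFun_eq_sum hU hkF,
    VarCalc.finsum_eq_sum_range (N := N) (fun l hl => by rw [hF l hl, ite_self])]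
  simp only [map_add, map_sum, Derivation.leibniz, smul_eq_mul, Finset.sum_add_distrib, add_assoc]
  congr 1
  · exact dirDeriv_comm hU _ _ F
  · congr 1
    · exact Finset.sum_congr rfl fun l _ => Finset.sum_congr rfl fun j _ => congrArg _
        (dirDeriv_comm hU _ _ F)
    · refine Finset.sum_congr rfl fun l _ => ?_
      simp only [jetDeriv_jetCoord]
      by_cases h : k = l + 1 <;> simp [h]

/-- The calculus of variations on the ring of differential functions. -/
noncomputable def diffCalc (hU : IsOpen U) : VarCalc n (diffRing U) where
  P := jetDeriv hU
  D := diffTotal hU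
  finite_order := jetDeriv_finite_order hU
  comm _ _ _ _ F := dirDeriv_comm hU _ _ F
  comm_zero i F := by
    rw [jetDeriv_diffTotal]
    simp
  comm_succ k i F := by
    rw [jetDeriv_diffTotal]
    congr 1
    rw [finsum_eq_single _ k]
    · simp
    · intro l hl
      rw [if_neg (by omega)]

theorem diffCalc_D_jetCoord (hU : IsOpen U) (k : ℕ) (i : Fin n) :
    (diffCalc hU).D (jetCoord U k i) = jetCoord U (k + 1) i := by
  change totalDerivFun hU _ = _
  rw [totalDerivFun_eq_sum (N := k + 1) hU (fun l hl j => by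
    rw [jetDeriv_jetCoord, if_neg (by omega)])]
  rw [dirDeriv_jetCoord, Finset.sum_eq_single k]
  · simp [jetDeriv_jetCoord, xDir]
  · intro l _ hl
    simp [jetDeriv_jetCoord, hl]
  · simp

theorem diffCalc_P_coeffFun_zero (hU : IsOpen U) {c : (Fin n → ℝ) → ℝ} (hc : ContDiffOn ℝ ∞ c U)
    (i : Fin n) (p : JetOver U) :
    ((diffCalc hU).P 0 i (coeffFun c hc)).1 p = pderiv i c (p.1.2 0) := by
  refine (dirDeriv_coeffFun hU _ hc p).trans ?_
  simp [jetDir, pderiv]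

theorem diffCalc_P_coeffFun_succ (hU : IsOpen U) {c : (Fin n → ℝ) → ℝ} (hc : ContDiffOn ℝ ∞ c U)
    (k : ℕ) (i : Fin n) : (diffCalc hU).P (k + 1) i (coeffFun c hc) = 0 := by
  refine diffRing_ext fun p => (dirDeriv_coeffFun hU _ hc p).trans ?_
  have : (jetDir (k + 1) i).2 0 = 0 := by simp [jetDir]
  rw [this, map_zero]
  rfl

theorem isCoeff_coeffFun (hU : IsOpen U) {c : (Fin n → ℝ) → ℝ} (hc : ContDiffOn ℝ ∞ c U) :
    (diffCalc hU).IsCoeff (jetCoord U 1) (coeffFun c hc) where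
  partial_succ := diffCalc_P_coeffFun_succ hU hc
  total := by
    change totalDerivFun hU _ = _
    rw [totalDerivFun_eq_sum (N := 1) hU (fun l hl j => by
      obtain ⟨l, rfl⟩ : ∃ m, l = m + 1 := ⟨l - 1, by omega⟩
      exact diffCalc_P_coeffFun_succ hU hc l j)]
    have hx : dirDeriv hU xDir (coeffFun c hc) = 0 := by
      refine diffRing_ext fun p => (dirDeriv_coeffFun hU _ hc p).trans ?_
      have : (xDir : ℝ × Jet n).2 0 = 0 := rfl
      rw [this, map_zero]
      rfl
    rw [hx, zero_add, Finset.sum_range_one]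
    exact Finset.sum_congr rfl fun l _ => mul_comm _ _

/-- `F` is the restriction of `f` to jets over `U`. -/
def Restricts (f : ℝ → Jet n → ℝ) (F : diffRing U) : Prop := ∀ p : JetOver U, f p.1.1 p.1.2 = F.1 p

theorem isDiffFun_iff {f : ℝ → Jet n → ℝ} : IsDiffFun U f ↔ ∃ F : diffRing U, Restricts f F := by
  constructor
  · rintro ⟨N, φ, hφ, h⟩
    refine ⟨⟨fun p => f p.1.1 p.1.2, N, φ, hφ, fun p hp => ?_⟩, fun p => rfl⟩
    simp only [extendJet, dif_pos hp]
    exact h p.1 p.2 hp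
  · rintro ⟨F, hF⟩
    obtain ⟨N, φ, hφ⟩ := F.2
    refine ⟨N, φ, hφ.smooth, fun x j hj => ?_⟩
    have h1 := hF ⟨(x, j), hj⟩
    have h2 := hφ.eq (x, j) hj
    simp only [extendJet, dif_pos hj] at h2
    exact h1.trans h2

theorem Restricts.hasLineDerivAt (hU : IsOpen U) {f : ℝ → Jet n → ℝ} {F : diffRing U}
    (hF : Restricts f F) (p : JetOver U) (v : ℝ × Jet n) :
    HasLineDerivAt ℝ (fun q : ℝ × Jet n => f q.1 q.2) ((dirDeriv hU v F).1 p) p.1 v := by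
  obtain ⟨N, φ, hφ⟩ := F.2
  have h1 : Expresses U N φ (fun q : ℝ × Jet n => f q.1 q.2) := hφ.congr fun q hq => by
    simp only [extendJet, dif_pos hq]
    exact hF ⟨q, hq⟩
  have h2 := h1.hasLineDerivAt hU p.2 v
  rwa [← (hφ.hasLineDerivAt hU p.2 v).lineDeriv] at h2

theorem Restricts.jetPartial (hU : IsOpen U) {f : ℝ → Jet n → ℝ} {F : diffRing U}
    (hF : Restricts f F) (k : ℕ) (i : Fin n) :
    Restricts (jetPartial k i f) ((diffCalc hU).P k i F) := by
  intro p
  have h : HasDerivAt (fun t : ℝ => f (p.1.1 + t * (jetDir k i).1) (p.1.2 + t • (jetDir k i).2))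
      (((diffCalc hU).P k i F).1 p) 0 := hF.hasLineDerivAt hU p (jetDir k i)
  have h2 : HasDerivAt (fun t => f p.1.1
      (Function.update p.1.2 k (Function.update (p.1.2 k) i t))) (((diffCalc hU).P k i F).1 p)
      (p.1.2 k i) := by
    -- The line derivative is taken at parameter `0`, whereas `jetPartial` differentiates at the
    -- value of the coordinate; the parameter is translated.
    rw [← sub_self (p.1.2 k i)] at h
    have h3 := h.comp_sub_const (p.1.2 k i) (p.1.2 k i)
    refine h3.congr_of_eventuallyEq (Filter.Eventually.of_forall fun t => ?_)
    have h4 : Function.update p.1.2 k (Function.update (p.1.2 k) i t)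
        = p.1.2 + (t - p.1.2 k i) • (jetDir k i).2 := by
      funext l m
      by_cases hl : l = k
      · subst hl
        by_cases hm : m = i
        · subst hm
          simp [jetDir]
        · simp [jetDir, hm]
      · simp [jetDir, hl]
    simp only [h4]
    simp [jetDir]
  exact h2.deriv

theorem Restricts.deriv_x (hU : IsOpen U) {f : ℝ → Jet n → ℝ} {F : diffRing U}
    (hF : Restricts f F) (p : JetOver U) :
    deriv (fun s => f s p.1.2) p.1.1 = (dirDeriv hU xDir F).1 p := by
  have h : HasDerivAt (fun t : ℝ => f (p.1.1 + t * (1 : ℝ)) (p.1.2 + t • (0 : Jet n)))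
      ((dirDeriv hU xDir F).1 p) 0 := hF.hasLineDerivAt hU p xDir
  rw [← sub_self p.1.1] at h
  have h3 := h.comp_sub_const p.1.1 p.1.1
  simp only [mul_one, add_sub_cancel, smul_zero, add_zero] at h3
  exact h3.deriv

theorem diffRing_sum_apply {ι : Type*} (s : Finset ι) (F : ι → diffRing U) (p : JetOver U) :
    (∑ i ∈ s, F i).1 p = ∑ i ∈ s, (F i).1 p := by
  have h := map_sum ((Pi.evalRingHom (fun _ : JetOver U => ℝ) p).comp
    (diffRing U).val.toRingHom) F s
  exact h

theorem Restricts.totalDeriv (hU : IsOpen U) {f : ℝ → Jet n → ℝ} {F : diffRing U}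
    (hF : Restricts f F) : Restricts (totalDeriv f) ((diffCalc hU).D F) := by
  intro p
  obtain ⟨N, hN⟩ := jetDeriv_finite_order hU F
  have hP : ∀ k i, _root_.jetPartial k i f p.1.1 p.1.2 = (jetDeriv hU k i F).1 p :=
    fun k i => hF.jetPartial hU k i p
  change deriv _ _ + ∑ᶠ k : ℕ, _ = (totalDerivFun hU F).1 p
  rw [totalDerivFun_eq_sum hU hN, hF.deriv_x hU,
    VarCalc.finsum_eq_sum_range (N := N) (fun k hk => Finset.sum_eq_zero fun i _ => by
      rw [hP, hN k hk]; exact mul_zero _)]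
  simp only [hP]
  refine congrArg _ ?_
  change _ = (∑ k ∈ _, _ : diffRing U).1 p
  rw [diffRing_sum_apply]
  refine Finset.sum_congr rfl fun k _ => ?_
  rw [diffRing_sum_apply]
  rfl

theorem Restricts.iterate_totalDeriv (hU : IsOpen U) {f : ℝ → Jet n → ℝ} {F : diffRing U}
    (hF : Restricts f F) (k : ℕ) :
    Restricts (_root_.totalDeriv^[k] f) ((diffCalc hU).D^[k] F) := by
  induction k with
  | zero => exact hF
  | succ k ih =>
    rw [Function.iterate_succ_apply', Function.iterate_succ_apply']
    exact ih.totalDeriv hU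

theorem Restricts.varDeriv (hU : IsOpen U) {f : ℝ → Jet n → ℝ} {F : diffRing U}
    (hF : Restricts f F) (i : Fin n) : Restricts (varDeriv i f) ((diffCalc hU).euler i F) := by
  intro p
  obtain ⟨N, hN⟩ := (diffCalc hU).exists_hasOrder F
  have hP : ∀ k, _root_.totalDeriv^[k] (_root_.jetPartial k i f) p.1.1 p.1.2
      = ((diffCalc hU).D^[k] ((diffCalc hU).P k i F)).1 p :=
    fun k => (hF.jetPartial hU k i).iterate_totalDeriv hU k p
  change ∑ᶠ k : ℕ, _ = _
  rw [(diffCalc hU).euler_eq_sum hN, diffRing_sum_apply,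
    VarCalc.finsum_eq_sum_range (N := N) (fun k hk => by
      rw [hP, hN k hk, VarCalc.iterate_D_zero]; exact mul_zero _)]
  refine Finset.sum_congr rfl fun k _ => ?_
  rw [hP]
  rfl

theorem Restricts.functionalIsZero_iff (hU : IsOpen U) {f : ℝ → Jet n → ℝ} {F : diffRing U}
    (hF : Restricts f F) : FunctionalIsZero U f ↔ F ∈ (diffCalc hU).exact := by
  constructor
  · rintro ⟨q, hq, h⟩
    obtain ⟨Q, hQ⟩ := isDiffFun_iff.1 hq
    refine ⟨Q, diffRing_ext fun p => ?_⟩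
    rw [← hF p, h _ _ p.2]
    exact (hQ.totalDeriv hU p).symm
  · rintro ⟨Q, rfl⟩
    have hQ : Restricts (fun x j => extendJet Q.1 (x, j)) Q := fun p => extendJet_apply Q.1 p
    exact ⟨_, isDiffFun_iff.2 ⟨Q, hQ⟩, fun x j hj =>
      (hF ⟨(x, j), hj⟩).trans (hQ.totalDeriv hU ⟨(x, j), hj⟩).symm⟩

theorem Restricts.add {f g : ℝ → Jet n → ℝ} {F G : diffRing U} (hF : Restricts f F)
    (hG : Restricts g G) : Restricts (f + g) (F + G) := fun p =>
  congrArg₂ (· + ·) (hF p) (hG p)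

theorem exists_restricts (F : diffRing U) : ∃ f, IsDiffFun U f ∧ Restricts f F := by
  have hF : Restricts (fun x j => extendJet F.1 (x, j)) F := fun p => extendJet_apply F.1 p
  exact ⟨_, isDiffFun_iff.2 ⟨F, hF⟩, hF⟩

namespace HydroOp

/-- The coefficients of an operator as differential functions. -/
noncomputable def opData (A : HydroOp n) (hU : IsOpen U) (hA : A.IsSmoothOn U) :
    (diffCalc hU).OpData where
  g i j := coeffFun (fun u => A.g u i j) (hA.g i j)
  b i j k := coeffFun (fun u => A.b u i j k) (hA.b i j k)
  w i j := coeffFun (fun u => A.w u i j) (hA.w i j)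
  ux := jetCoord U 1
  partial_ux k i l := jetDeriv_jetCoord hU k i 1 l
  g_coeff _ _ := isCoeff_coeffFun hU _
  b_coeff _ _ _ := isCoeff_coeffFun hU _
  w_coeff _ _ := isCoeff_coeffFun hU _

theorem bracket_restricts (A : HydroOp n) (hU : IsOpen U) (hA : A.IsSmoothOn U)
    {f g : ℝ → Jet n → ℝ} {F G : diffRing U} (hF : Restricts f F) (hG : Restricts g G) :
    Restricts (A.bracket f g) ((A.opData hU hA).bracket F G) := by
  intro p
  change ∑ i, _ = (∑ i, _ : diffRing U).1 p
  rw [diffRing_sum_apply]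
  refine Finset.sum_congr rfl fun i _ => ?_
  refine congrArg₂ (· * ·) (hF.varDeriv hU i p) ?_
  change ∑ l, _ = (∑ l, _ : diffRing U).1 p
  rw [diffRing_sum_apply]
  refine Finset.sum_congr rfl fun l _ => ?_
  have h1 := (hG.varDeriv hU l).totalDeriv hU p
  have h2 := hG.varDeriv hU l p
  have h3 : (∑ k, A.b (p.1.2 0) i l k * p.1.2 1 k) = ((A.opData hU hA).bu i l).1 p := by
    change _ = (∑ k, _ : diffRing U).1 p
    rw [diffRing_sum_apply]
    rfl
  exact congrArg₂ (· + ·) (congrArg₂ (· + ·) (congrArg _ h1) (congrArg₂ (· * ·) h3 h2))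
    (congrArg _ h2)

/-- Differential functions, brackets and exactness depend only on restrictions to jets over `U`, so
the definition transfers to the ring. -/
theorem isHamiltonian_iff (A : HydroOp n) (hU : IsOpen U) (hA : A.IsSmoothOn U) :
    A.IsHamiltonian U ↔
      (∀ F G, (A.opData hU hA).bracket F G + (A.opData hU hA).bracket G F ∈ (diffCalc hU).exact) ∧
      ∀ F G H, (A.opData hU hA).bracket ((A.opData hU hA).bracket F G) H
        + (A.opData hU hA).bracket ((A.opData hU hA).bracket G H) F
        + (A.opData hU hA).bracket ((A.opData hU hA).bracket H F) G ∈ (diffCalc hU).exact := by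
  have hb := fun f g F G => A.bracket_restricts hU hA (f := f) (g := g) (F := F) (G := G)
  constructor
  · rintro ⟨h1, h2⟩
    refine ⟨fun F G => ?_, fun F G H => ?_⟩
    · obtain ⟨f, hf, hF⟩ := exists_restricts F
      obtain ⟨g, hg, hG⟩ := exists_restricts G
      exact (((hb _ _ _ _ hF hG).add (hb _ _ _ _ hG hF)).functionalIsZero_iff hU).1 (h1 f g hf hg)
    · obtain ⟨f, hf, hF⟩ := exists_restricts F
      obtain ⟨g, hg, hG⟩ := exists_restricts G
      obtain ⟨h, hh, hH⟩ := exists_restricts H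
      exact ((((hb _ _ _ _ (hb _ _ _ _ hF hG) hH).add (hb _ _ _ _ (hb _ _ _ _ hG hH) hF)).add
        (hb _ _ _ _ (hb _ _ _ _ hH hF) hG)).functionalIsZero_iff hU).1 (h2 f g h hf hg hh)
  · rintro ⟨h1, h2⟩
    refine ⟨fun f g hf hg => ?_, fun f g h hf hg hh => ?_⟩
    · obtain ⟨F, hF⟩ := isDiffFun_iff.1 hf
      obtain ⟨G, hG⟩ := isDiffFun_iff.1 hg
      exact (((hb _ _ _ _ hF hG).add (hb _ _ _ _ hG hF)).functionalIsZero_iff hU).2 (h1 F G)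
    · obtain ⟨F, hF⟩ := isDiffFun_iff.1 hf
      obtain ⟨G, hG⟩ := isDiffFun_iff.1 hg
      obtain ⟨H, hH⟩ := isDiffFun_iff.1 hh
      exact ((((hb _ _ _ _ (hb _ _ _ _ hF hG) hH).add (hb _ _ _ _ (hb _ _ _ _ hG hH) hF)).add
        (hb _ _ _ _ (hb _ _ _ _ hH hF) hG)).functionalIsZero_iff hU).2 (h2 F G H)

/-- The point `x = 0`, `u = u₀`, with all derivatives equal to zero. -/
noncomputable def point (A : HydroOp n) (hU : IsOpen U) (hA : A.IsSmoothOn U) (u₀ : Fin n → ℝ)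
    (hu : u₀ ∈ U) : (A.opData hU hA).Point where
  ε := (Pi.evalRingHom (fun _ : JetOver U => ℝ)
    ⟨(0, fun k => if k = 0 then u₀ else 0), by simpa using hu⟩).comp (diffRing U).val.toRingHom
  u := jetCoord U 0
  x := xCoord U
  vanishes_ux l := by
    refine ⟨?_, ?_⟩
    · simp [opData, jetCoord]
    · have : (diffCalc hU).D ((A.opData hU hA).ux l) = jetCoord U 2 l :=
        diffCalc_D_jetCoord hU 1 l
      rw [this]
      simp [jetCoord]
  u_coeff l := isCoeff_coeffFun hU (c := fun u => u l) (by fun_prop)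
  partial_u i l := by
    refine (jetDeriv_jetCoord hU 0 i 0 l).trans ?_
    simp only [true_and]
  partial_x k i := by
    have : (diffCalc hU).P k i (xCoord U) = algebraMap ℝ _ (jetDir k i).1 := dirDeriv_xCoord hU _
    rw [this]
    simp [jetDir]
  D_x := by
    have h : ∀ k i, jetDeriv hU k i (xCoord U) = 0 := fun k i => by
      rw [jetDeriv, dirDeriv_xCoord]
      simp [jetDir]
    change totalDerivFun hU (xCoord U) = 1
    rw [totalDerivFun_eq_sum (N := 0) hU (fun k _ i => h k i), dirDeriv_xCoord]
    simp [xDir]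
  ε_x := rfl
  ε_algebraMap r := rfl

end HydroOp

end DiffCalc

/-! ### The Levi-Civita connection in contravariant form -/

section LeviCivita

open scoped Matrix

variable {n : ℕ} {R : Type*} [CommRing R] [Algebra ℝ R]

/-- A contravariant metric `g` with inverse `h` and Christoffel symbols `Γ`, over a ring of
functions with partial derivatives `d`. -/
structure LeviCivita (d : Fin n → Derivation ℝ R R) where
  g : Matrix (Fin n) (Fin n) R
  h : Matrix (Fin n) (Fin n) R
  Γ : Fin n → Fin n → Fin n → R
  g_symm : ∀ i j, g i j = g j i
  h_symm : ∀ i j, h i j = h j i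
  g_mul_h : g * h = 1
  two_Γ : ∀ i j k, 2 * Γ i j k = ∑ l, g i l * (d j (h l k) + d k (h l j) - d l (h j k))

theorem eq_zero_of_two_mul {x : R} (hx : 2 * x = 0) : x = 0 := by
  have h2 : algebraMap ℝ R (1 / 2) * 2 = 1 := by
    have : (2 : R) = algebraMap ℝ R 2 := (map_ofNat _ _).symm
    rw [this, ← map_mul]
    simp
  linear_combination algebraMap ℝ R (1 / 2) * hx - x * h2

namespace LeviCivita

variable {d : Fin n → Derivation ℝ R R} (L : LeviCivita d)

theorem h_mul_g : L.h * L.g = 1 := mul_eq_one_comm.1 L.g_mul_h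

theorem eq_zero_of_g_mul {x : Fin n → R} (hx : ∀ i, ∑ l, L.g i l * x l = 0) (l : Fin n) :
    x l = 0 := by
  have h1 : L.g.mulVec x = 0 := funext hx
  have h2 : L.h.mulVec (L.g.mulVec x) = x := by
    rw [Matrix.mulVec_mulVec, L.h_mul_g, Matrix.one_mulVec]
  rw [← h2, h1, Matrix.mulVec_zero]
  rfl

theorem Γ_symm (i j k : Fin n) : L.Γ i j k = L.Γ i k j := by
  rw [← sub_eq_zero]
  apply eq_zero_of_two_mul
  rw [mul_sub, L.two_Γ, L.two_Γ, ← Finset.sum_sub_distrib]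
  refine Finset.sum_eq_zero fun l _ => ?_
  rw [L.h_symm j k]
  ring

/-- `Γⁱʲₖ = -gⁱˢ Γʲ_{sk}`. -/
def β (i j k : Fin n) : R := -∑ s, L.g i s * L.Γ j s k

theorem h_mul_Γ (k j l : Fin n) :
    2 * ∑ a, L.h k a * L.Γ a j l = d j (L.h k l) + d l (L.h k j) - d k (L.h j l) := by
  have h1 : (L.h * L.g).mulVec (fun b => d j (L.h b l) + d l (L.h b j) - d b (L.h j l)) k
      = d j (L.h k l) + d l (L.h k j) - d k (L.h j l) := by
    rw [L.h_mul_g, Matrix.one_mulVec]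
  rw [← h1, ← Matrix.mulVec_mulVec, Finset.mul_sum]
  refine Finset.sum_congr rfl fun a _ => ?_
  rw [mul_left_comm, L.two_Γ]
  rfl

/-- Metricity for the covariant metric: in the sum of two lowered Christoffel symbols the remaining
derivatives of `h` cancel. -/
theorem d_h (l j k : Fin n) :
    d l (L.h k j) = (∑ a, L.h k a * L.Γ a j l) + ∑ a, L.h j a * L.Γ a k l := by
  rw [← sub_eq_zero]
  apply eq_zero_of_two_mul
  rw [mul_sub, mul_add, L.h_mul_Γ, L.h_mul_Γ, L.h_symm j l, L.h_symm j k, L.h_symm k l]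
  ring

theorem d_g (l i j : Fin n) : d l (L.g i j) = L.β i j l + L.β j i l := by
  let G : Matrix (Fin n) (Fin n) R := Matrix.of fun i j => L.Γ i j l
  let dg : Matrix (Fin n) (Fin n) R := L.g.map (d l)
  let dh : Matrix (Fin n) (Fin n) R := L.h.map (d l)
  have hg : L.gᵀ = L.g := Matrix.ext fun i j => L.g_symm j i
  have hh : L.hᵀ = L.h := Matrix.ext fun i j => L.h_symm j i
  have h1 : dg * L.h + L.g * dh = 0 := by
    ext a b
    have h2 : d l ((L.g * L.h) a b) = 0 := by
      rw [L.g_mul_h, Matrix.one_apply]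
      split_ifs <;> simp
    rw [Matrix.mul_apply, map_sum] at h2
    simp only [Matrix.add_apply, Matrix.mul_apply, ← Finset.sum_add_distrib, Matrix.zero_apply]
    rw [← h2]
    refine Finset.sum_congr rfl fun c _ => ?_
    simp only [dg, dh, Matrix.map_apply, Derivation.leibniz, smul_eq_mul]
    ring
  have h2 : dh = L.h * G + (L.h * G)ᵀ := by
    ext a b
    exact L.d_h l b a
  have h3 : dg = -(G * L.g) - (G * L.g)ᵀ := by
    -- Differentiating `g h = 1` turns metricity for `h` into metricity for `g`.
    have h4 : dg = -(L.g * dh * L.g) := by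
      have h5 : dg = dg * L.h * L.g := by rw [Matrix.mul_assoc, L.h_mul_g, Matrix.mul_one]
      rw [h5, eq_neg_of_add_eq_zero_left h1, Matrix.neg_mul]
    rw [h4, h2, Matrix.mul_add, Matrix.add_mul, Matrix.transpose_mul, hh, Matrix.transpose_mul, hg,
      ← Matrix.mul_assoc, L.g_mul_h, Matrix.one_mul, Matrix.mul_assoc L.g, Matrix.mul_assoc Gᵀ,
      L.h_mul_g, Matrix.mul_one, neg_add']
  have h4 : d l (L.g i j) = dg i j := rfl
  rw [h4, h3]
  simp only [Matrix.sub_apply, Matrix.neg_apply, Matrix.transpose_apply, Matrix.mul_apply, β, G,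
    Matrix.of_apply]
  have h5 : ∀ i j, ∑ s, L.Γ i s l * L.g s j = ∑ s, L.g j s * L.Γ i s l := fun i j =>
    Finset.sum_congr rfl fun s _ => by rw [mul_comm, L.g_symm s j]
  rw [h5, h5]
  ring

theorem torsion (i j m : Fin n) :
    ∑ l, L.β j i l * L.g l m = ∑ l, L.β m i l * L.g l j := by
  simp only [β, neg_mul, Finset.sum_neg_distrib, Finset.sum_mul]
  rw [Finset.sum_comm]
  refine congrArg _ (Finset.sum_congr rfl fun s _ => Finset.sum_congr rfl fun l _ => ?_)
  rw [L.Γ_symm i s l, L.g_symm j s, L.g_symm l m]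
  ring

/-- Uniqueness of the Levi-Civita connection in contravariant form. -/
theorem eq_β {b : Fin n → Fin n → Fin n → R} (h1 : ∀ l i j, d l (L.g i j) = b i j l + b j i l)
    (h2 : ∀ i j m, ∑ l, b j i l * L.g l m = ∑ l, b m i l * L.g l j) (i j k : Fin n) :
    b i j k = L.β i j k := by
  -- The difference of the two connections with its last index raised. Metricity makes it skew in
  -- the first two slots, and torsion-freeness makes it symmetric in the first and third; a tensor
  -- with both symmetries is zero.
  let T : Fin n → Fin n → Fin n → R := fun j i m => ∑ l, (b j i l - L.β j i l) * L.g l m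
  have hT1 : ∀ j i m, T j i m = - T i j m := by
    intro j i m
    simp only [T]
    rw [← Finset.sum_neg_distrib]
    refine Finset.sum_congr rfl fun l _ => ?_
    linear_combination L.g l m * (L.d_g l j i - h1 l j i)
  have hT2 : ∀ j i m, T j i m = T m i j := by
    intro j i m
    simp only [T, sub_mul, Finset.sum_sub_distrib]
    rw [h2, L.torsion]
  have hT : ∀ j i m, T j i m = 0 := by
    intro j i m
    apply eq_zero_of_two_mul
    linear_combination hT1 j i m - hT2 i j m - hT1 m j i + hT2 j m i + hT1 i m j - hT2 m i j
  rw [← sub_eq_zero]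
  refine L.eq_zero_of_g_mul (x := fun l => b i j l - L.β i j l) (fun m => ?_) k
  rw [← hT i j m]
  exact Finset.sum_congr rfl fun l _ => by rw [mul_comm, L.g_symm m l]

/-- The curvature `Rʲ_{skl}`. -/
def curvature (j s k l : Fin n) : R :=
  d k (L.Γ j l s) - d l (L.Γ j k s)
    + ∑ m, (L.Γ j k m * L.Γ m l s - L.Γ j l m * L.Γ m k s)

/-- `Rⁱʲ_{kl} = gⁱˢ Rʲ_{skl}`. -/
def contraCurvature (i j k l : Fin n) : R := ∑ s, L.g i s * L.curvature j s k l

/-- `∂ₗ Γʲᵐᵣ - ∂ᵣ Γʲᵐₗ`. -/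
def curlβ (j m l r : Fin n) : R := d l (L.β j m r) - d r (L.β j m l)

/-- Differentiate `β = -g Γ`, with `∂g` given by metricity. The derivatives of `Γ` assemble into the
curvature, whose `ΓΓ` terms absorb one half of `∂g`. -/
theorem curlβ_eq (j m l r : Fin n) : L.curlβ j m l r
    = (∑ s, (L.β s j r * L.Γ m s l - L.β s j l * L.Γ m s r)) - L.contraCurvature j m l r := by
  have h1 : ∀ l r, d l (L.β j m r) = -∑ s, ((L.β j s l + L.β s j l) * L.Γ m s r
      + L.g j s * d l (L.Γ m s r)) := by
    intro l r
    simp only [β, map_neg, map_sum]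
    refine congrArg _ (Finset.sum_congr rfl fun s _ => ?_)
    rw [Derivation.leibniz, L.d_g, β, β, smul_eq_mul, smul_eq_mul]
    ring
  have h2 : ∑ s, L.g j s * ∑ t, (L.Γ m l t * L.Γ t r s - L.Γ m r t * L.Γ t l s)
      = ∑ t, (L.β j t l * L.Γ m t r - L.β j t r * L.Γ m t l) := by
    simp only [Finset.mul_sum]
    rw [Finset.sum_comm]
    refine Finset.sum_congr rfl fun t _ => ?_
    simp only [β, neg_mul, sub_neg_eq_add, Finset.sum_mul]
    rw [← Finset.sum_neg_distrib, ← Finset.sum_add_distrib]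
    refine Finset.sum_congr rfl fun s _ => ?_
    rw [L.Γ_symm m l t, L.Γ_symm m r t, L.Γ_symm t r s, L.Γ_symm t l s]
    ring
  simp only [curlβ, contraCurvature, curvature, mul_add, Finset.sum_add_distrib, h2]
  rw [h1, h1, ← sub_eq_zero]
  simp only [← Finset.sum_neg_distrib, ← Finset.sum_sub_distrib, ← Finset.sum_add_distrib]
  refine Finset.sum_eq_zero fun s _ => ?_
  rw [L.Γ_symm m s r, L.Γ_symm m s l]
  ring

/-- The two products `β β` cancel against the `β Γ` terms of `curlβ_eq`, one after a use of
torsion-freeness, so that only the curvature remains. -/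
theorem curvature_eq (i j m r : Fin n) :
    ∑ l, (L.β i m l * L.β l j r - L.β i j l * L.β l m r + L.curlβ j m l r * L.g l i)
      = -∑ l, L.g i l * L.contraCurvature j m l r := by
  have h1 : ∑ l, (∑ s, L.β s j l * L.Γ m s r) * L.g l i = -∑ l, L.β i j l * L.β l m r := by
    simp only [Finset.sum_mul]
    rw [Finset.sum_comm]
    have h2 : ∀ s, ∑ l, L.β s j l * L.Γ m s r * L.g l i
        = ∑ l, L.β i j l * L.g l s * L.Γ m s r := by
      intro s
      have := L.torsion j s i
      calc _ = (∑ l, L.β s j l * L.g l i) * L.Γ m s r := by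
            rw [Finset.sum_mul]; exact Finset.sum_congr rfl fun l _ => by ring
        _ = _ := by rw [this, Finset.sum_mul]
    simp only [h2]
    rw [Finset.sum_comm, ← Finset.sum_neg_distrib]
    refine Finset.sum_congr rfl fun l _ => ?_
    have h3 : L.β l m r = -∑ s, L.g l s * L.Γ m s r := rfl
    rw [h3, mul_neg, neg_neg, Finset.mul_sum]
    exact Finset.sum_congr rfl fun s _ => by ring
  have h3 : ∑ l, (∑ s, L.β s j r * L.Γ m s l) * L.g l i = -∑ l, L.β i m l * L.β l j r := by
    simp only [Finset.sum_mul]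
    rw [Finset.sum_comm, ← Finset.sum_neg_distrib]
    refine Finset.sum_congr rfl fun s _ => ?_
    have h4 : L.β i m s = -∑ l, L.g i l * L.Γ m l s := rfl
    rw [h4, neg_mul, neg_neg, Finset.sum_mul]
    refine Finset.sum_congr rfl fun l _ => ?_
    rw [L.Γ_symm m s l, L.g_symm i l]
    ring
  simp only [curlβ_eq, sub_mul, Finset.sum_add_distrib, Finset.sum_sub_distrib, h1, h3]
  have h4 : ∑ l, L.contraCurvature j m l r * L.g l i
      = ∑ l, L.g i l * L.contraCurvature j m l r :=
    Finset.sum_congr rfl fun l _ => by rw [mul_comm, L.g_symm l i]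
  rw [h4]
  ring

end LeviCivita

end LeviCivita

/-- The values of the coefficients of an operator and of their derivatives:
`dg i j l = ∂ₗ gⁱʲ`, `db i j k l = ∂ₗ bⁱʲₖ`, `ddw i j l r = ∂ᵣ ∂ₗ wⁱʲ`. -/
@[ext]
structure CoeffJet (n : ℕ) (S : Type*) where
  g : Fin n → Fin n → S
  dg : Fin n → Fin n → Fin n → S
  b : Fin n → Fin n → Fin n → S
  db : Fin n → Fin n → Fin n → Fin n → S
  w : Fin n → Fin n → S
  dw : Fin n → Fin n → Fin n → S
  ddw : Fin n → Fin n → Fin n → Fin n → S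

/-! ### The conditions in terms of coefficients and their derivatives -/

namespace CoeffJet

variable {n : ℕ} {S : Type*} [CommRing S]

def curl (J : CoeffJet n S) (i j l r : Fin n) : S := J.db i j r l - J.db i j l r

def killing (J : CoeffJet n S) (i j m : Fin n) : S :=
  ∑ l, (J.g l i * J.dw j m l - J.b i j l * J.w l m + J.b i m l * J.w l j)

def dkilling (J : CoeffJet n S) (i j m r : Fin n) : S :=
  ∑ l, (J.dg l i r * J.dw j m l + J.g l i * J.ddw j m l r
    - (J.db i j l r * J.w l m + J.b i j l * J.dw l m r)
    + (J.db i m l r * J.w l j + J.b i m l * J.dw l j r))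

def curvature (J : CoeffJet n S) (i j m r : Fin n) : S :=
  ∑ l, (J.b i m l * J.b l j r - J.b i j l * J.b l m r + J.curl j m l r * J.g l i)

def mixed (J : CoeffJet n S) (i j m r : Fin n) : S :=
  ∑ l, (J.curl i j l r * J.w l m + J.dw i j l * J.b l m r
    + (J.curl j m l r * J.w l i + J.dw j m l * J.b l i r)
    + (J.curl m i l r * J.w l j + J.dw m i l * J.b l j r))

/-- It is paired with `uʳₓ uˢₓ`, so only its symmetrisation in `r`, `s` matters. -/
def quadratic (J : CoeffJet n S) (i j m r s : Fin n) : S :=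
  ∑ l, (J.curl i j l r * J.b l m s + J.curl j m l r * J.b l i s + J.curl m i l r * J.b l j s)

structure IsSkew (J : CoeffJet n S) : Prop where
  g_symm : ∀ i j, J.g i j = J.g j i
  dg_eq : ∀ i j l, J.dg i j l = J.b i j l + J.b j i l
  w_skew : ∀ i j, J.w i j = -J.w j i

/-- The part of the conditions for the Jacobi identity that suffices in the nondegenerate case. -/
structure IsPreJacobi (J : CoeffJet n S) : Prop where
  torsion : ∀ i j m, ∑ l, (J.b j i l * J.g l m - J.b m i l * J.g l j) = 0
  curvature : ∀ i j m r, J.curvature i j m r = 0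
  killing : ∀ i j m, J.killing i j m = J.killing j m i
  poisson : ∀ i j m, ∑ l, (J.dw i j l * J.w l m + J.dw j m l * J.w l i + J.dw m i l * J.w l j) = 0

/-- The conditions for the Jacobi identity. -/
structure IsJacobi (J : CoeffJet n S) : Prop extends J.IsPreJacobi where
  mixed : ∀ i j m r, J.dkilling i j m r = J.mixed i j m r
  quadratic : ∀ i j m r s, J.quadratic i j m r s + J.quadratic i j m s r = 0

end CoeffJet

/-! ### Flat metrics: the quadratic and mixed conditions -/

section Flat

open scoped Matrix

variable {n : ℕ} {R : Type*} [CommRing R] [Algebra ℝ R]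

/-- The jet of coefficients given as ring elements. -/
def CoeffJet.of (d : Fin n → Derivation ℝ R R) (g : Fin n → Fin n → R)
    (b : Fin n → Fin n → Fin n → R) (w : Fin n → Fin n → R) : CoeffJet n R where
  g := g
  dg i j l := d l (g i j)
  b := b
  db i j k l := d l (b i j k)
  w := w
  dw i j l := d l (w i j)
  ddw i j l r := d r (d l (w i j))

theorem CoeffJet.d_killing (d : Fin n → Derivation ℝ R R) (g : Fin n → Fin n → R)
    (b : Fin n → Fin n → Fin n → R) (w : Fin n → Fin n → R) (i j m r : Fin n) :
    d r ((CoeffJet.of d g b w).killing i j m) = (CoeffJet.of d g b w).dkilling i j m r := by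
  simp only [killing, dkilling, CoeffJet.of, map_sum, map_add, map_sub, Derivation.leibniz,
    smul_eq_mul]
  exact Finset.sum_congr rfl fun l _ => by ring

namespace LeviCivita

variable {d : Fin n → Derivation ℝ R R} (L : LeviCivita d)

theorem contraCurvature_eq_zero (w : Fin n → Fin n → R)
    (h : ∀ i j m r, (CoeffJet.of d L.g L.β w).curvature i j m r = 0) (i j k l : Fin n) :
    L.contraCurvature i j k l = 0 := by
  refine L.eq_zero_of_g_mul (x := fun k => L.contraCurvature i j k l) (fun m => ?_) k
  rw [← neg_eq_zero, ← L.curvature_eq]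
  exact h m i j l

theorem curvature_eq_zero (hL : ∀ i j k l, L.contraCurvature i j k l = 0) (j s k l : Fin n) :
    L.curvature j s k l = 0 :=
  L.eq_zero_of_g_mul (x := fun s => L.curvature j s k l) (fun i => hL i j k l) s

/-- Without curvature the curl of `β` is itself quadratic in `Γ`. The condition becomes a cyclic
alternating sum of cubic expressions `B`, which cancels after symmetrisation in `r`, `s`. -/
theorem flat_quadratic (hL : ∀ i j k l, L.contraCurvature i j k l = 0) (w : Fin n → Fin n → R)
    (i j m r s : Fin n) : (CoeffJet.of d L.g L.β w).quadratic i j m r s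
      + (CoeffJet.of d L.g L.β w).quadratic i j m s r = 0 := by
  let G : Fin n → Matrix (Fin n) (Fin n) R := fun i => Matrix.of fun p q => L.Γ i p q
  let v : Fin n → Fin n → Fin n → R := fun j r p => L.Γ j p r
  -- `g`, `G i` and hence `g (G i) g` are symmetric matrices, so exchanging the two outer vectors
  -- preserves `B`; this exchange swaps `(j, r)` with `(m, s)`.
  let B : Fin n → Fin n → Fin n → Fin n → Fin n → R := fun j i m r s =>
    v j r ⬝ᵥ ((L.g * G i * L.g) *ᵥ v m s)
  have hg : L.gᵀ = L.g := Matrix.ext fun i j => L.g_symm j i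
  have hG : ∀ i, (G i)ᵀ = G i := fun i => Matrix.ext fun p q => L.Γ_symm i q p
  have hB : ∀ j i m r s, B j i m r s = B m i j s r := by
    intro j i m r s
    simp only [B]
    have ht : (L.g * G i * L.g)ᵀ = L.g * G i * L.g := by
      rw [Matrix.transpose_mul, Matrix.transpose_mul, hg, hG, Matrix.mul_assoc]
    rw [dotProduct_comm, ← Matrix.vecMul_transpose, ht, ← Matrix.dotProduct_mulVec]
  have hc : ∀ i j l r, L.curlβ i j l r
      = (v j r ᵥ* (L.g * G i)) l - (v i r ᵥ* (L.g * G j)) l := by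
    intro i j l r
    have h1 : ∀ i j, (v j r ᵥ* (L.g * G i)) l = -∑ s, L.β s i l * L.Γ j s r := by
      intro i j
      rw [← Finset.sum_neg_distrib]
      change ∑ s, L.Γ j s r * (L.g * G i) s l = _
      refine Finset.sum_congr rfl fun s _ => ?_
      have h2 : L.β s i l = -(L.g * G i) s l := rfl
      rw [h2]
      ring
    have h3 : ∑ s, L.β s i r * L.Γ j s l = ∑ s, L.β s j l * L.Γ i s r := by
      simp only [β, neg_mul, Finset.sum_neg_distrib, Finset.sum_mul]
      rw [Finset.sum_comm]
      refine congrArg _ (Finset.sum_congr rfl fun s _ => Finset.sum_congr rfl fun t _ => ?_)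
      rw [L.g_symm t s]
      ring
    rw [h1, h1, L.curlβ_eq, hL, sub_zero, Finset.sum_sub_distrib, h3]
    ring
  have hS : ∀ i j m r s, ∑ l, L.curlβ i j l r * L.β l m s = B i j m r s - B j i m r s := by
    intro i j m r s
    have h1 : ∀ l, L.β l m s = -(L.g *ᵥ v m s) l := fun l => rfl
    have h2 : ∀ i j, ∑ l, (v j r ᵥ* (L.g * G i)) l * (L.g *ᵥ v m s) l = B j i m r s := by
      intro i j
      change (v j r ᵥ* (L.g * G i)) ⬝ᵥ (L.g *ᵥ v m s) = _
      rw [← Matrix.dotProduct_mulVec, Matrix.mulVec_mulVec]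
    simp only [hc, h1, sub_mul, mul_neg, Finset.sum_sub_distrib, Finset.sum_neg_distrib, h2]
    ring
  have hQ : ∀ r s, (CoeffJet.of d L.g L.β w).quadratic i j m r s
      = (B i j m r s - B j i m r s) + (B j m i r s - B m j i r s)
        + (B m i j r s - B i m j r s) := by
    intro r s
    rw [← hS, ← hS, ← hS, ← Finset.sum_add_distrib, ← Finset.sum_add_distrib]
    rfl
  rw [hQ, hQ, hB i j m r s, hB j i m r s, hB j m i r s, hB m j i r s, hB m i j r s, hB i m j r s]
  ring

/-- `∇ₗ wʲᵐ`. -/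
def covDeriv (w : Fin n → Fin n → R) (l j m : Fin n) : R :=
  d l (w j m) + ∑ s, (L.Γ j l s * w s m + L.Γ m l s * w j s)

/-- `∇ᵣ ∇ₗ wʲᵐ`. -/
def covDeriv₂ (w : Fin n → Fin n → R) (r l j m : Fin n) : R :=
  d r (L.covDeriv w l j m) + ∑ t, (L.Γ j r t * L.covDeriv w l t m + L.Γ m r t * L.covDeriv w l j t
    - L.Γ t l r * L.covDeriv w t j m)

/-- The Ricci identity; the term in `Γᵗ_{lr}` drops out of the commutator because the connection has
no torsion. -/
theorem covDeriv₂_sub (w : Fin n → Fin n → R)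
    (hw : ∀ j m r l, d r (d l (w j m)) = d l (d r (w j m)))
    (r l j m : Fin n) : L.covDeriv₂ w r l j m - L.covDeriv₂ w l r j m
      = ∑ s, (L.curvature j s r l * w s m + L.curvature m s r l * w j s) := by
  have h1 : ∀ r l, d r (L.covDeriv w l j m) = d r (d l (w j m))
      + ∑ s, (d r (L.Γ j l s) * w s m + L.Γ j l s * d r (w s m) + d r (L.Γ m l s) * w j s
        + L.Γ m l s * d r (w j s)) := by
    intro r l
    simp only [covDeriv, map_add, map_sum, Derivation.leibniz, smul_eq_mul]
    exact congrArg _ (Finset.sum_congr rfl fun s _ => by ring)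
  have h2 : ∀ r l, ∑ t, (L.Γ j r t * L.covDeriv w l t m + L.Γ m r t * L.covDeriv w l j t
        - L.Γ t l r * L.covDeriv w t j m)
      = ∑ t, (L.Γ j r t * d l (w t m) + L.Γ m r t * d l (w j t) - L.Γ t l r * L.covDeriv w t j m)
        + ∑ s, ∑ t, (L.Γ j r t * L.Γ t l s * w s m + L.Γ j r t * L.Γ m l s * w t s
          + (L.Γ m r t * L.Γ j l s * w s t + L.Γ m r t * L.Γ t l s * w j s)) := by
    intro r l
    rw [Finset.sum_comm, ← Finset.sum_add_distrib]
    refine Finset.sum_congr rfl fun t _ => ?_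
    have h3 : L.covDeriv w l t m
        = d l (w t m) + ∑ s, (L.Γ t l s * w s m + L.Γ m l s * w t s) := rfl
    have h4 : L.covDeriv w l j t
        = d l (w j t) + ∑ s, (L.Γ j l s * w s t + L.Γ t l s * w j s) := rfl
    rw [h3, h4]
    simp only [mul_add, Finset.mul_sum, Finset.sum_add_distrib, mul_assoc]
    ring
  -- The cross terms, where the two Christoffel symbols act on different indices of `w`, are
  -- interchanged with `r` and `l` and cancel in the commutator.
  have h3 : ∀ r l, ∑ s, ∑ t, (L.Γ j r t * L.Γ m l s * w t s)
      = ∑ s, ∑ t, L.Γ m l t * L.Γ j r s * w s t := by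
    intro r l
    rw [Finset.sum_comm]
    exact Finset.sum_congr rfl fun s _ => Finset.sum_congr rfl fun t _ => by ring
  simp only [covDeriv₂, h1, h2]
  rw [hw j m r l]
  simp only [Finset.sum_add_distrib, Finset.sum_sub_distrib, curvature, add_mul, sub_mul,
    Finset.sum_mul, h3, L.Γ_symm _ l r]
  ring

theorem killing_eq (w : Fin n → Fin n → R) (hw : ∀ i j, w i j = -w j i) (i j m : Fin n) :
    (CoeffJet.of d L.g L.β w).killing i j m = ∑ l, L.g i l * L.covDeriv w l j m := by
  have h1 : ∀ l, L.g i l * L.covDeriv w l j m = L.g l i * d l (w j m)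
      + ∑ s, (L.g i l * L.Γ j l s * w s m - L.g i l * L.Γ m l s * w s j) := by
    intro l
    rw [covDeriv, mul_add, L.g_symm l i, Finset.mul_sum]
    refine congrArg _ (Finset.sum_congr rfl fun s _ => ?_)
    rw [hw j s]
    ring
  simp only [h1, CoeffJet.killing, CoeffJet.of, Finset.sum_add_distrib, Finset.sum_sub_distrib]
  rw [Finset.sum_comm (f := fun l s => L.g i l * L.Γ j l s * w s m),
    Finset.sum_comm (f := fun l s => L.g i l * L.Γ m l s * w s j)]
  have h2 : ∀ j m l, L.β i j l * w l m = -∑ x, L.g i x * L.Γ j x l * w l m := by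
    intro j m l
    rw [β, neg_mul, Finset.sum_mul]
  simp only [h2, Finset.sum_neg_distrib]
  ring

/-- This is `∇ᵣ ∇ⁱ wʲᵐ = 0`. Flatness makes `∇ᵖ ∇ⁱ wʲᵐ` symmetric in `p`, `i`, while the
Killing–Yano equation makes it skew in `i`, `j`; both symmetries together force it to vanish. -/
theorem flat_covDeriv_killing (hL : ∀ i j k l, L.contraCurvature i j k l = 0)
    (w : Fin n → Fin n → R) (hw : ∀ i j, w i j = -w j i)
    (hd : ∀ j m r l, d r (d l (w j m)) = d l (d r (w j m)))
    (hk : ∀ i j m, (CoeffJet.of d L.g L.β w).killing i j m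
      = (CoeffJet.of d L.g L.β w).killing j m i) (r i j m : Fin n) :
    d r ((CoeffJet.of d L.g L.β w).killing i j m)
      + ∑ t, (L.Γ i r t * (CoeffJet.of d L.g L.β w).killing t j m
        + L.Γ j r t * (CoeffJet.of d L.g L.β w).killing i t m
        + L.Γ m r t * (CoeffJet.of d L.g L.β w).killing i j t) = 0 := by
  set Φ := (CoeffJet.of d L.g L.β w).killing with hΦ
  have hΦK : ∀ i j m, Φ i j m = ∑ l, L.g i l * L.covDeriv w l j m := L.killing_eq w hw
  have hKa : ∀ l j m, L.covDeriv w l j m = -L.covDeriv w l m j := by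
    intro l j m
    have h1 : d l (w j m) = -d l (w m j) := by rw [hw j m, map_neg]
    rw [covDeriv, covDeriv, h1, neg_add, ← Finset.sum_neg_distrib]
    refine congrArg _ (Finset.sum_congr rfl fun s _ => ?_)
    rw [hw s m, hw j s]
    ring
  have hΦa : ∀ i j m, Φ i j m = -Φ i m j := by
    intro i j m
    rw [hΦK, hΦK, ← Finset.sum_neg_distrib]
    refine Finset.sum_congr rfl fun l _ => ?_
    rw [hKa l j m]
    ring
  -- `∇ᵣ Φⁱʲᵐ`, which inherits from `Φ` the skewness in `j`, `m` and the cyclic invariance.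
  let N : Fin n → Fin n → Fin n → Fin n → R := fun r i j m => d r (Φ i j m)
    + ∑ t, (L.Γ i r t * Φ t j m + L.Γ j r t * Φ i t m + L.Γ m r t * Φ i j t)
  have hNa : ∀ r i j m, N r i j m = -N r i m j := by
    intro r i j m
    simp only [N]
    rw [hΦa i j m, map_neg, neg_add, ← Finset.sum_neg_distrib]
    refine congrArg _ (Finset.sum_congr rfl fun t _ => ?_)
    rw [hΦa t j m, hΦa i t m, hΦa i j t]
    ring
  have hNc : ∀ r i j m, N r i j m = N r j m i := by
    intro r i j m
    simp only [N]
    rw [hk i j m]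
    refine congrArg _ (Finset.sum_congr rfl fun t _ => ?_)
    rw [hk t j m, hk i t m, hk i j t]
    ring
  have hN : ∀ r i j m, N r i j m = ∑ l, L.g i l * L.covDeriv₂ w r l j m := by
    intro r i j m
    have h1 : d r (Φ i j m) = ∑ l, ((L.β i l r + L.β l i r) * L.covDeriv w l j m
        + L.g i l * d r (L.covDeriv w l j m)) := by
      rw [hΦK, map_sum]
      refine Finset.sum_congr rfl fun l _ => ?_
      rw [Derivation.leibniz, L.d_g, smul_eq_mul, smul_eq_mul]
      ring
    have h2 : ∑ l, L.β l i r * L.covDeriv w l j m = -∑ t, L.Γ i r t * Φ t j m := by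
      simp only [hΦK, β, neg_mul, Finset.sum_neg_distrib, Finset.sum_mul, Finset.mul_sum]
      rw [Finset.sum_comm]
      refine congrArg _ (Finset.sum_congr rfl fun t _ => Finset.sum_congr rfl fun l _ => ?_)
      rw [L.g_symm l t, L.Γ_symm i t r]
      ring
    have h3 : ∑ l, L.β i l r * L.covDeriv w l j m
        = -∑ l, L.g i l * ∑ t, L.Γ t l r * L.covDeriv w t j m := by
      simp only [β, neg_mul, Finset.sum_neg_distrib, Finset.sum_mul, Finset.mul_sum]
      rw [Finset.sum_comm]
      exact congrArg _ (Finset.sum_congr rfl fun t _ => Finset.sum_congr rfl fun l _ => by ring)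
    have h4 : ∀ j, ∑ t, L.Γ j r t * Φ i t m
        = ∑ l, L.g i l * ∑ t, L.Γ j r t * L.covDeriv w l t m := by
      intro j
      simp only [hΦK, Finset.mul_sum]
      rw [Finset.sum_comm]
      exact Finset.sum_congr rfl fun t _ => Finset.sum_congr rfl fun l _ => by ring
    have h5 : ∀ m, ∑ t, L.Γ m r t * Φ i j t
        = ∑ l, L.g i l * ∑ t, L.Γ m r t * L.covDeriv w l j t := by
      intro m
      simp only [hΦK, Finset.mul_sum]
      rw [Finset.sum_comm]
      exact Finset.sum_congr rfl fun t _ => Finset.sum_congr rfl fun l _ => by ring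
    simp only [N, h1, covDeriv₂, add_mul, mul_add, mul_sub, Finset.sum_add_distrib,
      Finset.sum_sub_distrib, h2, h3, h4, h5]
    ring
  have hC : ∀ r l j m, L.covDeriv₂ w r l j m = L.covDeriv₂ w l r j m := by
    intro r l j m
    rw [← sub_eq_zero, L.covDeriv₂_sub w hd]
    simp [L.curvature_eq_zero hL]
  let Ψ : Fin n → Fin n → Fin n → Fin n → R := fun p i j m => ∑ r, L.g p r * N r i j m
  have hΨs : ∀ p i j m, Ψ p i j m = Ψ i p j m := by
    intro p i j m
    simp only [Ψ, hN, Finset.mul_sum]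
    rw [Finset.sum_comm]
    refine Finset.sum_congr rfl fun t _ => Finset.sum_congr rfl fun l _ => ?_
    rw [hC l t]
    ring
  have hΨa : ∀ p i j m, Ψ p i j m = -Ψ p j i m := by
    intro p i j m
    simp only [Ψ]
    rw [← Finset.sum_neg_distrib]
    refine Finset.sum_congr rfl fun t _ => ?_
    rw [hNc t i j m, hNa t j m i]
    ring
  have hΨ : ∀ p i j m, Ψ p i j m = 0 := by
    intro p i j m
    apply eq_zero_of_two_mul
    linear_combination hΨs p i j m + hΨa i p j m - hΨs i j p m - hΨa j i p m + hΨs j p i m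
      + hΨa p j i m
  exact L.eq_zero_of_g_mul (x := fun r => N r i j m) (fun p => hΨ p i j m) r

/-- `∇∇w = 0` expresses `∂ᵣ K` through products `Γ K`. Cyclic invariance moves the contracted index
of `K` to the first place, and for a flat metric each product expands into terms of the mixed
expression. -/
theorem flat_mixed (hL : ∀ i j k l, L.contraCurvature i j k l = 0)
    (w : Fin n → Fin n → R) (hw : ∀ i j, w i j = -w j i)
    (hd : ∀ j m r l, d r (d l (w j m)) = d l (d r (w j m)))
    (hk : ∀ i j m, (CoeffJet.of d L.g L.β w).killing i j m
      = (CoeffJet.of d L.g L.β w).killing j m i) (i j m r : Fin n) :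
    (CoeffJet.of d L.g L.β w).dkilling i j m r = (CoeffJet.of d L.g L.β w).mixed i j m r := by
  have h0 := L.flat_covDeriv_killing hL w hw hd hk r i j m
  have hdk : d r ((CoeffJet.of d L.g L.β w).killing i j m)
      = (CoeffJet.of d L.g L.β w).dkilling i j m r := CoeffJet.d_killing d L.g L.β w i j m r
  rw [hdk] at h0
  rw [eq_neg_of_add_eq_zero_left h0]
  set Φ := (CoeffJet.of d L.g L.β w).killing with hΦ
  let H : Fin n → Fin n → Fin n → R := fun i j l => ∑ t, L.Γ i r t * L.β t j l
  have hE : ∀ i j m, ∑ t, L.Γ i r t * Φ t j m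
      = -∑ l, (d l (w j m) * L.β l i r + (H i j l * w l m - H i m l * w l j)) := by
    intro i j m
    have h1 : ∀ t, Φ t j m = ∑ l, (L.g l t * d l (w j m) - L.β t j l * w l m
        + L.β t m l * w l j) := fun t => rfl
    simp only [h1, Finset.mul_sum]
    rw [Finset.sum_comm, ← Finset.sum_neg_distrib]
    refine Finset.sum_congr rfl fun l _ => ?_
    have h2 : L.β l i r = -∑ s, L.g l s * L.Γ i s r := rfl
    simp only [H, h2, mul_add, mul_sub, Finset.sum_add_distrib, Finset.sum_sub_distrib,
      Finset.sum_mul, mul_neg, Finset.mul_sum, neg_add, neg_sub, neg_neg]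
    have h3 : ∀ t, L.Γ i r t * (L.g l t * d l (w j m)) = d l (w j m) * (L.g l t * L.Γ i t r) := by
      intro t
      rw [L.Γ_symm i r t]
      ring
    simp only [h3, mul_assoc]
    ring
  have hc : ∀ i j l, L.curlβ i j l r = H i j l - H j i l := by
    intro i j l
    have h1 : ∀ i j l, ∑ s, L.β s i l * L.Γ j s r = H j i l := fun i j l =>
      Finset.sum_congr rfl fun s _ => by rw [L.Γ_symm j s r, mul_comm]
    have h2 : ∑ s, L.β s i r * L.Γ j s l = H i j l := by
      rw [← h1]
      simp only [β, neg_mul, Finset.sum_neg_distrib, Finset.sum_mul]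
      rw [Finset.sum_comm]
      refine congrArg _ (Finset.sum_congr rfl fun s _ => Finset.sum_congr rfl fun t _ => ?_)
      rw [L.g_symm t s]
      ring
    rw [L.curlβ_eq, hL, sub_zero, Finset.sum_sub_distrib, h1, h2]
  have hm : (CoeffJet.of d L.g L.β w).mixed i j m r
      = ∑ l, (L.curlβ i j l r * w l m + d l (w i j) * L.β l m r
        + (L.curlβ j m l r * w l i + d l (w j m) * L.β l i r)
        + (L.curlβ m i l r * w l j + d l (w m i) * L.β l j r)) := rfl
  have h1 : ∀ t, Φ i t m = Φ t m i := fun t => hk i t m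
  have h2 : ∀ t, Φ i j t = Φ t i j := fun t => (hk t i j).symm
  rw [hm]
  simp only [h1, h2, Finset.sum_add_distrib, hE, hc, sub_mul, Finset.sum_sub_distrib]
  ring

end LeviCivita

end Flat

/-! ### From coefficient identities to identities in the ring, and back to points -/

namespace VarCalc.OpData

variable {n : ℕ} {R : Type*} [CommRing R] [Algebra ℝ R] {C : VarCalc n R} (A : C.OpData)

/-- The jet of the coefficients of an operator. -/
def toJet : CoeffJet n R := CoeffJet.of (C.P 0) A.g A.b A.w

theorem curvatureTerm_eq (i j m : Fin n) :
    A.curvatureTerm i j m = ∑ r, A.toJet.curvature i j m r * A.ux r := by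
  have h : ∀ l, A.b i m l * A.bu l j - A.b i j l * A.bu l m + A.curlu j m l * A.g l i
      = ∑ r, (A.b i m l * A.b l j r - A.b i j l * A.b l m r + A.curl j m l r * A.g l i)
        * A.ux r := by
    intro l
    simp only [bu, curlu, Finset.mul_sum, Finset.sum_mul, ← Finset.sum_sub_distrib,
      ← Finset.sum_add_distrib]
    exact Finset.sum_congr rfl fun r _ => by ring
  simp only [curvatureTerm, h]
  rw [Finset.sum_comm]
  simp only [← Finset.sum_mul]
  rfl

theorem mixedTerm_eq (i j m : Fin n) :
    A.mixedTerm i j m = ∑ r, A.toJet.mixed i j m r * A.ux r := by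
  have h : ∀ l, A.curlu i j l * A.w l m + C.P 0 l (A.w i j) * A.bu l m
      + (A.curlu j m l * A.w l i + C.P 0 l (A.w j m) * A.bu l i)
      + (A.curlu m i l * A.w l j + C.P 0 l (A.w m i) * A.bu l j)
      = ∑ r, (A.curl i j l r * A.w l m + C.P 0 l (A.w i j) * A.b l m r
        + (A.curl j m l r * A.w l i + C.P 0 l (A.w j m) * A.b l i r)
        + (A.curl m i l r * A.w l j + C.P 0 l (A.w m i) * A.b l j r)) * A.ux r := by
    intro l
    simp only [bu, curlu, Finset.mul_sum, Finset.sum_mul, ← Finset.sum_add_distrib]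
    exact Finset.sum_congr rfl fun r _ => by ring
  simp only [mixedTerm, h]
  rw [Finset.sum_comm]
  simp only [← Finset.sum_mul]
  rfl

theorem quadraticTerm_eq (i j m : Fin n) : A.quadraticTerm i j m
    = ∑ r, ∑ s, A.toJet.quadratic i j m r s * (A.ux r * A.ux s) := by
  have h : ∀ l, A.curlu i j l * A.bu l m + A.curlu j m l * A.bu l i + A.curlu m i l * A.bu l j
      = ∑ r, ∑ s, (A.curl i j l r * A.b l m s + A.curl j m l r * A.b l i s
        + A.curl m i l r * A.b l j s) * (A.ux r * A.ux s) := by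
    intro l
    simp only [bu, curlu, Finset.sum_mul_sum, ← Finset.sum_add_distrib]
    exact Finset.sum_congr rfl fun r _ => Finset.sum_congr rfl fun s _ => by ring
  simp only [quadraticTerm, h]
  rw [← sum_rotate]
  simp only [← Finset.sum_mul]
  rfl

variable {A}

theorem isSkew_of_toJet (h : A.toJet.IsSkew) : A.IsSkew := ⟨h.1, h.2, h.3⟩

theorem isJacobi_of_toJet (h : A.toJet.IsJacobi) : A.IsJacobi where
  torsion := h.torsion
  curvature i j m := by
    rw [curvatureTerm_eq]
    exact Finset.sum_eq_zero fun r _ => by rw [h.curvature, zero_mul]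
  killing := h.killing
  mixed i j m := by
    rw [mixedTerm_eq, (A.killingTerm_coeff i j m).2]
    refine Finset.sum_congr rfl fun r _ => ?_
    rw [← h.mixed]
    exact congrArg (· * A.ux r) (CoeffJet.d_killing (C.P 0) A.g A.b A.w i j m r)
  quadratic i j m := by
    apply eq_zero_of_two_mul
    -- Only the symmetrised identity is available, so the sum is doubled and one copy has `r` and
    -- `s` interchanged.
    rw [two_mul, quadraticTerm_eq]
    nth_rewrite 2 [Finset.sum_comm]
    simp only [← Finset.sum_add_distrib]
    refine Finset.sum_eq_zero fun r _ => Finset.sum_eq_zero fun s _ => ?_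
    linear_combination h.quadratic i j m r s * (A.ux r * A.ux s)
  poisson := h.poisson

end VarCalc.OpData

namespace CoeffJet

variable {n : ℕ} {S T : Type*} [CommRing S] [CommRing T]

/-- Change of coefficients. -/
def map (φ : S →+* T) (J : CoeffJet n S) : CoeffJet n T where
  g i j := φ (J.g i j)
  dg i j l := φ (J.dg i j l)
  b i j k := φ (J.b i j k)
  db i j k l := φ (J.db i j k l)
  w i j := φ (J.w i j)
  dw i j l := φ (J.dw i j l)
  ddw i j l r := φ (J.ddw i j l r)

variable (φ : S →+* T) (J : CoeffJet n S)

theorem map_curvature (i j m r : Fin n) :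
    φ (J.curvature i j m r) = (J.map φ).curvature i j m r := by
  simp [curvature, map, curl]

theorem map_killing (i j m : Fin n) : φ (J.killing i j m) = (J.map φ).killing i j m := by
  simp [killing, map]

theorem map_dkilling (i j m r : Fin n) : φ (J.dkilling i j m r) = (J.map φ).dkilling i j m r := by
  simp [dkilling, map]

theorem map_mixed (i j m r : Fin n) : φ (J.mixed i j m r) = (J.map φ).mixed i j m r := by
  simp [mixed, map, curl]

theorem map_quadratic (i j m r s : Fin n) :
    φ (J.quadratic i j m r s) = (J.map φ).quadratic i j m r s := by
  simp [quadratic, map, curl]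

variable {φ J}

theorem IsPreJacobi.map (h : J.IsPreJacobi) : (J.map φ).IsPreJacobi where
  torsion i j m := by simpa [CoeffJet.map] using congrArg φ (h.torsion i j m)
  curvature i j m r := by rw [← map_curvature, h.curvature, map_zero]
  killing i j m := by rw [← map_killing, ← map_killing, h.killing]
  poisson i j m := by simpa [CoeffJet.map] using congrArg φ (h.poisson i j m)

theorem IsJacobi.map (h : J.IsJacobi) : (J.map φ).IsJacobi where
  toIsPreJacobi := h.toIsPreJacobi.map
  mixed i j m r := by rw [← map_dkilling, ← map_mixed, h.mixed]
  quadratic i j m r s := by rw [← map_quadratic, ← map_quadratic, ← map_add, h.quadratic, map_zero]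

variable {ι : Type*} {φ : ι → S →+* T} (hφ : ∀ x y, (∀ p, φ p x = φ p y) → x = y)

include hφ

theorem isSkew_of_map (h : ∀ p, (J.map (φ p)).IsSkew) : J.IsSkew where
  g_symm i j := hφ _ _ fun p => (h p).g_symm i j
  dg_eq i j l := hφ _ _ fun p => by simpa [CoeffJet.map] using (h p).dg_eq i j l
  w_skew i j := hφ _ _ fun p => by simpa [CoeffJet.map] using (h p).w_skew i j

theorem isPreJacobi_of_map (h : ∀ p, (J.map (φ p)).IsPreJacobi) : J.IsPreJacobi where
  torsion i j m := hφ _ _ fun p => by simpa [CoeffJet.map] using (h p).torsion i j m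
  curvature i j m r := hφ _ _ fun p => by rw [map_curvature, (h p).curvature, map_zero]
  killing i j m := hφ _ _ fun p => by rw [map_killing, map_killing, (h p).killing]
  poisson i j m := hφ _ _ fun p => by simpa [CoeffJet.map] using (h p).poisson i j m

theorem isJacobi_of_map (h : ∀ p, (J.map (φ p)).IsJacobi) : J.IsJacobi where
  toIsPreJacobi := isPreJacobi_of_map hφ fun p => (h p).toIsPreJacobi
  mixed i j m r := hφ _ _ fun p => by rw [map_dkilling, map_mixed, (h p).mixed]
  quadratic i j m r s := hφ _ _ fun p => by
    rw [map_add, map_quadratic, map_quadratic, (h p).quadratic, map_zero]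

end CoeffJet

/-! ### Hamiltonian operators in terms of values at points -/

section Evaluation

variable {n : ℕ} {U : Set (Fin n → ℝ)}

/-- Evaluation at a jet. -/
noncomputable def evalJet (p : JetOver U) : diffRing U →+* ℝ :=
  (Pi.evalRingHom (fun _ : JetOver U => ℝ) p).comp (diffRing U).val.toRingHom

theorem evalJet_ext (F G : diffRing U) (h : ∀ p, evalJet p F = evalJet p G) : F = G :=
  diffRing_ext h

/-- The jet `x = 0`, `u = u₀`, all derivatives zero. -/
def constJet {u₀ : Fin n → ℝ} (hu : u₀ ∈ U) : JetOver U :=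
  ⟨(0, fun k => if k = 0 then u₀ else 0), by simpa using hu⟩

theorem contDiffOn_pderiv (hU : IsOpen U) {c : (Fin n → ℝ) → ℝ} (hc : ContDiffOn ℝ ∞ c U)
    (i : Fin n) : ContDiffOn ℝ ∞ (pderiv i c) U :=
  (hc.fderiv_of_isOpen (m := ∞) hU (by simp)).clm_apply contDiffOn_const

theorem diffCalc_P_coeffFun (hU : IsOpen U) {c : (Fin n → ℝ) → ℝ} (hc : ContDiffOn ℝ ∞ c U)
    (i : Fin n) :
    (diffCalc hU).P 0 i (coeffFun c hc) = coeffFun (pderiv i c) (contDiffOn_pderiv hU hc i) :=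
  diffRing_ext fun p => diffCalc_P_coeffFun_zero hU hc i p

namespace HydroOp

/-- The values at `u` of the coefficients and their derivatives. -/
noncomputable def jet (A : HydroOp n) (u : Fin n → ℝ) : CoeffJet n ℝ where
  g := A.g u
  dg i j l := pderiv l (fun v => A.g v i j) u
  b := A.b u
  db i j k l := pderiv l (fun v => A.b v i j k) u
  w := A.w u
  dw i j l := pderiv l (fun v => A.w v i j) u
  ddw i j l r := pderiv r (pderiv l (fun v => A.w v i j)) u

theorem toJet_map_evalJet (A : HydroOp n) (hU : IsOpen U) (hA : A.IsSmoothOn U) (p : JetOver U) :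
    (A.opData hU hA).toJet.map (evalJet p) = A.jet (p.1.2 0) := by
  simp only [VarCalc.OpData.toJet, CoeffJet.of, opData, CoeffJet.map, diffCalc_P_coeffFun]
  rfl

theorem isHamiltonian_of_jet (A : HydroOp n) (hU : IsOpen U) (hA : A.IsSmoothOn U)
    (h1 : ∀ u ∈ U, (A.jet u).IsSkew)
    (h2 : ∀ u ∈ U, (A.jet u).IsJacobi) :
    A.IsHamiltonian U := by
  have h3 : (A.opData hU hA).IsSkew := by
    refine VarCalc.OpData.isSkew_of_toJet (CoeffJet.isSkew_of_map evalJet_ext fun p => ?_)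
    rw [toJet_map_evalJet]
    exact h1 _ p.2
  have h4 : (A.opData hU hA).IsJacobi := by
    refine VarCalc.OpData.isJacobi_of_toJet (CoeffJet.isJacobi_of_map evalJet_ext fun p => ?_)
    rw [toJet_map_evalJet]
    exact h2 _ p.2
  exact (A.isHamiltonian_iff hU hA).2 ⟨h3.bracket_add_bracket_mem_exact, h4.jacobi_mem_exact h3⟩

/-- The mixed and quadratic conditions are not extracted; non-degeneracy supplies them later. -/
theorem IsHamiltonian.jet {A : HydroOp n} (hU : IsOpen U) (hA : A.IsSmoothOn U) (h : A.IsHamiltonian U) :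
    (∀ u ∈ U, (A.jet u).IsSkew) ∧ ∀ u ∈ U, (A.jet u).IsPreJacobi := by
  rw [A.isHamiltonian_iff hU hA] at h
  have hmap : ∀ u (hu : u ∈ U), A.jet u = (A.opData hU hA).toJet.map (A.point hU hA u hu).ε :=
    fun u hu => (A.toJet_map_evalJet hU hA (constJet hu)).symm
  have h1 : ∀ u ∈ U, (A.jet u).IsSkew := by
    intro u hu
    have h3 := VarCalc.OpData.isSkewAt_of_bracket (A.point hU hA u hu) h.1
    rw [hmap u hu]
    exact ⟨h3.1, h3.2, h3.3⟩
  -- The Jacobi test requires skewness in the ring, so the pointwise identities are first collected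
  -- over all of `U`.
  have h3 : (A.opData hU hA).IsSkew := by
    refine VarCalc.OpData.isSkew_of_toJet (CoeffJet.isSkew_of_map evalJet_ext fun p => ?_)
    rw [toJet_map_evalJet]
    exact h1 _ p.2
  refine ⟨h1, fun u hu => ?_⟩
  have h4 := h3.isJacobiAt (A.point hU hA u hu) h.2
  rw [hmap u hu]
  refine ⟨fun i j m => ?_, fun i j m r => ?_, fun i j m => ?_, fun i j m => ?_⟩
  · rw [← h4.torsion i j m, VarCalc.OpData.torsionTerm, map_sum]
    simp only [map_sub, map_mul]
    rfl
  · rw [← CoeffJet.map_curvature, ← h4.curvature i j m r,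
      VarCalc.OpData.partial_one_curvatureTerm]
    rfl
  · rw [← CoeffJet.map_killing, ← CoeffJet.map_killing]
    exact h4.killing i j m
  · rw [← h4.poisson i j m, VarCalc.OpData.poissonTerm, map_sum]
    simp only [map_add, map_mul]
    rfl

end HydroOp

end Evaluation

/-! ### Non-degenerate operators: the geometric meaning of the conditions -/

section SmoothMetric

open scoped Matrix

variable {n : ℕ} {V : Set (Fin n → ℝ)}

theorem contDiffOn_matrix_det {M : (Fin n → ℝ) → Matrix (Fin n) (Fin n) ℝ}
    (hM : ∀ i j, ContDiffOn ℝ ∞ (fun u => M u i j) V) : ContDiffOn ℝ ∞ (fun u => (M u).det) V := by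
  simp only [Matrix.det_apply']
  exact ContDiffOn.sum fun σ _ => contDiffOn_const.mul (contDiffOn_prod fun i _ => hM _ _)

theorem contDiffOn_matrix_inv {M : (Fin n → ℝ) → Matrix (Fin n) (Fin n) ℝ}
    (hM : ∀ i j, ContDiffOn ℝ ∞ (fun u => M u i j) V) (hdet : ∀ u ∈ V, (M u).det ≠ 0)
    (i j : Fin n) : ContDiffOn ℝ ∞ (fun u => (M u)⁻¹ i j) V := by
  simp only [Matrix.inv_def, Ring.inverse_eq_inv', Matrix.smul_apply, smul_eq_mul,
    Matrix.adjugate_apply]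
  refine ((contDiffOn_matrix_det hM).inv hdet).mul (contDiffOn_matrix_det fun k l => ?_)
  simp only [Matrix.updateRow_apply]
  split_ifs
  · exact contDiffOn_const
  · exact hM k l

theorem contDiffOn_christoffel (hV : IsOpen V) {g : (Fin n → ℝ) → Matrix (Fin n) (Fin n) ℝ}
    (hg : ∀ i j, ContDiffOn ℝ ∞ (fun u => g u i j) V) (hdet : ∀ u ∈ V, (g u).det ≠ 0)
    (i j k : Fin n) : ContDiffOn ℝ ∞ (christoffel g i j k) V := by
  have h := fun a b c => contDiffOn_pderiv hV (contDiffOn_matrix_inv hg hdet a b) c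
  exact contDiffOn_const.mul (ContDiffOn.sum fun l _ =>
    (hg i l).mul (((h _ _ _).add (h _ _ _)).sub (h _ _ _)))

/-- The Levi-Civita connection of a smooth contravariant metric. -/
noncomputable def metricLeviCivita (hV : IsOpen V) {g : (Fin n → ℝ) → Matrix (Fin n) (Fin n) ℝ}
    (hg : ∀ i j, ContDiffOn ℝ ∞ (fun u => g u i j) V) (hdet : ∀ u ∈ V, (g u).det ≠ 0)
    (hsymm : ∀ u ∈ V, ∀ i j, g u i j = g u j i) : LeviCivita ((diffCalc hV).P 0) where
  g := Matrix.of fun i j => coeffFun (fun u => g u i j) (hg i j)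
  h := Matrix.of fun i j => coeffFun (fun u => (g u)⁻¹ i j) (contDiffOn_matrix_inv hg hdet i j)
  Γ i j k := coeffFun (christoffel g i j k) (contDiffOn_christoffel hV hg hdet i j k)
  g_symm i j := diffRing_ext fun p => hsymm _ p.2 i j
  h_symm i j := diffRing_ext fun p => by
    have h : (g (p.1.2 0))ᵀ = g (p.1.2 0) := Matrix.ext fun i j => hsymm _ p.2 j i
    have h2 := congrFun (congrFun (Matrix.transpose_nonsing_inv (g (p.1.2 0))) j) i
    rw [h] at h2
    exact h2
  g_mul_h := by
    ext i j : 1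
    refine evalJet_ext _ _ fun p => ?_
    have h : g (p.1.2 0) * (g (p.1.2 0))⁻¹ = 1 :=
      Matrix.mul_nonsing_inv _ (isUnit_iff_ne_zero.2 (hdet _ p.2))
    have h2 := congrFun (congrFun h i) j
    rw [Matrix.mul_apply, map_sum]
    simp only [map_mul]
    refine Eq.trans h2 ?_
    rw [Matrix.one_apply, Matrix.one_apply]
    split_ifs <;> simp
  two_Γ i j k := by
    refine evalJet_ext _ _ fun p => ?_
    simp only [Matrix.of_apply, diffCalc_P_coeffFun, map_mul, map_ofNat, map_sum, map_add, map_sub]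
    change 2 * christoffel g i j k (p.1.2 0) = _
    rw [christoffel, ← mul_assoc, mul_one_div_cancel two_ne_zero, one_mul]
    rfl

section

variable (hV : IsOpen V) {g : (Fin n → ℝ) → Matrix (Fin n) (Fin n) ℝ}
  (hg : ∀ i j, ContDiffOn ℝ ∞ (fun u => g u i j) V) (hdet : ∀ u ∈ V, (g u).det ≠ 0)
  (hsymm : ∀ u ∈ V, ∀ i j, g u i j = g u j i)

theorem evalJet_β (i j k : Fin n) (p : JetOver V) :
    evalJet p ((metricLeviCivita hV hg hdet hsymm).β i j k)
      = contraChristoffel g i j k (p.1.2 0) := by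
  rw [LeviCivita.β, map_neg, map_sum]
  simp only [map_mul]
  rfl

theorem evalJet_contraCurvature (i j k l : Fin n) (p : JetOver V) :
    evalJet p ((metricLeviCivita hV hg hdet hsymm).contraCurvature i j k l)
      = contraRiemann g i j k l (p.1.2 0) := by
  simp only [LeviCivita.contraCurvature, LeviCivita.curvature, metricLeviCivita,
    diffCalc_P_coeffFun, map_mul, map_sum, map_add, map_sub]
  rfl

end

namespace HydroOp

variable (A : HydroOp n) (hV : IsOpen V) (hA : A.IsSmoothOn V)

theorem toJet_isSkew (h : ∀ u ∈ V, (A.jet u).IsSkew) : (A.opData hV hA).toJet.IsSkew :=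
  CoeffJet.isSkew_of_map evalJet_ext fun p => by
    rw [toJet_map_evalJet]
    exact h _ p.2

theorem toJet_isPreJacobi (h : ∀ u ∈ V, (A.jet u).IsPreJacobi) :
    (A.opData hV hA).toJet.IsPreJacobi :=
  CoeffJet.isPreJacobi_of_map evalJet_ext fun p => by
    rw [toJet_map_evalJet]
    exact h _ p.2

include hV hA

theorem contraCovDeriv_eq_killing (hdet : A.IsNondegenerate V)
    (hsymm : ∀ u ∈ V, ∀ i j, A.g u i j = A.g u j i) (hw : ∀ u ∈ V, ∀ i j, A.w u i j = -A.w u j i)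
    (hb : ∀ u ∈ V, ∀ i j k, A.b u i j k = contraChristoffel A.g i j k u) {u : Fin n → ℝ}
    (hu : u ∈ V) (i j k : Fin n) :
    contraCovDeriv A.g A.w i j k u = (A.jet u).killing i j k := by
  let L := metricLeviCivita hV hA.g hdet hsymm
  have hβ : (A.opData hV hA).b = L.β := by
    funext i j k
    refine evalJet_ext _ _ fun p => ?_
    exact (hb _ p.2 i j k).trans (evalJet_β hV _ _ _ i j k p).symm
  have h1 := L.killing_eq (A.opData hV hA).w (fun i j => diffRing_ext fun p => hw _ p.2 i j) i j k
  rw [← hβ] at h1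
  have h2 := congrArg (evalJet (constJet hu)) h1
  have h3 : evalJet (constJet hu) ((A.opData hV hA).toJet.killing i j k)
      = (A.jet u).killing i j k := by
    rw [CoeffJet.map_killing, toJet_map_evalJet]
    rfl
  refine Eq.trans ?_ (h2.symm.trans h3)
  simp only [LeviCivita.covDeriv, opData, diffCalc_P_coeffFun, map_sum, map_mul, map_add]
  rfl

/-- Skew and torsion identities determine `b` by uniqueness of the Levi-Civita connection; the
curvature identity then gives `g R = 0`, and `g` is invertible. -/
theorem metric_of_isPreJacobi (hdet : A.IsNondegenerate V) (h1 : ∀ u ∈ V, (A.jet u).IsSkew)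
    (h2 : ∀ u ∈ V, (A.jet u).IsPreJacobi) {u : Fin n → ℝ} (hu : u ∈ V) :
    (∀ i j k, A.b u i j k = contraChristoffel A.g i j k u)
      ∧ ∀ i j k l, contraRiemann A.g i j k l u = 0 := by
  let L := metricLeviCivita hV hA.g hdet fun u hu => (h1 u hu).g_symm
  have h3 := A.toJet_isSkew hV hA h1
  have h4 := A.toJet_isPreJacobi hV hA h2
  have hβ : (A.opData hV hA).b = L.β := by
    funext i j k
    refine L.eq_β (fun l i j => h3.dg_eq i j l) (fun i j m => ?_) i j k
    rw [← sub_eq_zero, ← Finset.sum_sub_distrib]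
    exact h4.torsion i j m
  refine ⟨fun i j k => ?_, fun i j k l => ?_⟩
  · have h5 := congrArg (evalJet (constJet hu)) (congrFun (congrFun (congrFun hβ i) j) k)
    exact h5.trans (evalJet_β hV _ _ _ i j k _)
  · have h5 : ∀ i j m r, (CoeffJet.of ((diffCalc hV).P 0) L.g L.β
        (A.opData hV hA).w).curvature i j m r = 0 := by
      rw [← hβ]
      exact h4.curvature
    have h6 := congrArg (evalJet (constJet hu)) (L.contraCurvature_eq_zero _ h5 i j k l)
    exact (evalJet_contraCurvature hV _ _ _ i j k l _).symm.trans (h6.trans (map_zero _))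

/-- Flatness and the Killing–Yano equation also yield the mixed and quadratic conditions. These are
needed later for the members of the pencil that degenerate. -/
theorem isJacobi_of_metric (hdet : A.IsNondegenerate V)
    (hsymm : ∀ u ∈ V, ∀ i j, A.g u i j = A.g u j i)
    (hb : ∀ u ∈ V, ∀ i j k, A.b u i j k = contraChristoffel A.g i j k u)
    (hR : ∀ u ∈ V, ∀ i j k l, contraRiemann A.g i j k l u = 0)
    (hK : IsKillingYanoOn V A.g A.w) (hP : IsPoissonOn V A.w) {u : Fin n → ℝ} (hu : u ∈ V) :
    (A.jet u).IsJacobi := by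
  let L := metricLeviCivita hV hA.g hdet hsymm
  have hβ : (A.opData hV hA).b = L.β := by
    funext i j k
    refine evalJet_ext _ _ fun p => ?_
    exact (hb _ p.2 i j k).trans (evalJet_β hV _ _ _ i j k p).symm
  have hflat : ∀ i j k l, L.contraCurvature i j k l = 0 := by
    intro i j k l
    refine evalJet_ext _ _ fun p => ?_
    exact (evalJet_contraCurvature hV _ _ _ i j k l p).trans
      ((hR _ p.2 i j k l).trans (map_zero _).symm)
  have hw : ∀ i j, (A.opData hV hA).w i j = -(A.opData hV hA).w j i :=
    fun i j => diffRing_ext fun p => hP.skew _ p.2 i j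
  have hkill : ∀ i j m, (A.opData hV hA).toJet.killing i j m
      = (A.opData hV hA).toJet.killing j m i := by
    intro i j m
    refine evalJet_ext _ _ fun p => ?_
    rw [CoeffJet.map_killing, CoeffJet.map_killing, toJet_map_evalJet]
    have h1 := fun i j k => A.contraCovDeriv_eq_killing hV hA hdet hsymm hP.skew hb p.2 i j k
    have h2 := hK.killing _ p.2 i j m
    -- `∇ʲ ωⁱᵐ` is skew in the last two indices, which turns the Killing–Yano equation into cyclic
    -- invariance.
    have h3 : (A.jet (p.1.2 0)).killing j i m = -(A.jet (p.1.2 0)).killing j m i := by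
      have hdw : ∀ i j l, (A.jet (p.1.2 0)).dw i j l = -(A.jet (p.1.2 0)).dw j i l := by
        intro i j l
        have h4 := congrArg (fun F => evalJet p ((diffCalc hV).P 0 l F)) (hw i j)
        simp only [map_neg] at h4
        rw [opData, diffCalc_P_coeffFun, diffCalc_P_coeffFun] at h4
        exact h4
      rw [CoeffJet.killing, CoeffJet.killing, ← Finset.sum_neg_distrib]
      refine Finset.sum_congr rfl fun l _ => ?_
      rw [hdw i m l]
      ring
    rw [h1, h1, h3] at h2
    linarith
  have hd : ∀ j m r l, (diffCalc hV).P 0 r ((diffCalc hV).P 0 l ((A.opData hV hA).w j m))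
      = (diffCalc hV).P 0 l ((diffCalc hV).P 0 r ((A.opData hV hA).w j m)) :=
    fun j m r l => (diffCalc hV).comm _ _ _ _ _
  have hJ : (A.opData hV hA).toJet
      = CoeffJet.of ((diffCalc hV).P 0) L.g L.β (A.opData hV hA).w := by
    rw [← hβ]
    rfl
  have h0 : (A.opData hV hA).toJet.IsJacobi :=
    { torsion := fun i j m => by
        rw [hJ, Finset.sum_sub_distrib, sub_eq_zero]
        exact L.torsion i j m
      curvature := fun i j m r => by
        rw [hJ]
        refine (L.curvature_eq i j m r).trans ?_
        simp [hflat]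
      killing := hkill
      poisson := fun i j m => by
        refine evalJet_ext _ _ fun p => ?_
        have h1 := hP.jacobi _ p.2 i j m
        have h2 := hP.skew _ p.2
        simp only [VarCalc.OpData.toJet, CoeffJet.of, opData, diffCalc_P_coeffFun, map_sum,
          map_add, map_mul, map_zero]
        -- The two forms of the Poisson condition contract `∂ω` with different indices of `ω`;
        -- skewness relates them by an overall sign.
        rw [← neg_eq_zero, ← Finset.sum_neg_distrib] at h1
        rw [← h1]
        refine Finset.sum_congr rfl fun l _ => ?_
        rw [h2 i l, h2 j l, h2 m l]
        change pderiv l (fun v => A.w v i j) (p.1.2 0) * A.w (p.1.2 0) l m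
          + pderiv l (fun v => A.w v j m) (p.1.2 0) * A.w (p.1.2 0) l i
          + pderiv l (fun v => A.w v m i) (p.1.2 0) * A.w (p.1.2 0) l j = _
        ring
      mixed := fun i j m r => by
        rw [hJ] at hkill ⊢
        exact L.flat_mixed hflat _ hw hd hkill i j m r
      quadratic := fun i j m r s => by
        rw [hJ]
        exact L.flat_quadratic hflat _ i j m r s }
  have h1 := h0.map (φ := evalJet (constJet hu))
  rw [toJet_map_evalJet] at h1
  exact h1

end HydroOp

end SmoothMetric

/-- Quadratic forms in two variables. -/
def IsBiquadratic (F : ℝ → ℝ → ℝ) : Prop :=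
  ∃ p q r, ∀ μ ν, F μ ν = μ ^ 2 * p + μ * ν * q + ν ^ 2 * r

/-! ### Quadratic dependence on the pencil parameters -/

namespace IsBiquadratic

theorem mul (a b c d : ℝ) : IsBiquadratic fun μ ν => (μ * a + ν * b) * (μ * c + ν * d) :=
  ⟨a * c, a * d + b * c, b * d, fun μ ν => by ring⟩

theorem add {F G : ℝ → ℝ → ℝ} (hF : IsBiquadratic F) (hG : IsBiquadratic G) :
    IsBiquadratic fun μ ν => F μ ν + G μ ν := by
  obtain ⟨p, q, r, h⟩ := hF
  obtain ⟨p', q', r', h'⟩ := hG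
  exact ⟨p + p', q + q', r + r', fun μ ν => by simp only [h, h']; ring⟩

theorem sub {F G : ℝ → ℝ → ℝ} (hF : IsBiquadratic F) (hG : IsBiquadratic G) :
    IsBiquadratic fun μ ν => F μ ν - G μ ν := by
  obtain ⟨p, q, r, h⟩ := hF
  obtain ⟨p', q', r', h'⟩ := hG
  exact ⟨p - p', q - q', r - r', fun μ ν => by simp only [h, h']; ring⟩

theorem sum {ι : Type*} (s : Finset ι) {F : ι → ℝ → ℝ → ℝ} (hF : ∀ i, IsBiquadratic (F i)) :
    IsBiquadratic fun μ ν => ∑ i ∈ s, F i μ ν := by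
  choose p q r h using hF
  refine ⟨∑ i ∈ s, p i, ∑ i ∈ s, q i, ∑ i ∈ s, r i, fun μ ν => ?_⟩
  simp only [h, Finset.sum_add_distrib, Finset.mul_sum]

/-- The value at `(1, 0)` gives `p`; half the difference and half the sum of the values at `(1, ±δ)`
give `q` and `r`. -/
theorem eq_zero {F : ℝ → ℝ → ℝ} (hF : IsBiquadratic F) {δ : ℝ} (hδ : δ ≠ 0) (h0 : F 1 0 = 0)
    (h1 : F 1 δ = 0) (h2 : F 1 (-δ) = 0) (μ ν : ℝ) : F μ ν = 0 := by
  obtain ⟨p, q, r, h⟩ := hF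
  rw [h] at h0 h1 h2 ⊢
  have hp : p = 0 := by linarith
  have hq : δ * q = 0 := by linarith
  have hr : δ ^ 2 * r = 0 := by linarith
  rw [hp, (mul_eq_zero.1 hq).resolve_left hδ,
    (mul_eq_zero.1 hr).resolve_left (pow_ne_zero 2 hδ)]
  ring

end IsBiquadratic

namespace CoeffJet

variable {n : ℕ}

/-- Linear combinations of jets. -/
def linComb (μ : ℝ) (J : CoeffJet n ℝ) (ν : ℝ) (K : CoeffJet n ℝ) : CoeffJet n ℝ where
  g i j := μ * J.g i j + ν * K.g i j
  dg i j l := μ * J.dg i j l + ν * K.dg i j l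
  b i j k := μ * J.b i j k + ν * K.b i j k
  db i j k l := μ * J.db i j k l + ν * K.db i j k l
  w i j := μ * J.w i j + ν * K.w i j
  dw i j l := μ * J.dw i j l + ν * K.dw i j l
  ddw i j l r := μ * J.ddw i j l r + ν * K.ddw i j l r

variable {J K : CoeffJet n ℝ}

theorem IsSkew.linComb (hJ : J.IsSkew) (hK : K.IsSkew) (μ ν : ℝ) :
    (CoeffJet.linComb μ J ν K).IsSkew where
  g_symm i j := by
    simp only [CoeffJet.linComb]
    rw [hJ.g_symm, hK.g_symm]
  dg_eq i j l := by
    simp only [CoeffJet.linComb, hJ.dg_eq, hK.dg_eq]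
    ring
  w_skew i j := by
    simp only [CoeffJet.linComb]
    rw [hJ.w_skew, hK.w_skew]
    ring

theorem linComb_curl (μ ν : ℝ) (i j l r : Fin n) :
    (linComb μ J ν K).curl i j l r = μ * J.curl i j l r + ν * K.curl i j l r := by
  simp only [curl, linComb]
  ring

/-- Every Jacobi condition is bilinear in the coefficient jet, so its defect is a binary quadratic
form in `μ`, `ν`. Three members of the pencil thus control all of them, without any non-degeneracy.
-/
theorem isJacobi_linComb {δ : ℝ} (hδ : δ ≠ 0) (h0 : (linComb 1 J 0 K).IsJacobi)
    (h1 : (linComb 1 J δ K).IsJacobi) (h2 : (linComb 1 J (-δ) K).IsJacobi) (μ ν : ℝ) :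
    (linComb μ J ν K).IsJacobi := by
  have hm := IsBiquadratic.mul
  have hkill : ∀ i j m, IsBiquadratic fun μ ν => (linComb μ J ν K).killing i j m := fun i j m =>
    .sum _ fun l => ((hm _ _ _ _).sub (hm _ _ _ _)).add (hm _ _ _ _)
  have hquad : ∀ i j m r s, IsBiquadratic fun μ ν => (linComb μ J ν K).quadratic i j m r s := by
    intro i j m r s
    simp only [quadratic, linComb_curl]
    exact .sum _ fun l => ((hm _ _ _ _).add (hm _ _ _ _)).add (hm _ _ _ _)
  have hmixed : ∀ i j m r, IsBiquadratic fun μ ν => (linComb μ J ν K).mixed i j m r := by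
    intro i j m r
    simp only [mixed, linComb_curl]
    exact .sum _ fun l => (((hm _ _ _ _).add (hm _ _ _ _)).add
      ((hm _ _ _ _).add (hm _ _ _ _))).add ((hm _ _ _ _).add (hm _ _ _ _))
  have hdkill : ∀ i j m r, IsBiquadratic fun μ ν => (linComb μ J ν K).dkilling i j m r :=
    fun i j m r => .sum _ fun l => (((hm _ _ _ _).add (hm _ _ _ _)).sub
      ((hm _ _ _ _).add (hm _ _ _ _))).add ((hm _ _ _ _).add (hm _ _ _ _))
  have hcurv : ∀ i j m r, IsBiquadratic fun μ ν => (linComb μ J ν K).curvature i j m r := by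
    intro i j m r
    simp only [curvature, linComb_curl]
    exact .sum _ fun l => ((hm _ _ _ _).sub (hm _ _ _ _)).add (hm _ _ _ _)
  have htors : ∀ i j m, IsBiquadratic fun μ ν => ∑ l, ((linComb μ J ν K).b j i l
      * (linComb μ J ν K).g l m - (linComb μ J ν K).b m i l * (linComb μ J ν K).g l j) :=
    fun i j m => .sum _ fun l => (hm _ _ _ _).sub (hm _ _ _ _)
  have hpois : ∀ i j m, IsBiquadratic fun μ ν => ∑ l, ((linComb μ J ν K).dw i j l
      * (linComb μ J ν K).w l m + (linComb μ J ν K).dw j m l * (linComb μ J ν K).w l i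
      + (linComb μ J ν K).dw m i l * (linComb μ J ν K).w l j) :=
    fun i j m => .sum _ fun l => ((hm _ _ _ _).add (hm _ _ _ _)).add (hm _ _ _ _)
  exact
    { torsion := fun i j m => (htors i j m).eq_zero hδ (h0.torsion i j m) (h1.torsion i j m)
        (h2.torsion i j m) μ ν
      curvature := fun i j m r => (hcurv i j m r).eq_zero hδ (h0.curvature i j m r)
        (h1.curvature i j m r) (h2.curvature i j m r) μ ν
      killing := fun i j m => sub_eq_zero.1 <| ((hkill i j m).sub (hkill j m i)).eq_zero hδ
        (sub_eq_zero.2 (h0.killing i j m)) (sub_eq_zero.2 (h1.killing i j m))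
        (sub_eq_zero.2 (h2.killing i j m)) μ ν
      poisson := fun i j m => (hpois i j m).eq_zero hδ (h0.poisson i j m) (h1.poisson i j m)
        (h2.poisson i j m) μ ν
      mixed := fun i j m r => sub_eq_zero.1 <| ((hdkill i j m r).sub (hmixed i j m r)).eq_zero hδ
        (sub_eq_zero.2 (h0.mixed i j m r)) (sub_eq_zero.2 (h1.mixed i j m r))
        (sub_eq_zero.2 (h2.mixed i j m r)) μ ν
      quadratic := fun i j m r s => ((hquad i j m r s).add (hquad i j m s r)).eq_zero hδ
        (h0.quadratic i j m r s) (h1.quadratic i j m r s) (h2.quadratic i j m r s) μ ν }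

end CoeffJet

/-! ### Pencils of operators -/

section Pencil

variable {n : ℕ} {U : Set (Fin n → ℝ)}

theorem pderiv_linComb (hU : IsOpen U) {f g : (Fin n → ℝ) → ℝ} (hf : ContDiffOn ℝ ∞ f U)
    (hg : ContDiffOn ℝ ∞ g U) (μ ν : ℝ) (l : Fin n) {u : Fin n → ℝ} (hu : u ∈ U) :
    pderiv l (fun v => μ * f v + ν * g v) u = μ * pderiv l f u + ν * pderiv l g u := by
  have h1 := ((hf.contDiffAt (hU.mem_nhds hu)).differentiableAt (by simp)).hasFDerivAt
  have h2 := ((hg.contDiffAt (hU.mem_nhds hu)).differentiableAt (by simp)).hasFDerivAt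
  have h3 := (h1.const_mul μ).add (h2.const_mul ν)
  exact congrArg (fun L : (Fin n → ℝ) →L[ℝ] ℝ => L (Pi.single l 1)) h3.fderiv

theorem pderiv_congr (hU : IsOpen U) {f g : (Fin n → ℝ) → ℝ} (h : ∀ u ∈ U, f u = g u)
    (l : Fin n) {u : Fin n → ℝ} (hu : u ∈ U) : pderiv l f u = pderiv l g u := by
  have h1 : f =ᶠ[nhds u] g := Filter.eventuallyEq_of_mem (hU.mem_nhds hu) h
  rw [pderiv, pderiv, h1.fderiv_eq]

theorem isOpen_nondegLocus (hU : IsOpen U) {g : (Fin n → ℝ) → Matrix (Fin n) (Fin n) ℝ}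
    (hg : ∀ i j, ContDiffOn ℝ ∞ (fun u => g u i j) U) : IsOpen (nondegLocus U g) :=
  (contDiffOn_matrix_det hg).continuousOn.isOpen_inter_preimage hU isOpen_ne

theorem nondegLocus_subset (U : Set (Fin n → ℝ)) (g : (Fin n → ℝ) → Matrix (Fin n) (Fin n) ℝ) :
    nondegLocus U g ⊆ U := fun _ h => h.1

namespace HydroOp

theorem IsSmoothOn.mono {A : HydroOp n} {V : Set (Fin n → ℝ)} (hA : A.IsSmoothOn U)
    (h : V ⊆ U) : A.IsSmoothOn V :=
  ⟨fun i j => (hA.g i j).mono h, fun i j k => (hA.b i j k).mono h, fun i j => (hA.w i j).mono h⟩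

theorem IsSmoothOn.linComb {A B : HydroOp n} (hA : A.IsSmoothOn U) (hB : B.IsSmoothOn U)
    (μ ν : ℝ) : (linComb μ A ν B).IsSmoothOn U where
  g i j := (contDiffOn_const.mul (hA.g i j)).add (contDiffOn_const.mul (hB.g i j))
  b i j k := (contDiffOn_const.mul (hA.b i j k)).add (contDiffOn_const.mul (hB.b i j k))
  w i j := (contDiffOn_const.mul (hA.w i j)).add (contDiffOn_const.mul (hB.w i j))

theorem jet_linComb (hU : IsOpen U) {A B : HydroOp n} (hA : A.IsSmoothOn U) (hB : B.IsSmoothOn U)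
    (μ ν : ℝ) {u : Fin n → ℝ} (hu : u ∈ U) :
    (linComb μ A ν B).jet u = CoeffJet.linComb μ (A.jet u) ν (B.jet u) := by
  have hddw : ∀ i j l r, pderiv r (pderiv l fun v => μ * A.w v i j + ν * B.w v i j) u
      = μ * pderiv r (pderiv l fun v => A.w v i j) u
        + ν * pderiv r (pderiv l fun v => B.w v i j) u := fun i j l r => by
    rw [pderiv_congr hU (fun v hv => pderiv_linComb hU (hA.w i j) (hB.w i j) μ ν l hv) r hu]
    exact pderiv_linComb hU (contDiffOn_pderiv hU (hA.w i j) l)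
      (contDiffOn_pderiv hU (hB.w i j) l) μ ν r hu
  exact CoeffJet.ext rfl
    (funext fun i => funext fun j => funext fun l =>
      pderiv_linComb hU (hA.g i j) (hB.g i j) μ ν l hu)
    rfl
    (funext fun i => funext fun j => funext fun k => funext fun l =>
      pderiv_linComb hU (hA.b i j k) (hB.b i j k) μ ν l hu)
    rfl
    (funext fun i => funext fun j => funext fun l =>
      pderiv_linComb hU (hA.w i j) (hB.w i j) μ ν l hu)
    (funext fun i => funext fun j => funext fun l => funext fun r => hddw i j l r)

theorem pencil_g (A B : HydroOp n) (μ : ℝ) : pencil A.g B.g μ = (linComb 1 A μ B).g := by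
  funext u
  simp [pencil, linComb]

theorem pencil_w (A B : HydroOp n) (μ : ℝ) : pencil A.w B.w μ = (linComb 1 A μ B).w := by
  funext u
  simp [pencil, linComb]

theorem isPoissonOn_of_jet {A : HydroOp n} (h1 : ∀ u ∈ U, (A.jet u).IsSkew)
    (h2 : ∀ u ∈ U, (A.jet u).IsPreJacobi) : IsPoissonOn U A.w where
  skew u hu := (h1 u hu).w_skew
  jacobi u hu i j k := by
    have h3 := (h2 u hu).poisson i j k
    have h4 : ∀ i j, A.w u i j = -A.w u j i := (h1 u hu).w_skew
    rw [← neg_eq_zero, ← Finset.sum_neg_distrib] at h3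
    rw [← h3]
    refine Finset.sum_congr rfl fun s _ => ?_
    rw [h4 i s, h4 j s, h4 k s]
    change _ = -(pderiv s (fun v => A.w v i j) u * A.w u s k
      + pderiv s (fun v => A.w v j k) u * A.w u s i + pderiv s (fun v => A.w v k i) u * A.w u s j)
    ring

theorem isKillingYanoOn_of_jet {V : Set (Fin n → ℝ)} (hV : IsOpen V) {A : HydroOp n}
    (hA : A.IsSmoothOn V) (hdet : A.IsNondegenerate V) (h1 : ∀ u ∈ V, (A.jet u).IsSkew)
    (h2 : ∀ u ∈ V, (A.jet u).IsPreJacobi) : IsKillingYanoOn V A.g A.w where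
  skew u hu := (h1 u hu).w_skew
  killing u hu i j k := by
    have hb := fun u hu => (A.metric_of_isPreJacobi hV hA hdet h1 h2 (u := u) hu).1
    have hK := fun i j k => A.contraCovDeriv_eq_killing hV hA hdet (fun u hu => (h1 u hu).g_symm)
      (fun u hu => (h1 u hu).w_skew) hb hu i j k
    -- Negation is written as a linear combination so that `pderiv_linComb` also differentiates the
    -- skewness relation.
    have hw : ∀ i j, ∀ v ∈ V, A.w v i j = (-1) * A.w v j i + 0 * A.w v j i := fun i j v hv => by
      have : A.w v i j = -A.w v j i := (h1 v hv).w_skew i j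
      rw [this]
      ring
    have hdw : ∀ i j l, (A.jet u).dw i j l = -(A.jet u).dw j i l := fun i j l => by
      refine (pderiv_congr hV (hw i j) l hu).trans ?_
      rw [pderiv_linComb hV (hA.w j i) (hA.w j i) (-1) 0 l hu]
      change _ = -pderiv l (fun v => A.w v j i) u
      ring
    have h3 : (A.jet u).killing j i k = -(A.jet u).killing j k i := by
      rw [CoeffJet.killing, CoeffJet.killing, ← Finset.sum_neg_distrib]
      refine Finset.sum_congr rfl fun l _ => ?_
      rw [hdw i k l]
      ring
    rw [hK, hK, h3, (h2 u hu).killing i j k, add_neg_cancel]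

end HydroOp

end Pencil

/-- The determinant is continuous in the parameter and nonzero at `0`. -/
theorem exists_pos_det_add_smul_ne_zero {n : ℕ} {M N : Matrix (Fin n) (Fin n) ℝ}
    (hM : M.det ≠ 0) : ∃ δ : ℝ, δ ≠ 0 ∧ (M + δ • N).det ≠ 0 ∧ (M + (-δ) • N).det ≠ 0 := by
  have hc : Continuous fun t : ℝ => (M + t • N).det := by fun_prop
  have h0 : ∀ᶠ t : ℝ in nhds 0, (M + t • N).det ≠ 0 :=
    hc.continuousAt.eventually_ne (by simpa using hM)
  obtain ⟨ε, hε, h⟩ := Metric.eventually_nhds_iff.1 h0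
  refine ⟨ε / 2, by positivity, h ?_, h ?_⟩ <;>
  · simp only [dist_zero_right, norm_neg, Real.norm_eq_abs]
    rw [abs_of_pos (by positivity)]
    linarith

/-! ### The two implications -/

namespace HydroOp

variable {n : ℕ} {U : Set (Fin n → ℝ)}

/-- On the locus where `A + μ B` is non-degenerate its `b` is `Γ_μ`, and `b` is linear in `μ` by
construction. The curvature relation reads `0 = 0 + μ 0`. -/
theorem isBiPencil_of_areCompatible (hU : IsOpen U) {A B : HydroOp n}
    (hAsmooth : A.IsSmoothOn U) (hBsmooth : B.IsSmoothOn U)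
    (hAnondeg : A.IsNondegenerate U) (hBnondeg : B.IsNondegenerate U)
    (hA : A.IsHamiltonian U) (hB : B.IsHamiltonian U) (h : AreCompatible A B U) :
    IsBiPencil U A.g B.g A.w B.w := by
  have hAm := fun u hu => A.metric_of_isPreJacobi hU hAsmooth hAnondeg (hA.jet hU hAsmooth).1
    (hA.jet hU hAsmooth).2 (u := u) hu
  have hBm := fun u hu => B.metric_of_isPreJacobi hU hBsmooth hBnondeg (hB.jet hU hBsmooth).1
    (hB.jet hU hBsmooth).2 (u := u) hu
  have hC := fun μ : ℝ => hAsmooth.linComb hBsmooth 1 μ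
  have hCj := fun μ : ℝ => (h 1 μ).jet hU (hC μ)
  have hV := fun μ : ℝ => isOpen_nondegLocus hU (hC μ).g
  have hCV := fun μ : ℝ => (hC μ).mono (nondegLocus_subset U (linComb 1 A μ B).g)
  have hdet : ∀ μ : ℝ, (linComb 1 A μ B).IsNondegenerate
      (nondegLocus U (linComb 1 A μ B).g) := fun μ u hu => hu.2
  have hs : ∀ μ : ℝ, ∀ u ∈ nondegLocus U (linComb 1 A μ B).g,
      ((linComb 1 A μ B).jet u).IsSkew := fun μ u hu => (hCj μ).1 u hu.1
  have hp : ∀ μ : ℝ, ∀ u ∈ nondegLocus U (linComb 1 A μ B).g,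
      ((linComb 1 A μ B).jet u).IsPreJacobi := fun μ u hu => (hCj μ).2 u hu.1
  have hCm := fun μ u hu => (linComb 1 A μ B).metric_of_isPreJacobi (hV μ) (hCV μ) (hdet μ)
    (hs μ) (hp μ) (u := u) hu
  refine ⟨⟨fun μ u hu i j k => ?_, fun μ u hu i j k l => ?_⟩, fun μ => ?_, fun μ => ?_⟩
  · rw [pencil_g] at hu ⊢
    rw [← (hCm μ u hu).1, ← (hAm u hu.1).1, ← (hBm u hu.1).1]
    simp [linComb]
  · rw [pencil_g] at hu ⊢
    rw [(hCm μ u hu).2, (hAm u hu.1).2, (hBm u hu.1).2]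
    ring
  · rw [pencil_w]
    exact isPoissonOn_of_jet (hCj μ).1 (hCj μ).2
  · rw [pencil_w, pencil_g]
    exact isKillingYanoOn_of_jet (hV μ) (hCV μ) (hdet μ) (hs μ) (hp μ)

theorem areCompatible_of_isBiPencil (hU : IsOpen U) {A B : HydroOp n}
    (hAsmooth : A.IsSmoothOn U) (hBsmooth : B.IsSmoothOn U)
    (hAnondeg : A.IsNondegenerate U) (hBnondeg : B.IsNondegenerate U)
    (hA : A.IsHamiltonian U) (hB : B.IsHamiltonian U) (h : IsBiPencil U A.g B.g A.w B.w) :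
    AreCompatible A B U := by
  have hAj := hA.jet hU hAsmooth
  have hBj := hB.jet hU hBsmooth
  have hAm := fun u hu => A.metric_of_isPreJacobi hU hAsmooth hAnondeg hAj.1 hAj.2 (u := u) hu
  have hBm := fun u hu => B.metric_of_isPreJacobi hU hBsmooth hBnondeg hBj.1 hBj.2 (u := u) hu
  have hskew : ∀ μ ν : ℝ, ∀ u ∈ U, ((linComb μ A ν B).jet u).IsSkew := fun μ ν u hu => by
    rw [jet_linComb hU hAsmooth hBsmooth μ ν hu]
    exact (hAj.1 u hu).linComb (hBj.1 u hu) μ ν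
  -- The locus is open, so the geometric criterion applies on it. Flatness of `g_A + t g_B` follows
  -- from the pencil relation, since the Hamiltonian operators `A` and `B` have flat metrics.
  have key : ∀ u ∈ U, ∀ t : ℝ, (A.g u + t • B.g u).det ≠ 0 →
      (CoeffJet.linComb 1 (A.jet u) t (B.jet u)).IsJacobi := by
    intro u hu t ht
    rw [← jet_linComb hU hAsmooth hBsmooth 1 t hu]
    have hC := hAsmooth.linComb hBsmooth 1 t
    have hsub := nondegLocus_subset U (linComb 1 A t B).g
    refine (linComb 1 A t B).isJacobi_of_metric (V := nondegLocus U (linComb 1 A t B).g)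
      (isOpen_nondegLocus hU hC.g) (hC.mono hsub) (fun v hv => hv.2)
      (fun v hv => (hskew 1 t v hv.1).g_symm) (fun v hv i j k => ?_) (fun v hv i j k l => ?_)
      ?_ ?_ ⟨hu, ?_⟩
    · have h1 := h.metric.christoffel t v (by rw [pencil_g]; exact hv) i j k
      rw [pencil_g, ← (hAm v hv.1).1, ← (hBm v hv.1).1] at h1
      rw [h1]
      simp [linComb]
    · have h1 := h.metric.curvature t v (by rw [pencil_g]; exact hv) i j k l
      rw [pencil_g, (hAm v hv.1).2, (hBm v hv.1).2] at h1
      rw [h1]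
      ring
    · have h1 := h.killingYano t
      rwa [pencil_g, pencil_w] at h1
    · have h1 := h.poisson t
      rw [pencil_w] at h1
      exact ⟨fun v hv => h1.skew v hv.1, fun v hv => h1.jacobi v hv.1⟩
    · rw [← pencil_g]
      exact ht
  intro μ ν
  refine isHamiltonian_of_jet _ hU (hAsmooth.linComb hBsmooth μ ν) (hskew μ ν) fun u hu => ?_
  rw [jet_linComb hU hAsmooth hBsmooth μ ν hu]
  -- The size of `δ` depends on the point `u`, which is harmless since the conditions are pointwise.
  obtain ⟨δ, hδ, h1, h2⟩ := exists_pos_det_add_smul_ne_zero (N := B.g u) (hAnondeg u hu)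
  exact CoeffJet.isJacobi_linComb hδ (key u hu 0 (by simpa using hAnondeg u hu)) (key u hu δ h1)
    (key u hu (-δ) h2) μ ν

end HydroOp

theorem mainTheorem4 (n : ℕ) (U : Set (Fin n → ℝ)) (hU : IsOpen U) (A B : HydroOp n)
    (hAsmooth : A.IsSmoothOn U) (hBsmooth : B.IsSmoothOn U)
    (hAnondeg : A.IsNondegenerate U) (hBnondeg : B.IsNondegenerate U)
    (hA : A.IsHamiltonian U) (hB : B.IsHamiltonian U) :
    HydroOp.AreCompatible A B U ↔ IsBiPencil U A.g B.g A.w B.w :=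
  ⟨HydroOp.isBiPencil_of_areCompatible hU hAsmooth hBsmooth hAnondeg hBnondeg hA hB,
    HydroOp.areCompatible_of_isBiPencil hU hAsmooth hBsmooth hAnondeg hBnondeg hA hB⟩
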